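/- Let $\mathcal A$ be an essential (i.e. some layer is a point) finite real complexified toric arrangement in $T=(\mathbb C^*)^d$: a finite set of hypertori $\{t\in T: t^{\chi}=a\}$ with $0\neq\chi\in\mathbb Z^d$ and $|a|=1$. Write $M(\mathcal A)=T\setminus\bigcup\mathcal A$, and let $q:\mathbb C^d\to T$, $q(z)=e^{2\pi i z}$, be the universal covering. Layers are the connected components of intersections of elements of $\mathcal A$. Let $\mathcal A^{\upharpoonright}$ be the periodic arrangement of affine hyperplanes in $\mathbb R^d$ lifting $\mathcal A$, and $\mathcal A_0$ the linear arrangement of all its directions. For a layer $L$, let $X_L\subseteq\mathbb R^d$ be the intersection of the hyperplanes of $\mathcal A_0$ associated to the hypertori containing $L$. For a real arrangement $\mathscr H$ with faces ordered by $G\le K$ iff $G\subseteq\overline K$, let $\mathcal S(\mathscr H)$ be the poset of pairs $[G,C]$ with $C$ a chamber and $G\le C$ a face, where $[G',C']\le[G,C]$ iff $G\le G'$ and $C'=C_{G'}$; here $C_{G'}$ is the chamber $\geq G'$ that no hyperplane containing $G'$ separates from $C$. Let $\mathcal F(\mathcal A)=\mathcal F(\mathcal A^{\upharpoonright})/\mathbb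 Z^d$ be the face category of $\mathcal A$. For a face $F$ let $\mathcal A[F]$ be the linear arrangement of directions of the hypertori containing $F$. A morphism $m:F\to G$, lifted to a pair of faces $\tilde F\le\tilde G$ of $\mathcal A^\upharpoonright$, induces $i_m:\mathcal F(\mathcal A[G])\to\mathcal F(\mathcal A[F])$: the face $i_m(K)$ lies on the same side as $K$ of the hyperplanes in $\mathcal A[G]$, and on the same side as $\tilde G$ (seen from $\tilde F$) of the others. Let $\int\mathscr D$ be the Grothendieck construction of the diagram $F\mapsto\mathcal S(\mathcal A[F])$, $m\mapsto([K,C]\mapsto[i_m(K),i_m(C)])$ on $\mathcal F(\mathcal A)^{op}$; its realization is the toric Salvetti complex $\operatorname{Sal}(\mathcal A)$. There is a natural comparison map $\kappa:|\int\mathscr D|\to|\mathcal S(\mathcal A^{\upharpoonright})/\mathbb Z^d|$, sending a vertex $(F,[G,C])$ to the orbit of the pair $[\tilde G,\tilde C]$ seen from a lift of $F$ in the directions $G$, $C$. Every $\mathbb Z^d$-equivariant choice $p$ of points $p([G,C])=a+ib$, with $a\in G$ and $b$ in the open cone of directions lying on the same side as $C$ of all hyperplanes containing $G$, induces by affine extension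 followed by $q$ a map $\iota_p:|\mathcal S(\mathcal A^{\upharpoonright})/\mathbb Z^d|\to M(\mathcal A)$. For a layer $L$ and a face $F_0$ of $\mathcal A_0$ with linear hull $X_L$, let $\mathcal S_{L,F_0}$ be the full subcategory of $\int\mathscr D$ (and the corresponding subcomplex of $\operatorname{Sal}(\mathcal A)$) on the objects $(F,[G,C])$ with $F\subseteq L$ and $C=B_G$ for some chamber $B\ge F_0$ of $\mathcal A[F]$. Let $g\in T$ be such that multiplication by $g$ preserves $\mathcal A$. There are choices $p$ which are equivariant under all real translations that cover elements of $T$ preserving $\mathcal A$. Moreover there is $v\in\mathbb R^d$ with $q(v)=g$, and there are cellular self-maps $\mu'_g$ of $|\mathcal S(\mathcal A^{\upharpoonright})/\mathbb Z^d|$ and $\mu_g$ of $\operatorname{Sal}(\mathcal A)=|\int\mathscr D|$, induced by functors that are given on objects by $[G,C]\mapsto[v+G,v+C]$ and $(F,[G,C])\mapsto(gF,[G,C])$ respectively, such that: 1. $\kappa\mu_g=\mu'_g\kappa$; for every $p$ commuting with the translation by $v$ one has $\iota_p\,\mu'_g=g\cdot\iota_p$; and for every $\mathbb Z^d$-equivariant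 $p$ the maps $\iota_p\,\mu'_g$ and $g\cdot\iota_p$ into $M(\mathcal A)$ are homotopic. 2. For all $L$ and $F_0$ as above, $\mu_g$ maps $\mathcal S_{L,F_0}$ into $\mathcal S_{gL,F_0}$. In particular, if $gL=L$, then $\mu_g$ restricts to a map $\mathcal S_{L,F_0}\to\mathcal S_{L,F_0}$, and this restriction is homotopic to the identity. -/

import Mathlib

open CategoryTheory Opposite Topology Filter
open scoped Pointwise

noncomputable section

namespace ToricSalvetti

/-! ## Arrangements of real affine hyperplanes, sign vectors, faces and Salvetti posets -/

/-- The real vector space `ℝ^d`. -/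
abbrev Vec (d : ℕ) : Type := Fin d → ℝ

/-- Affine forms on `ℝ^d`.  An arrangement of affine hyperplanes is given by a set `E` of
affine forms; the form `f` stands for the hyperplane `f = 0` with positive side `f > 0`. -/
abbrev Form (d : ℕ) : Type := Vec d →ᵃ[ℝ] ℝ

variable {d : ℕ}

/-- The set of all points with the same sign vector as `x`. -/
def signCell (E : Set (Form d)) (x : Vec d) : Set (Vec d) :=
  {y | ∀ f ∈ E, SignType.sign (f y) = SignType.sign (f x)}

/-- The faces of the arrangement `E`. -/
def IsFace (E : Set (Form d)) (F : Set (Vec d)) : Prop := ∃ x, F = signCell E x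

/-- The chambers of the arrangement `E`: the faces that lie on no hyperplane. -/
def IsChamber (E : Set (Form d)) (C : Set (Vec d)) : Prop :=
  IsFace E C ∧ ∀ f ∈ E, ∀ x ∈ C, f x ≠ 0

/-- No hyperplane of `E` containing `G` separates `C` from `C'`.  If `C'` is a chamber with
`G ≤ C'`, this says that `C' = C_G`. -/
def AgreeAt (E : Set (Form d)) (G C C' : Set (Vec d)) : Prop :=
  ∀ f ∈ E, (∀ x ∈ G, f x = 0) →
    ∀ c ∈ C, ∀ c' ∈ C', SignType.sign (f c) = SignType.sign (f c')

/-- The poset of faces of `E`, ordered by inclusion of closures. -/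
@[ext] structure Face (E : Set (Form d)) : Type where
  carrier : Set (Vec d)
  isFace : IsFace E carrier

/-- The Salvetti poset of `E`: all pairs `[G, C]` of a chamber `C` and a face `G ≤ C`. -/
@[ext] structure Sal (E : Set (Form d)) : Type where
  face : Set (Vec d)
  chamber : Set (Vec d)
  isFace : IsFace E face
  isChamber : IsChamber E chamber
  le : face ⊆ closure chamber

section Basic

variable {E : Set (Form d)} {F G : Set (Vec d)}

theorem mem_signCell_self (x : Vec d) : x ∈ signCell E x := fun _ _ => rfl

theorem IsFace.nonempty (h : IsFace E F) : F.Nonempty := by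
  obtain ⟨x, rfl⟩ := h
  exact ⟨x, mem_signCell_self x⟩

theorem IsFace.sign_eq (h : IsFace E F) {x y : Vec d} (hx : x ∈ F) (hy : y ∈ F) {f : Form d}
    (hf : f ∈ E) : SignType.sign (f x) = SignType.sign (f y) := by
  obtain ⟨z, rfl⟩ := h
  rw [hx f hf, hy f hf]

theorem IsFace.eq_signCell (h : IsFace E F) {x : Vec d} (hx : x ∈ F) : F = signCell E x := by
  obtain ⟨z, rfl⟩ := h
  ext y
  exact ⟨fun hy f hf => by rw [hy f hf, hx f hf], fun hy f hf => by rw [hy f hf, hx f hf]⟩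

theorem IsFace.mem (h : IsFace E F) {x y : Vec d} (hx : x ∈ F)
    (hy : ∀ f ∈ E, SignType.sign (f y) = SignType.sign (f x)) : y ∈ F := by
  rw [h.eq_signCell hx]
  exact hy

theorem IsFace.vanish (h : IsFace E F) {x : Vec d} (hx : x ∈ F) {f : Form d} (hf : f ∈ E)
    (h0 : f x = 0) : ∀ y ∈ F, f y = 0 := fun y hy => by
  have := h.sign_eq hx hy hf
  rw [h0, sign_zero] at this
  exact sign_eq_zero_iff.mp this.symm

theorem IsFace.eq_of_mem (hF : IsFace E F) (hG : IsFace E G) {x : Vec d} (hx : x ∈ F)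
    (hx' : x ∈ G) : F = G := by
  rw [hF.eq_signCell hx, hG.eq_signCell hx']

theorem form_add (f : Form d) (x v : Vec d) : f (x + v) = f x + f.linear v := by
  have := f.map_vadd x v
  simp only [vadd_eq_add] at this
  rw [add_comm x v, this, add_comm]

theorem form_sub (f : Form d) (x y : Vec d) : f.linear (x - y) = f x - f y := by
  have := form_add f y (x - y)
  rw [add_sub_cancel] at this
  linarith

theorem form_continuous (f : Form d) : Continuous f := f.continuous_of_finiteDimensional

/-- Inclusion of closures of faces in terms of sign vectors. -/
theorem face_le_iff (hF : IsFace E F) (hG : IsFace E G) {x y : Vec d} (hx : x ∈ F)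
    (hy : y ∈ G) : F ⊆ closure G ↔
      ∀ f ∈ E, f x ≠ 0 → SignType.sign (f x) = SignType.sign (f y) := by
  constructor
  · intro h f hf hne
    have hxc := h hx
    rcases lt_or_gt_of_ne hne with hlt | hgt
    · obtain ⟨z, hz, hzG⟩ := mem_closure_iff.mp hxc {z | f z < 0}
        (isOpen_lt (form_continuous f) continuous_const) hlt
      rw [← hG.sign_eq hzG hy hf, sign_neg hlt, sign_neg hz]
    · obtain ⟨z, hz, hzG⟩ := mem_closure_iff.mp hxc {z | 0 < f z}
        (isOpen_lt continuous_const (form_continuous f)) hgt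
      rw [← hG.sign_eq hzG hy hf, sign_pos hgt, sign_pos hz]
  · intro h x' hx'
    have hx'y : ∀ f ∈ E, f x' ≠ 0 → SignType.sign (f x') = SignType.sign (f y) := by
      intro f hf hne
      have hs := hF.sign_eq hx' hx hf
      rw [hs]
      refine h f hf fun h0 => hne ?_
      rw [h0, sign_zero] at hs
      exact sign_eq_zero_iff.mp hs
    have hseg : ∀ ε : ℝ, 0 < ε → ε ≤ 1 → x' + ε • (y - x') ∈ G := by
      intro ε h0 h1
      refine hG.mem hy fun f hf => ?_
      have hval : f (x' + ε • (y - x')) = (1 - ε) * f x' + ε * f y := by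
        rw [form_add, map_smul, form_sub, smul_eq_mul]; ring
      rw [hval]
      have hs := hx'y f hf
      rcases lt_trichotomy (f x') 0 with hl | he | hg
      · have := hs hl.ne
        rw [sign_neg hl, eq_comm, sign_eq_neg_one_iff] at this
        rw [sign_neg this, sign_neg]
        nlinarith [mul_nonpos_of_nonneg_of_nonpos (sub_nonneg.mpr h1) hl.le,
          mul_neg_of_pos_of_neg h0 this]
      · rw [he, mul_zero, zero_add, sign_mul, sign_pos h0, one_mul]
      · have := hs hg.ne'
        rw [sign_pos hg, eq_comm, sign_eq_one_iff] at this
        rw [sign_pos this, sign_pos]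
        nlinarith [mul_nonneg (sub_nonneg.mpr h1) hg.le, mul_pos h0 this]
    have hc : ContinuousWithinAt (fun ε : ℝ => x' + ε • (y - x')) (Set.Ioc 0 1) 0 := by
      fun_prop
    have h0 : (0 : ℝ) ∈ closure (Set.Ioc (0 : ℝ) 1) := by
      rw [closure_Ioc (by norm_num)]; simp
    have := hc.mem_closure h0 (t := G) (fun ε hε => hseg ε hε.1 hε.2)
    simpa using this

theorem face_le_trans {H : Set (Vec d)} (h : F ⊆ closure G) (h' : G ⊆ closure H) :
    F ⊆ closure H :=
  h.trans (closure_minimal h' isClosed_closure)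

theorem face_le_antisymm (hF : IsFace E F) (hG : IsFace E G) (h : F ⊆ closure G)
    (h' : G ⊆ closure F) : F = G := by
  obtain ⟨x, hx⟩ := hF.nonempty
  obtain ⟨y, hy⟩ := hG.nonempty
  refine hF.eq_of_mem hG hx (hG.mem hy fun f hf => ?_)
  by_cases hx0 : f x = 0
  · by_cases hy0 : f y = 0
    · rw [hx0, hy0]
    · exact ((face_le_iff hG hF hy hx).mp h' f hf hy0).symm
  · exact (face_le_iff hF hG hx hy).mp h f hf hx0

theorem vanish_of_le (hF : IsFace E F) (hG : IsFace E G) (h : F ⊆ closure G) {f : Form d}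
    (hf : f ∈ E) (h0 : ∀ y ∈ G, f y = 0) : ∀ x ∈ F, f x = 0 := by
  intro x hx
  obtain ⟨y, hy⟩ := hG.nonempty
  by_contra hne
  have := (face_le_iff hF hG hx hy).mp h f hf hne
  rw [h0 y hy, sign_zero] at this
  exact hne (sign_eq_zero_iff.mp this)

instance : PartialOrder (Face E) where
  le F G := F.carrier ⊆ closure G.carrier
  le_refl _ := subset_closure
  le_trans _ _ _ h h' := face_le_trans h h'
  le_antisymm F G h h' := Face.ext (face_le_antisymm F.isFace G.isFace h h')

theorem Face.le_def {F G : Face E} : F ≤ G ↔ F.carrier ⊆ closure G.carrier := Iff.rfl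

/-- The order of the Salvetti poset: `[G', C'] ≤ [G, C]` if `G ≤ G'` and `C' = C_{G'}`. -/
instance : PartialOrder (Sal E) where
  le x y := y.face ⊆ closure x.face ∧ AgreeAt E x.face x.chamber y.chamber
  le_refl x := ⟨subset_closure, fun _ hf _ _ hc _ hc' => x.isChamber.1.sign_eq hc hc' hf⟩
  le_trans x y z h h' := ⟨face_le_trans h'.1 h.1, fun f hf h0 c hc c' hc' => by
    obtain ⟨b, hb⟩ := y.isChamber.1.nonempty
    rw [h.2 f hf h0 c hc b hb,
      h'.2 f hf (vanish_of_le y.isFace x.isFace h.1 hf h0) b hb c' hc']⟩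
  le_antisymm x y h h' := by
    have hface : x.face = y.face := face_le_antisymm x.isFace y.isFace h'.1 h.1
    refine Sal.ext hface ?_
    obtain ⟨a, ha⟩ := x.isFace.nonempty
    obtain ⟨c, hc⟩ := x.isChamber.1.nonempty
    obtain ⟨c', hc'⟩ := y.isChamber.1.nonempty
    refine x.isChamber.1.eq_of_mem y.isChamber.1 hc (y.isChamber.1.mem hc' fun f hf => ?_)
    by_cases h0 : f a = 0
    · exact h.2 f hf (x.isFace.vanish ha hf h0) c hc c' hc'
    · rw [← (face_le_iff x.isFace x.isChamber.1 ha hc).mp x.le f hf h0,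
        (face_le_iff y.isFace y.isChamber.1 (hface ▸ ha) hc').mp y.le f hf h0]

theorem Sal.le_def {x y : Sal E} :
    x ≤ y ↔ y.face ⊆ closure x.face ∧ AgreeAt E x.face x.chamber y.chamber := Iff.rfl

end Basic

/-! ## Local arrangements, and the passage from a local arrangement to the whole one -/

/-- The linear arrangement of (the directions of) all hyperplanes of `E` containing `W`. -/
def localForms (E : Set (Form d)) (W : Set (Vec d)) : Set (Form d) :=
  {h | ∃ f ∈ E, (∀ x ∈ W, f x = 0) ∧ h = f.linear.toAffineMap}

/-- The points whose sign agrees with `K` (a face of the local arrangement at `W`)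
on the hyperplanes containing `W`, and with `W` on all the others. -/
def glue (E : Set (Form d)) (W K : Set (Vec d)) : Set (Vec d) :=
  {u | ∃ w ∈ W, ∃ v ∈ K, ∀ f ∈ E, SignType.sign (f u) =
    if f w = 0 then SignType.sign (f.linear v) else SignType.sign (f w)}

/-- Moving a little does not change the non-zero signs. -/
def LocFin (E : Set (Form d)) : Prop :=
  ∀ x v : Vec d, ∀ᶠ ε in 𝓝[>] (0 : ℝ), ∀ f ∈ E, f x ≠ 0 →
    SignType.sign (f (x + ε • v)) = SignType.sign (f x)

/-- `E₂` is the local arrangement of `E₁` at the (part of a) face `W`. -/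
structure IsLocal (E₁ E₂ : Set (Form d)) (W : Set (Vec d)) : Prop where
  locFin : LocFin E₁
  nonempty : W.Nonempty
  const : ∀ w ∈ W, ∀ w' ∈ W, ∀ f ∈ E₁, SignType.sign (f w) = SignType.sign (f w')
  eq : E₂ = localForms E₁ W

section Glue

variable {E₁ E₂ E₃ : Set (Form d)} {W W₁ W₂ W₃ K K' : Set (Vec d)}

theorem sign_zero_iff {a b : ℝ} (h : SignType.sign a = SignType.sign b) : a = 0 ↔ b = 0 := by
  rw [← sign_eq_zero_iff, h, sign_eq_zero_iff]

theorem IsLocal.vanish (h : IsLocal E₁ E₂ W) {w : Vec d} (hw : w ∈ W) {f : Form d}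
    (hf : f ∈ E₁) (h0 : f w = 0) : ∀ x ∈ W, f x = 0 := fun x hx =>
  (sign_zero_iff (h.const w hw x hx f hf)).mp h0

theorem IsLocal.linear_mem (h : IsLocal E₁ E₂ W) {w : Vec d} (hw : w ∈ W) {f : Form d}
    (hf : f ∈ E₁) (h0 : f w = 0) : f.linear.toAffineMap ∈ E₂ := by
  rw [h.eq]
  exact ⟨f, hf, h.vanish hw hf h0, rfl⟩

theorem IsLocal.exists_mem (h : IsLocal E₁ E₂ W) (hK : IsFace E₂ K) :
    ∃ u, u ∈ glue E₁ W K := by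
  obtain ⟨w, hw⟩ := h.nonempty
  obtain ⟨v, hv⟩ := hK.nonempty
  obtain ⟨ε, hε, h0⟩ := ((h.locFin w v).and self_mem_nhdsWithin).exists
  refine ⟨w + ε • v, w, hw, v, hv, fun f hf => ?_⟩
  split_ifs with h1
  · rw [form_add, h1, zero_add, map_smul, smul_eq_mul, sign_mul, sign_pos h0, one_mul]
  · exact hε f hf h1

theorem IsLocal.mem_glue_iff (h : IsLocal E₁ E₂ W) (hK : IsFace E₂ K) {w v u : Vec d}
    (hw : w ∈ W) (hv : v ∈ K) : u ∈ glue E₁ W K ↔ ∀ f ∈ E₁, SignType.sign (f u) =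
      if f w = 0 then SignType.sign (f.linear v) else SignType.sign (f w) := by
  constructor
  · rintro ⟨w', hw', v', hv', hu⟩ f hf
    rw [hu f hf]
    have hs := h.const w' hw' w hw f hf
    by_cases h0 : f w = 0
    · rw [if_pos h0, if_pos ((sign_zero_iff hs).mpr h0)]
      exact hK.sign_eq hv' hv (h.linear_mem hw hf h0)
    · rw [if_neg h0, if_neg (fun h1 => h0 ((sign_zero_iff hs).mp h1)), hs]
  · intro hu
    exact ⟨w, hw, v, hv, hu⟩

theorem IsLocal.isFace (h : IsLocal E₁ E₂ W) (hK : IsFace E₂ K) : IsFace E₁ (glue E₁ W K) := by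
  obtain ⟨u, hu⟩ := h.exists_mem hK
  refine ⟨u, ?_⟩
  obtain ⟨w, hw⟩ := h.nonempty
  obtain ⟨v, hv⟩ := hK.nonempty
  have hu' := (h.mem_glue_iff hK hw hv).mp hu
  ext y
  rw [h.mem_glue_iff hK hw hv]
  exact forall₂_congr fun f hf => by rw [hu' f hf]

theorem IsLocal.le (h : IsLocal E₁ E₂ W) (hK : IsFace E₂ K) (hK' : IsFace E₂ K')
    (hle : K ⊆ closure K') : glue E₁ W K ⊆ closure (glue E₁ W K') := by
  obtain ⟨u, hu⟩ := h.exists_mem hK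
  obtain ⟨u', hu'⟩ := h.exists_mem hK'
  obtain ⟨w, hw⟩ := h.nonempty
  obtain ⟨v, hv⟩ := hK.nonempty
  obtain ⟨v', hv'⟩ := hK'.nonempty
  refine (face_le_iff (h.isFace hK) (h.isFace hK') hu hu').mpr fun f hf hne => ?_
  have h1 := (h.mem_glue_iff hK hw hv).mp hu f hf
  have h2 := (h.mem_glue_iff hK' hw hv').mp hu' f hf
  rw [h1, h2]
  by_cases h0 : f w = 0
  · rw [if_pos h0] at h1
    rw [if_pos h0, if_pos h0]
    exact (face_le_iff hK hK' hv hv').mp hle _ (h.linear_mem hw hf h0)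
      (fun hz => hne ((sign_zero_iff h1).mpr hz))
  · rw [if_neg h0, if_neg h0]

theorem IsLocal.isChamber (h : IsLocal E₁ E₂ W) (hK : IsChamber E₂ K) :
    IsChamber E₁ (glue E₁ W K) := by
  refine ⟨h.isFace hK.1, fun f hf u hu => ?_⟩
  obtain ⟨w, hw⟩ := h.nonempty
  obtain ⟨v, hv⟩ := hK.1.nonempty
  have h1 := (h.mem_glue_iff hK.1 hw hv).mp hu f hf
  by_cases h0 : f w = 0
  · rw [if_pos h0] at h1
    exact fun hz => hK.2 _ (h.linear_mem hw hf h0) v hv ((sign_zero_iff h1).mp hz)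
  · rw [if_neg h0] at h1
    exact fun hz => h0 ((sign_zero_iff h1).mp hz)

/-- The order-preserving map `[K, C] ↦ [i(K), i(C)]` from the Salvetti poset of a local
arrangement, where `i = glue E₁ W`. -/
def IsLocal.push (h : IsLocal E₁ E₂ W) : Sal E₂ →o Sal E₁ where
  toFun x :=
    { face := glue E₁ W x.face
      chamber := glue E₁ W x.chamber
      isFace := h.isFace x.isFace
      isChamber := h.isChamber x.isChamber
      le := h.le x.isFace x.isChamber.1 x.le }
  monotone' x y hxy := by
    refine ⟨h.le y.isFace x.isFace hxy.1, fun f hf hz c hc c' hc' => ?_⟩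
    obtain ⟨w, hw⟩ := h.nonempty
    obtain ⟨v, hv⟩ := x.isFace.nonempty
    obtain ⟨u, hu⟩ := h.exists_mem x.isFace
    obtain ⟨b, hb⟩ := x.isChamber.1.nonempty
    obtain ⟨b', hb'⟩ := y.isChamber.1.nonempty
    have h1 := (h.mem_glue_iff x.isFace hw hv).mp hu f hf
    have h2 := (h.mem_glue_iff x.isChamber.1 hw hb).mp hc f hf
    have h3 := (h.mem_glue_iff y.isChamber.1 hw hb').mp hc' f hf
    have h0 : f w = 0 := by
      by_contra h0
      rw [if_neg h0] at h1
      exact h0 ((sign_zero_iff h1).mp (hz u hu))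
    rw [if_pos h0] at h1 h2 h3
    rw [h2, h3]
    have hlin := h.linear_mem hw hf h0
    exact hxy.2 _ hlin (x.isFace.vanish hv hlin ((sign_zero_iff h1).mp (hz u hu))) b hb b' hb'

theorem IsLocal.push_face (h : IsLocal E₁ E₂ W) (x : Sal E₂) :
    (h.push x).face = glue E₁ W x.face := rfl

theorem IsLocal.push_chamber (h : IsLocal E₁ E₂ W) (x : Sal E₂) :
    (h.push x).chamber = glue E₁ W x.chamber := rfl

theorem glue_glue (h₁ : IsLocal E₁ E₂ W₁) (h₂ : IsLocal E₂ E₃ W₂) (h₃ : IsLocal E₁ E₃ W₃)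
    (hc : ∀ f ∈ E₁, ∀ w₁ ∈ W₁, ∀ w₂ ∈ W₂, ∀ w₃ ∈ W₃, SignType.sign (f w₃) =
      if f w₁ = 0 then SignType.sign (f.linear w₂) else SignType.sign (f w₁))
    (hK : IsFace E₃ K) : glue E₁ W₁ (glue E₂ W₂ K) = glue E₁ W₃ K := by
  obtain ⟨w₁, hw₁⟩ := h₁.nonempty
  obtain ⟨w₂, hw₂⟩ := h₂.nonempty
  obtain ⟨w₃, hw₃⟩ := h₃.nonempty
  obtain ⟨v, hv⟩ := hK.nonempty
  obtain ⟨v', hv'⟩ := h₂.exists_mem hK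
  have hv'' := (h₂.mem_glue_iff hK hw₂ hv).mp hv'
  ext u
  rw [h₁.mem_glue_iff (h₂.isFace hK) hw₁ hv', h₃.mem_glue_iff hK hw₃ hv]
  refine forall₂_congr fun f hf => ?_
  have hcc := hc f hf w₁ hw₁ w₂ hw₂ w₃ hw₃
  by_cases h0 : f w₁ = 0
  · have h4 := hv'' _ (h₁.linear_mem hw₁ hf h0)
    rw [if_pos h0] at hcc ⊢
    by_cases h5 : f.linear w₂ = 0
    · have h6 : SignType.sign (f.linear v') = SignType.sign (f.linear v) := h4.trans (if_pos h5)
      rw [if_pos ((sign_zero_iff hcc).mpr h5), h6]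
    · have h6 : SignType.sign (f.linear v') = SignType.sign (f.linear w₂) := h4.trans (if_neg h5)
      rw [if_neg (fun hz => h5 ((sign_zero_iff hcc).mp hz)), h6, hcc]
  · rw [if_neg h0] at hcc ⊢
    rw [if_neg (fun hz => h0 ((sign_zero_iff hcc).mp hz)), hcc]

theorem push_push (h₁ : IsLocal E₁ E₂ W₁) (h₂ : IsLocal E₂ E₃ W₂) (h₃ : IsLocal E₁ E₃ W₃)
    (hc : ∀ f ∈ E₁, ∀ w₁ ∈ W₁, ∀ w₂ ∈ W₂, ∀ w₃ ∈ W₃, SignType.sign (f w₃) =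
      if f w₁ = 0 then SignType.sign (f.linear w₂) else SignType.sign (f w₁))
    (x : Sal E₃) : h₁.push (h₂.push x) = h₃.push x :=
  Sal.ext (glue_glue h₁ h₂ h₃ hc x.isFace) (glue_glue h₁ h₂ h₃ hc x.isChamber.1)

end Glue

/-! ## The quotient of a poset by a group action, as a category -/

/-- The quotient category `P / Γ` of a poset by a free action of a group by order automorphisms.
Its objects are the orbits.  Its morphisms are the orbits of pairs `x ≤ y`; if the action is free,
each such orbit has exactly one member in which `y` is the chosen representative `rep Y` of its
orbit, and this member is recorded by the element `k` of `Γ` with `x = k + rep X`. -/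
structure OrbitCat (Γ P : Type) [AddCommGroup Γ] [AddAction Γ P] : Type where
  orbit : AddAction.orbitRel.Quotient Γ P

namespace OrbitCat

variable {Γ P : Type} [AddCommGroup Γ] [AddAction Γ P]

/-- The orbit of `x`. -/
def mk' (Γ : Type) {P : Type} [AddCommGroup Γ] [AddAction Γ P] (x : P) : OrbitCat Γ P :=
  ⟨Quotient.mk'' x⟩

/-- The chosen representative of an orbit. -/
def rep (X : OrbitCat Γ P) : P := Quotient.out X.orbit

theorem exists_vadd_eq_rep (Γ : Type) {P : Type} [AddCommGroup Γ] [AddAction Γ P] (x : P) :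
    ∃ k : Γ, k +ᵥ x = (mk' Γ x).rep :=
  AddAction.mem_orbit_iff.mp (AddAction.orbitRel_apply.mp
    (Quotient.exact (Quotient.out_eq (mk' Γ x).orbit)))

/-- An element carrying `x` to the representative of its orbit. -/
def shift (Γ : Type) {P : Type} [AddCommGroup Γ] [AddAction Γ P] (x : P) : Γ :=
  (exists_vadd_eq_rep Γ x).choose

theorem shift_vadd (x : P) : shift Γ x +ᵥ x = (mk' Γ x).rep :=
  (exists_vadd_eq_rep Γ x).choose_spec

variable [Preorder P] [CovariantClass Γ P (· +ᵥ ·) (· ≤ ·)]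

theorem vadd_le_vadd' (k : Γ) {x y : P} (h : x ≤ y) : k +ᵥ x ≤ k +ᵥ y :=
  CovariantClass.elim k h

instance : Category (OrbitCat Γ P) where
  Hom X Y := {k : Γ // k +ᵥ X.rep ≤ Y.rep}
  id X := ⟨0, by rw [zero_vadd]⟩
  comp f g := ⟨g.1 + f.1, by
    rw [add_vadd]
    exact (vadd_le_vadd' g.1 f.2).trans g.2⟩
  id_comp f := Subtype.ext (add_zero f.1)
  comp_id f := Subtype.ext (zero_add f.1)
  assoc f g h := Subtype.ext (add_assoc h.1 g.1 f.1).symm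

theorem id_val (X : OrbitCat Γ P) : (𝟙 X : X ⟶ X).1 = 0 := rfl

theorem comp_val {X Y Z : OrbitCat Γ P} (f : X ⟶ Y) (g : Y ⟶ Z) : (f ≫ g).1 = g.1 + f.1 := rfl

end OrbitCat

/-! ## Geometric realization -/

/-- The geometric realization of (the nerve of) a category; for a poset this is the realization
of its order complex. -/
abbrev Realization (C : Type) [Category.{0} C] : TopCat.{0} := SSet.toTop.obj (nerve C)

/-- The cellular map induced by a functor. -/
def realize {C C' : Type} [Category.{0} C] [Category.{0} C'] (Φ : C ⥤ C') :
    Realization C ⟶ Realization C' := SSet.toTop.map (nerveMap Φ)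

/-! ## Toric arrangements -/

/-- The complex torus `(ℂ^*)^d`. -/
abbrev Torus (d : ℕ) : Type := Fin d → ℂˣ

/-- The linear form `x ↦ ∑ χ_i x_i` of a character `χ ∈ ℤ^d`. -/
def charForm (χ : Fin d → ℤ) : Vec d →ₗ[ℝ] ℝ := ∑ i, (χ i : ℝ) • LinearMap.proj i

/-- An integer vector as a real vector. -/
def intVec (k : Fin d → ℤ) : Vec d := fun i => (k i : ℝ)

/-- The affine form `x ↦ χ(x) - c`. -/
def affForm (χ : Fin d → ℤ) (c : ℝ) : Form d :=
  (charForm χ).toAffineMap - AffineMap.const ℝ (Vec d) c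

/-- The universal covering map `x + i y ↦ exp (2 π i (x + i y))` of the complex torus, where
`ℂ^d = ℝ^d ⊕ i ℝ^d` is written as a product. -/
def toTorus (z : Vec d × Vec d) : Torus d := fun j =>
  Units.mk0 (Complex.exp (2 * Real.pi * Complex.I * ((z.1 j : ℂ) + (z.2 j : ℂ) * Complex.I)))
    (Complex.exp_ne_zero _)

/-- The hypertorus `{t | t^χ = a}`, with `a` in the unit circle. -/
def hypertorus (p : (Fin d → ℤ) × Circle) : Set (Torus d) :=
  {t | ((∏ i, t i ^ p.1 i : ℂˣ) : ℂ) = (p.2 : ℂ)}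

/-- A finite real complexified toric arrangement in `(ℂ^*)^d`, given by equations `t^χ = a` with
`χ ≠ 0` and `|a| = 1`. -/
structure ToricArrangement (d : ℕ) : Type where
  data : Finset ((Fin d → ℤ) × Circle)
  ne_zero : ∀ p ∈ data, p.1 ≠ 0

section FormLemmas

theorem charForm_apply (χ : Fin d → ℤ) (x : Vec d) : charForm χ x = ∑ i, (χ i : ℝ) * x i := by
  simp [charForm]

theorem affForm_apply (χ : Fin d → ℤ) (c : ℝ) (x : Vec d) : affForm χ c x = charForm χ x - c := by
  simp [affForm]

theorem affForm_linear (χ : Fin d → ℤ) (c : ℝ) : (affForm χ c).linear = charForm χ := by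
  simp [affForm]

theorem charForm_intVec (χ k : Fin d → ℤ) : charForm χ (intVec k) = ((∑ i, χ i * k i : ℤ) : ℝ) := by
  simp [charForm_apply, intVec]

theorem intVec_zero : intVec (0 : Fin d → ℤ) = 0 := by
  ext i; simp [intVec]

theorem intVec_add (k l : Fin d → ℤ) : intVec (k + l) = intVec k + intVec l := by
  ext i; simp [intVec]

theorem circle_exp_sub_int (c : ℝ) (n : ℤ) :
    Circle.exp (2 * Real.pi * (c - n)) = Circle.exp (2 * Real.pi * c) := by
  rw [Circle.exp_eq_exp]
  exact ⟨-n, by push_cast; ring⟩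

/-- `exp (2 π i c) = exp (2 π i c')` only if `c - c'` is an integer. -/
theorem circle_exp_eq {c c' : ℝ} (h : Circle.exp (2 * Real.pi * c) = Circle.exp (2 * Real.pi * c')) :
    ∃ n : ℤ, c = c' + n := by
  obtain ⟨m, hm⟩ := Circle.exp_eq_exp.mp h
  refine ⟨m, ?_⟩
  have hp : (2 * Real.pi) ≠ 0 := by positivity
  apply mul_left_cancel₀ hp
  rw [hm]; ring

theorem toTorus_continuous : Continuous (toTorus (d := d)) := by
  refine continuous_pi fun j => ?_
  rw [Units.continuous_iff]
  constructor
  · change Continuous fun z : Vec d × Vec d =>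
      Complex.exp (2 * Real.pi * Complex.I * ((z.1 j : ℂ) + (z.2 j : ℂ) * Complex.I))
    fun_prop
  · have : (fun z : Vec d × Vec d => ((toTorus z j)⁻¹ : ℂˣ).val) = fun z : Vec d × Vec d =>
        Complex.exp (-(2 * Real.pi * Complex.I * ((z.1 j : ℂ) + (z.2 j : ℂ) * Complex.I))) := by
      funext z
      rw [Units.val_inv_eq_inv_val, Complex.exp_neg]
      rfl
    change Continuous fun z : Vec d × Vec d => ((toTorus z j)⁻¹ : ℂˣ).val
    rw [this]
    fun_prop

theorem toTorus_add_int (z : Vec d × Vec d) (k : Fin d → ℤ) :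
    toTorus (z + (intVec k, 0)) = toTorus z := by
  funext j
  apply Units.ext
  change Complex.exp _ = Complex.exp _
  rw [Complex.exp_eq_exp_iff_exists_int]
  refine ⟨k j, ?_⟩
  simp [intVec]
  ring

theorem toTorus_char (χ : Fin d → ℤ) (z : Vec d × Vec d) :
    ((∏ i, toTorus z i ^ χ i : ℂˣ) : ℂ) =
      Complex.exp (2 * Real.pi * Complex.I *
        ((charForm χ z.1 : ℂ) + (charForm χ z.2 : ℂ) * Complex.I)) := by
  have h : ∀ i, ((toTorus z i : ℂˣ) : ℂ) =
      Complex.exp (2 * Real.pi * Complex.I * ((z.1 i : ℂ) + (z.2 i : ℂ) * Complex.I)) :=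
    fun _ => rfl
  rw [Units.coe_prod]
  simp only [Units.val_zpow_eq_zpow_val, h, ← Complex.exp_int_mul]
  rw [← Complex.exp_sum]
  congr 1
  rw [charForm_apply, charForm_apply]
  push_cast
  rw [Finset.sum_mul, ← Finset.sum_add_distrib, Finset.mul_sum]
  exact Finset.sum_congr rfl fun i _ => by ring

end FormLemmas

namespace ToricArrangement

variable (A : ToricArrangement d)

/-- The elements of the arrangement. -/
def hypertori : Set (Set (Torus d)) := {H | ∃ p ∈ A.data, H = hypertorus p}

/-- The complement `M(A)`. -/
def complement : Set (Torus d) := {t | ∀ H ∈ A.hypertori, t ∉ H}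

/-- The layers: connected components of intersections of elements of the arrangement. -/
def layers : Set (Set (Torus d)) :=
  {L | ∃ B ⊆ A.hypertori, ∃ x ∈ ⋂₀ B, L = connectedComponentIn (⋂₀ B) x}

/-- The arrangement is essential: some layer is a point. -/
def IsEssential : Prop := ∃ L ∈ A.layers, L.Subsingleton

/-- Multiplication by `g` preserves the arrangement. -/
def IsInvariant (g : Torus d) : Prop := (fun H => g • H) '' A.hypertori = A.hypertori

/-- The periodic arrangement of affine hyperplanes in `ℝ^d` obtained by lifting `A`. -/
def lift : Set (Form d) :=
  {f | ∃ p ∈ A.data, ∃ c : ℝ, Circle.exp (2 * Real.pi * c) = p.2 ∧ f = affForm p.1 c}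

/-- The linear arrangement `A_0` in `ℝ^d` of all directions of hypertori of `A`. -/
def linear : Set (Form d) := {f | ∃ p ∈ A.data, f = (charForm p.1).toAffineMap}

/-- The flat `X_L` of `A_0`: the intersection of the hyperplanes associated to the hypertori
containing `L`. -/
def flat (L : Set (Torus d)) : Submodule ℝ (Vec d) :=
  ⨅ p ∈ {p | p ∈ A.data ∧ L ⊆ hypertorus p}, LinearMap.ker (charForm p.1)

section Lift

variable {A}

theorem lift_translate {f : Form d} (hf : f ∈ A.lift) (k : Fin d → ℤ) :
    ∃ f' ∈ A.lift, (∀ x, f' x = f (intVec k + x)) ∧ f'.linear = f.linear := by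
  obtain ⟨p, hp, c, hc, rfl⟩ := hf
  refine ⟨affForm p.1 (c - (∑ i, p.1 i * k i : ℤ)), ⟨p, hp, _, ?_, rfl⟩, fun x => ?_, ?_⟩
  · rw [circle_exp_sub_int, hc]
  · rw [affForm_apply, affForm_apply, map_add, charForm_intVec]; ring
  · rw [affForm_linear, affForm_linear]

theorem mem_translate {k : Fin d → ℤ} {S : Set (Vec d)} {x : Vec d} :
    intVec k + x ∈ intVec k +ᵥ S ↔ x ∈ S := by
  rw [← vadd_eq_add, Set.vadd_mem_vadd_set_iff]

theorem vadd_signCell (k : Fin d → ℤ) (x : Vec d) :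
    intVec k +ᵥ signCell A.lift x = signCell A.lift (intVec k + x) := by
  ext y
  rw [Set.mem_vadd_set_iff_neg_vadd_mem, vadd_eq_add]
  constructor
  · intro h f hf
    obtain ⟨f', hf', h1, -⟩ := lift_translate hf k
    have := h f' hf'
    rwa [h1, h1, add_neg_cancel_left] at this
  · intro h f hf
    obtain ⟨f', hf', h1, -⟩ := lift_translate hf (-k)
    have hk : intVec (-k) = -intVec k := by ext i; simp [intVec]
    have := h f' hf'
    rwa [h1, h1, hk, neg_add_cancel_left] at this

theorem isFace_vadd {F : Set (Vec d)} (h : IsFace A.lift F) (k : Fin d → ℤ) :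
    IsFace A.lift (intVec k +ᵥ F) := by
  obtain ⟨x, rfl⟩ := h
  exact ⟨_, vadd_signCell k x⟩

theorem isChamber_vadd {F : Set (Vec d)} (h : IsChamber A.lift F) (k : Fin d → ℤ) :
    IsChamber A.lift (intVec k +ᵥ F) := by
  refine ⟨isFace_vadd h.1 k, ?_⟩
  rintro f hf _ ⟨x, hx, rfl⟩
  obtain ⟨f', hf', h1, -⟩ := lift_translate hf k
  have := h.2 f' hf' x hx
  rwa [h1] at this

theorem le_vadd {F G : Set (Vec d)} (h : F ⊆ closure G) (w : Vec d) :
    w +ᵥ F ⊆ closure (w +ᵥ G) := by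
  rw [closure_vadd]
  exact Set.vadd_set_mono h

theorem agreeAt_vadd {G C C' : Set (Vec d)} (h : AgreeAt A.lift G C C') (k : Fin d → ℤ) :
    AgreeAt A.lift (intVec k +ᵥ G) (intVec k +ᵥ C) (intVec k +ᵥ C') := by
  rintro f hf h0 _ ⟨c, hc, rfl⟩ _ ⟨c', hc', rfl⟩
  obtain ⟨f', hf', h1, -⟩ := lift_translate hf k
  have := h f' hf' (fun x hx => by rw [h1]; exact h0 _ (Set.vadd_mem_vadd_set hx)) c hc c' hc'
  rwa [h1, h1] at this

theorem localForms_vadd (F : Set (Vec d)) (k : Fin d → ℤ) :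
    localForms A.lift (intVec k +ᵥ F) = localForms A.lift F := by
  ext h
  constructor
  · rintro ⟨f, hf, h0, rfl⟩
    obtain ⟨f', hf', h1, h2⟩ := lift_translate hf k
    exact ⟨f', hf', fun x hx => by rw [h1]; exact h0 _ (Set.vadd_mem_vadd_set hx), by rw [h2]⟩
  · rintro ⟨f, hf, h0, rfl⟩
    obtain ⟨f', hf', h1, h2⟩ := lift_translate hf (-k)
    have hk : intVec (-k) = -intVec k := by ext i; simp [intVec]
    refine ⟨f', hf', ?_, by rw [h2]⟩
    rintro _ ⟨x, hx, rfl⟩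
    change f' (intVec k + x) = 0
    rw [h1, hk, neg_add_cancel_left]
    exact h0 x hx

/-- A real number off a coset of `ℤ` has positive distance to it. -/
theorem exists_gap (r : ℝ) : ∃ δ > 0, ∀ n : ℤ, r - n ≠ 0 → δ ≤ |r - n| := by
  by_cases h : Int.fract r = 0
  · refine ⟨1, one_pos, fun n hn => ?_⟩
    obtain ⟨m, rfl⟩ : ∃ m : ℤ, r = m := ⟨⌊r⌋, by
      have := Int.floor_add_fract r
      rw [h, add_zero] at this
      exact this.symm⟩
    have : (m - n : ℤ) ≠ 0 := fun h => hn (by exact_mod_cast h)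
    exact_mod_cast Int.one_le_abs this
  · have h0 : 0 < Int.fract r := lt_of_le_of_ne (Int.fract_nonneg r) (Ne.symm h)
    refine ⟨min (Int.fract r) (1 - Int.fract r), lt_min h0 (by linarith [Int.fract_lt_one r]),
      fun n _ => ?_⟩
    have hr := Int.floor_add_fract r
    rcases le_or_gt n ⌊r⌋ with hn | hn
    · have hn' : (n : ℝ) ≤ ⌊r⌋ := by exact_mod_cast hn
      refine (min_le_left _ _).trans (le_trans ?_ (le_abs_self _))
      linarith
    · have hn' : (⌊r⌋ : ℝ) + 1 ≤ n := by exact_mod_cast hn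
      refine (min_le_right _ _).trans (le_trans ?_ (neg_le_abs _))
      linarith

theorem sign_eq_of_abs_lt {a b : ℝ} (h : |b| < |a|) : SignType.sign (a + b) = SignType.sign a := by
  rcases lt_trichotomy a 0 with ha | ha | ha
  · rw [sign_neg ha, sign_neg]
    rw [abs_of_neg ha] at h
    linarith [le_abs_self b]
  · rw [ha, abs_zero] at h
    exact absurd h (not_lt.mpr (abs_nonneg b))
  · rw [sign_pos ha, sign_pos]
    rw [abs_of_pos ha] at h
    linarith [neg_abs_le b]

theorem locFin_lift : LocFin A.lift := by
  intro x v
  have key : ∀ p ∈ A.data, ∀ᶠ ε in 𝓝[>] (0 : ℝ), ∀ c : ℝ, Circle.exp (2 * Real.pi * c) = p.2 →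
      affForm p.1 c x ≠ 0 →
      SignType.sign (affForm p.1 c (x + ε • v)) = SignType.sign (affForm p.1 c x) := by
    intro p _
    by_cases hex : ∃ c₀ : ℝ, Circle.exp (2 * Real.pi * c₀) = p.2
    · obtain ⟨c₀, hc₀⟩ := hex
      obtain ⟨δ, hδ, hgap⟩ := exists_gap (charForm p.1 x - c₀)
      have hlim : Tendsto (fun ε : ℝ => |ε * charForm p.1 v|) (𝓝[>] 0) (𝓝 0) := by
        have : Continuous fun ε : ℝ => |ε * charForm p.1 v| := by fun_prop
        have h := this.tendsto 0
        simp only [zero_mul, abs_zero] at h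
        exact h.mono_left nhdsWithin_le_nhds
      filter_upwards [hlim.eventually (gt_mem_nhds hδ)] with ε hε c hc hne
      obtain ⟨n, rfl⟩ := circle_exp_eq (hc.trans hc₀.symm)
      rw [form_add, affForm_linear, map_smul, smul_eq_mul]
      apply sign_eq_of_abs_lt
      refine hε.trans_le ?_
      rw [affForm_apply] at hne ⊢
      rw [← sub_sub] at hne ⊢
      exact hgap n hne
    · exact Eventually.of_forall fun ε c hc => absurd ⟨c, hc⟩ hex
  have := (A.data.eventually_all).mpr key
  filter_upwards [this] with ε hε
  rintro f ⟨p, hp, c, hc, rfl⟩ hne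
  exact hε p hp c hc hne

theorem locFin_localForms (W : Set (Vec d)) : LocFin (localForms A.lift W) := by
  intro x v
  have key : ∀ p ∈ A.data, ∀ᶠ ε in 𝓝[>] (0 : ℝ), charForm p.1 x ≠ 0 →
      SignType.sign (charForm p.1 (x + ε • v)) = SignType.sign (charForm p.1 x) := by
    intro p _
    by_cases h0 : charForm p.1 x = 0
    · exact Eventually.of_forall fun ε h => absurd h0 h
    · have hlim : Tendsto (fun ε : ℝ => |ε * charForm p.1 v|) (𝓝[>] 0) (𝓝 0) := by
        have : Continuous fun ε : ℝ => |ε * charForm p.1 v| := by fun_prop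
        have h := this.tendsto 0
        simp only [zero_mul, abs_zero] at h
        exact h.mono_left nhdsWithin_le_nhds
      filter_upwards [hlim.eventually (gt_mem_nhds (abs_pos.mpr h0))] with ε hε _
      rw [map_add, map_smul, smul_eq_mul]
      exact sign_eq_of_abs_lt hε
  have := (A.data.eventually_all).mpr key
  filter_upwards [this] with ε hε
  rintro _ ⟨f, ⟨p, hp, c, hc, rfl⟩, -, rfl⟩ hne
  rw [affForm_linear] at hne ⊢
  exact hε p hp hne

end Lift

/-! ### Faces of the toric arrangement -/

/-- The poset of faces of the lifted arrangement. -/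
abbrev Cell : Type := Face A.lift

instance : AddAction (Fin d → ℤ) A.Cell where
  vadd k F := ⟨intVec k +ᵥ F.carrier, isFace_vadd F.isFace k⟩
  zero_vadd F := Face.ext (by
    change intVec 0 +ᵥ F.carrier = F.carrier
    rw [intVec_zero, zero_vadd])
  add_vadd k l F := Face.ext (by
    change intVec (k + l) +ᵥ F.carrier = intVec k +ᵥ (intVec l +ᵥ F.carrier)
    rw [intVec_add, add_vadd])

instance : CovariantClass (Fin d → ℤ) A.Cell (· +ᵥ ·) (· ≤ ·) :=
  ⟨fun k _ _ h => le_vadd h (intVec k)⟩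

instance : AddAction (Fin d → ℤ) (Sal A.lift) where
  vadd k x := ⟨intVec k +ᵥ x.face, intVec k +ᵥ x.chamber, isFace_vadd x.isFace k,
    isChamber_vadd x.isChamber k, le_vadd x.le _⟩
  zero_vadd x := Sal.ext
    (by
      change intVec 0 +ᵥ x.face = x.face
      rw [intVec_zero, zero_vadd])
    (by
      change intVec 0 +ᵥ x.chamber = x.chamber
      rw [intVec_zero, zero_vadd])
  add_vadd k l x := Sal.ext
    (by
      change intVec (k + l) +ᵥ x.face = intVec k +ᵥ (intVec l +ᵥ x.face)
      rw [intVec_add, add_vadd])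
    (by
      change intVec (k + l) +ᵥ x.chamber = intVec k +ᵥ (intVec l +ᵥ x.chamber)
      rw [intVec_add, add_vadd])

instance : CovariantClass (Fin d → ℤ) (Sal A.lift) (· +ᵥ ·) (· ≤ ·) :=
  ⟨fun k _ _ h => ⟨le_vadd h.1 (intVec k), agreeAt_vadd h.2 k⟩⟩

variable {A} in
theorem Cell.vadd_carrier (k : Fin d → ℤ) (F : A.Cell) :
    (k +ᵥ F).carrier = intVec k +ᵥ F.carrier := rfl

variable {A} in
theorem sal_vadd_face (k : Fin d → ℤ) (x : Sal A.lift) :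
    (k +ᵥ x).face = intVec k +ᵥ x.face := rfl

variable {A} in
theorem sal_vadd_chamber (k : Fin d → ℤ) (x : Sal A.lift) :
    (k +ᵥ x).chamber = intVec k +ᵥ x.chamber := rfl

/-- The face category `F(A)`: the quotient of the poset of faces of the lifted arrangement by the
translations in `ℤ^d`. -/
abbrev FaceCat : Type := OrbitCat (Fin d → ℤ) A.Cell

/-- A face of `A` as a subset of the (compact) torus. -/
def FaceCat.toSet {A : ToricArrangement d} (F : A.FaceCat) : Set (Torus d) :=
  (fun x => toTorus (x, 0)) '' F.rep.carrier

/-- The linear arrangement `A[F]`. -/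
abbrev localArr (F : A.FaceCat) : Set (Form d) := localForms A.lift F.rep.carrier

section Local

variable {A}

theorem isLocal_star (F : A.Cell) : IsLocal A.lift (localForms A.lift F.carrier) F.carrier where
  locFin := locFin_lift
  nonempty := F.isFace.nonempty
  const _ hw _ hw' _ hf := F.isFace.sign_eq hw hw' hf
  eq := rfl

/-- For faces `F ≤ G` of the lifted arrangement, the differences `y - x` (`y ∈ G`, `x ∈ F`) lie in
the face of `A[F]` corresponding to `G`, and the local arrangement of `A[F]` there is `A[G]`. -/
theorem isLocal_sub {F G : A.Cell} (h : F ≤ G) : IsLocal (localForms A.lift F.carrier)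
    (localForms A.lift G.carrier) (G.carrier - F.carrier) where
  locFin := locFin_localForms _
  nonempty := G.isFace.nonempty.sub F.isFace.nonempty
  const := by
    rintro _ ⟨y, hy, x, hx, rfl⟩ _ ⟨y', hy', x', hx', rfl⟩ _ ⟨f, hf, h0, rfl⟩
    change SignType.sign (f.linear (y - x)) = SignType.sign (f.linear (y' - x'))
    rw [form_sub, form_sub, h0 x hx, h0 x' hx', sub_zero, sub_zero]
    exact G.isFace.sign_eq hy hy' hf
  eq := by
    ext e
    constructor
    · rintro ⟨f, hf, h0, rfl⟩
      have hF := vanish_of_le F.isFace G.isFace h hf h0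
      refine ⟨f.linear.toAffineMap, ⟨f, hf, hF, rfl⟩, ?_, ?_⟩
      · rintro _ ⟨y, hy, x, hx, rfl⟩
        change f.linear (y - x) = 0
        rw [form_sub, h0 y hy, hF x hx, sub_zero]
      · rw [LinearMap.toAffineMap_linear]
    · rintro ⟨_, ⟨f, hf, hF, rfl⟩, h0, rfl⟩
      refine ⟨f, hf, fun y hy => ?_, by rw [LinearMap.toAffineMap_linear]⟩
      obtain ⟨x, hx⟩ := F.isFace.nonempty
      have := h0 (y - x) (Set.sub_mem_sub hy hx)
      change f.linear (y - x) = 0 at this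
      rwa [form_sub, hF x hx, sub_zero] at this

theorem star_compat {F G : A.Cell} (h : F ≤ G) : ∀ f ∈ A.lift, ∀ w₁ ∈ F.carrier,
    ∀ w₂ ∈ G.carrier - F.carrier, ∀ w₃ ∈ G.carrier, SignType.sign (f w₃) =
      if f w₁ = 0 then SignType.sign (f.linear w₂) else SignType.sign (f w₁) := by
  rintro f hf w₁ hw₁ _ ⟨y, hy, x, hx, rfl⟩ w₃ hw₃
  split_ifs with h0
  · change SignType.sign (f w₃) = SignType.sign (f.linear (y - x))
    rw [form_sub, F.isFace.vanish hw₁ hf h0 x hx, sub_zero]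
    exact G.isFace.sign_eq hw₃ hy hf
  · exact ((face_le_iff F.isFace G.isFace hw₁ hw₃).mp h f hf h0).symm

theorem sub_compat {F G H : A.Cell} (h' : G ≤ H) :
    ∀ f ∈ localForms A.lift F.carrier, ∀ w₁ ∈ G.carrier - F.carrier,
      ∀ w₂ ∈ H.carrier - G.carrier, ∀ w₃ ∈ H.carrier - F.carrier, SignType.sign (f w₃) =
        if f w₁ = 0 then SignType.sign (f.linear w₂) else SignType.sign (f w₁) := by
  rintro _ ⟨f, hf, hF, rfl⟩ _ ⟨y, hy, x, hx, rfl⟩ _ ⟨z, hz, y', hy', rfl⟩ _ ⟨z', hz', x', hx', rfl⟩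
  have e1 : f.linear.toAffineMap ((fun a b => a - b) y x) = f y := by
    change f.linear (y - x) = f y
    rw [form_sub, hF x hx, sub_zero]
  have e3 : f.linear.toAffineMap ((fun a b => a - b) z' x') = f z' := by
    change f.linear (z' - x') = f z'
    rw [form_sub, hF x' hx', sub_zero]
  rw [e1, e3]
  split_ifs with h0
  · change SignType.sign (f z') = SignType.sign (f.linear (z - y'))
    rw [form_sub, G.isFace.vanish hy hf h0 y' hy', sub_zero]
    exact H.isFace.sign_eq hz' hz hf
  · exact ((face_le_iff G.isFace H.isFace hy hz').mp h' f hf h0).symm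

/-- A morphism `m : F ⟶ G` of `F(A)` makes `A[G]` a local arrangement of `A[F]`. -/
theorem isLocal_hom {F G : A.FaceCat} (m : F ⟶ G) : IsLocal (A.localArr F) (A.localArr G)
    (G.rep.carrier - (m.1 +ᵥ F.rep).carrier) := by
  have := isLocal_sub m.2
  rwa [Cell.vadd_carrier, localForms_vadd] at this

/-- The map `[K, C] ↦ [i_m(K), i_m(C)]` from `S(A[G])` to `S(A[F])`, for `m : F ⟶ G`. -/
def transition {F G : A.FaceCat} (m : F ⟶ G) : Sal (A.localArr G) →o Sal (A.localArr F) :=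
  (isLocal_hom m).push

theorem transition_id (F : A.FaceCat) (x : Sal (A.localArr F)) : transition (𝟙 F) x = x := by
  have key : ∀ K, IsFace (A.localArr F) K →
      glue (A.localArr F) (F.rep.carrier - ((𝟙 F : F ⟶ F).1 +ᵥ F.rep).carrier) K = K := by
    intro K hK
    obtain ⟨w, hw⟩ := F.rep.isFace.nonempty
    obtain ⟨v, hv⟩ := hK.nonempty
    have hw' : w ∈ ((𝟙 F : F ⟶ F).1 +ᵥ F.rep).carrier := by
      rw [OrbitCat.id_val, zero_vadd]; exact hw
    have hi := isLocal_hom (𝟙 F)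
    have hmem : ∀ u, u ∈ glue (A.localArr F)
        (F.rep.carrier - ((𝟙 F : F ⟶ F).1 +ᵥ F.rep).carrier) K ↔ u ∈ K := by
      intro u
      rw [hi.mem_glue_iff hK (Set.sub_mem_sub hw hw') hv, hK.eq_signCell hv]
      refine forall₂_congr fun f hf => ?_
      obtain ⟨e, he, h0, rfl⟩ := hf
      have : e.linear.toAffineMap (w - w) = 0 := by
        rw [sub_self]; exact map_zero e.linear
      rw [if_pos this]
      rfl
    exact Set.ext hmem
  exact Sal.ext (key _ x.isFace) (key _ x.isChamber.1)

theorem transition_comp {F G H : A.FaceCat} (m : F ⟶ G) (n : G ⟶ H) (x : Sal (A.localArr H)) :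
    transition (m ≫ n) x = transition m (transition n x) := by
  symm
  have h2 : n.1 +ᵥ G.rep ≤ H.rep := n.2
  refine push_push (isLocal_hom m) (isLocal_hom n) (isLocal_hom (m ≫ n)) ?_ x
  intro f hf w₁ hw₁ w₂ hw₂ w₃ hw₃
  have hf' : f ∈ localForms A.lift ((m ≫ n).1 +ᵥ F.rep).carrier := by
    rw [Cell.vadd_carrier, localForms_vadd]; exact hf
  refine sub_compat h2 f hf' w₁ ?_ w₂ hw₂ w₃ hw₃
  obtain ⟨y, hy, x, hx, rfl⟩ := hw₁
  refine ⟨intVec n.1 + y, Set.vadd_mem_vadd_set hy, intVec n.1 + x, ?_, ?_⟩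
  · rw [OrbitCat.comp_val, add_vadd]
    exact Set.vadd_mem_vadd_set hx
  · change intVec n.1 + y - (intVec n.1 + x) = y - x
    abel

/-- The poset map from `S(A[F])`, for a lifted face `F`, to the Salvetti poset of the lifted
arrangement: `[K, C]` goes to the face and the chamber of the lifted arrangement that are
seen from `F` in the directions of `K` and of `C`. -/
def star {E : Set (Form d)} (F : A.Cell) (hE : E = localForms A.lift F.carrier) :
    Sal E →o Sal A.lift :=
  IsLocal.push (E₁ := A.lift) (W := F.carrier)
    { locFin := locFin_lift
      nonempty := F.isFace.nonempty
      const := fun _ hw _ hw' _ hf => F.isFace.sign_eq hw hw' hf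
      eq := hE }

theorem star_transition {F G : A.FaceCat} (m : F ⟶ G) (x : Sal (A.localArr G)) :
    star G.rep rfl x = m.1 +ᵥ star F.rep rfl (transition m x) := by
  have hE : A.localArr F = localForms A.lift (m.1 +ᵥ F.rep).carrier := by
    rw [Cell.vadd_carrier, localForms_vadd]
  have h1 : star (m.1 +ᵥ F.rep) hE (transition m x) = star G.rep rfl x :=
    push_push _ (isLocal_hom m) _ (star_compat m.2) x
  rw [← h1]
  have key : ∀ K, IsFace (A.localArr F) K → glue A.lift (m.1 +ᵥ F.rep).carrier K =
      intVec m.1 +ᵥ glue A.lift F.rep.carrier K := by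
    intro K hK
    have hloc := isLocal_star F.rep
    obtain ⟨u, hu⟩ := hloc.exists_mem hK
    obtain ⟨w, hw, v, hv, hs⟩ := id hu
    have hf2 := isFace_vadd (hloc.isFace hK) m.1
    have hloc' : IsLocal A.lift (A.localArr F) (m.1 +ᵥ F.rep).carrier := by
      have := isLocal_star (m.1 +ᵥ F.rep)
      rwa [← hE] at this
    refine (hloc'.isFace hK).eq_of_mem hf2 (x := intVec m.1 + u) ?_ (Set.vadd_mem_vadd_set hu)
    refine ⟨intVec m.1 + w, Set.vadd_mem_vadd_set hw, v, hv, fun f hf => ?_⟩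
    obtain ⟨f', hf', e1, e2⟩ := lift_translate hf m.1
    have := hs f' hf'
    rw [e1, e1, e2] at this
    exact this
  exact Sal.ext (key _ (transition m x).isFace) (key _ (transition m x).isChamber.1)

end Local

/-! ### The toric Salvetti complex -/

/-- The diagram of posets `F ↦ S(A[F])` on `F(A)^op`. -/
def diagram : A.FaceCatᵒᵖ ⥤ Preord.{0} where
  obj F := Preord.of (Sal (A.localArr F.unop))
  map m := Preord.ofHom (transition m.unop)
  map_id F := Preord.ext fun x => transition_id F.unop x
  map_comp m n := Preord.ext fun x => transition_comp n.unop m.unop x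

/-- The Grothendieck construction `∫ D` of the diagram of the posets `S(A[F])`; its realization
is the toric Salvetti complex. -/
abbrev ToricSal : Type := Grothendieck (A.diagram ⋙ preordToCat)

/-- The face `F` of an object `(F, [G, C])` of `∫ D`. -/
def ToricSal.base {A : ToricArrangement d} (X : A.ToricSal) : A.FaceCat :=
  (Grothendieck.base X).unop

/-- The pair `[G, C]` of an object `(F, [G, C])` of `∫ D`. -/
def ToricSal.pair {A : ToricArrangement d} (X : A.ToricSal) : Sal (A.localArr X.base) :=
  Grothendieck.fiber X

theorem ToricSal.hom_le {A : ToricArrangement d} {X Y : A.ToricSal} (f : X ⟶ Y) :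
    transition f.base.unop X.pair ≤ Y.pair := leOfHom f.fiber

/-- The quotient `S(A^↾) / ℤ^d` of the Salvetti poset of the lifted arrangement; its realization
is the quotient by `ℤ^d` of the Salvetti complex of the lifted arrangement. -/
abbrev SalQuot : Type := OrbitCat (Fin d → ℤ) (Sal A.lift)

/-- The comparison functor from `∫ D` to `S(A^↾) / ℤ^d`. -/
def comparison : A.ToricSal ⥤ A.SalQuot where
  obj X := OrbitCat.mk' (Fin d → ℤ) (star X.base.rep rfl X.pair)
  map {X Y} f := ⟨OrbitCat.shift (Fin d → ℤ) (star Y.base.rep rfl Y.pair) - f.base.unop.1 -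
      OrbitCat.shift (Fin d → ℤ) (star X.base.rep rfl X.pair), by
    rw [← OrbitCat.shift_vadd, ← OrbitCat.shift_vadd, ← add_vadd, sub_add_cancel]
    have h := star_transition f.base.unop X.pair
    have h2 : star Y.base.rep rfl (transition f.base.unop X.pair) ≤ star Y.base.rep rfl Y.pair :=
      (star Y.base.rep rfl).monotone (ToricSal.hom_le f)
    change _ +ᵥ star X.base.rep rfl X.pair ≤ _
    erw [h]
    rw [← add_vadd, sub_add_cancel]
    exact OrbitCat.vadd_le_vadd' _ h2⟩
  map_id X := by
    apply Subtype.ext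
    change _ - (0 : Fin d → ℤ) - _ = (0 : Fin d → ℤ)
    rw [sub_zero, sub_self]
  map_comp {X Y Z} f g := by
    apply Subtype.ext
    have h : (f ≫ g).base.unop.1 = f.base.unop.1 + g.base.unop.1 := rfl
    rw [OrbitCat.comp_val]
    simp only [h]
    abel

/-! ### The maps of the Salvetti complex into the complement -/

/-- The open convex set attached to `[G, C]` in the complexification `ℝ^d ⊕ i ℝ^d`: the points
`a + i b` with `a ∈ G` and with `b` in the open cone of all directions that lie on the same side
as `C` of each hyperplane containing `G`. -/
def convexPiece {E : Set (Form d)} (x : Sal E) : Set (Vec d × Vec d) :=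
  {z | z.1 ∈ x.face ∧ ∀ f ∈ E, (∀ y ∈ x.face, f y = 0) →
    ∀ c ∈ x.chamber, SignType.sign (f.linear z.2) = SignType.sign (f c)}

/-- A choice of points, equivariant under the translations in `ℤ^d`. -/
structure PointChoice : Type where
  point : Sal A.lift → Vec d × Vec d
  mem : ∀ x, point x ∈ convexPiece x
  equivariant : ∀ (k : Fin d → ℤ) x, point (k +ᵥ x) = point x + (intVec k, 0)

/-- A choice of points that commutes with the translation by `w`. -/
def PointChoice.IsEquivariantUnder {A : ToricArrangement d} (p : A.PointChoice) (w : Vec d) :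
    Prop :=
  ∀ x y : Sal A.lift, y.face = w +ᵥ x.face → y.chamber = w +ᵥ x.chamber →
    p.point y = p.point x + (w, 0)

section Inclusion

variable {A}

/-- A convex combination of points in the pieces of a chain avoids the hyperplanes. -/
theorem chain_avoids {E : Set (Form d)} {n : ℕ} (x : Fin (n + 1) → Sal E) (hx : Monotone x)
    (z : Fin (n + 1) → Vec d × Vec d) (hz : ∀ i, z i ∈ convexPiece (x i))
    (t : stdSimplex ℝ (Fin (n + 1))) {f : Form d} (hf : f ∈ E)
    (h1 : f (∑ i, t i • z i).1 = 0) (h2 : f.linear (∑ i, t i • z i).2 = 0) : False := by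
  have ht0 : ∀ i, 0 ≤ t i := t.2.1
  have ht1 : ∑ i, t i = 1 := t.2.2
  have hsum1 : f (∑ i, t i • z i).1 = ∑ i, t i * f (z i).1 := by
    have hl : ∀ v, f v = f.linear v + f 0 := fun v => by
      have := form_add f 0 v
      rw [zero_add] at this
      linarith
    rw [hl, Prod.fst_sum, map_sum]
    have : ∑ i, t i * f (z i).1 = ∑ i, (t i * f.linear (z i).1 + t i * f 0) :=
      Finset.sum_congr rfl fun i _ => by rw [hl (z i).1]; ring
    rw [this, Finset.sum_add_distrib, ← Finset.sum_mul, ht1, one_mul]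
    simp
  have hsum2 : f.linear (∑ i, t i • z i).2 = ∑ i, t i * f.linear (z i).2 := by
    rw [Prod.snd_sum, map_sum]
    simp
  obtain ⟨m, -, hm⟩ : ∃ m ∈ Finset.univ, 0 < t m := by
    by_contra! hcon
    have : ∑ i, t i ≤ 0 := Finset.sum_nonpos fun i hi => hcon i hi
    linarith
  have hface : ∀ i j, f (z i).1 ≠ 0 → f (z j).1 ≠ 0 →
      SignType.sign (f (z i).1) = SignType.sign (f (z j).1) := by
    intro i j hi hj
    rcases le_total i j with h | h
    · exact ((face_le_iff (x j).isFace (x i).isFace (hz j).1 (hz i).1).mp (hx h).1 f hf hj).symm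
    · exact (face_le_iff (x i).isFace (x j).isFace (hz i).1 (hz j).1).mp (hx h).1 f hf hi
  have comb : ∀ (b : Fin (n + 1) → ℝ) (s : ℝ), (∀ i, 0 ≤ t i * (s * b i)) →
      ∑ i, t i * b i = 0 → ∀ i, 0 < t i → s * b i = 0 := by
    intro b s hnn h0 i hi
    have hs : ∑ i, t i * (s * b i) = 0 := by
      have : ∑ i, t i * (s * b i) = s * ∑ i, t i * b i := by
        rw [Finset.mul_sum]
        exact Finset.sum_congr rfl fun i _ => by ring
      rw [this, h0, mul_zero]
    have := (Finset.sum_eq_zero_iff_of_nonneg (fun i _ => hnn i)).mp hs i (Finset.mem_univ i)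
    exact (mul_eq_zero.mp this).resolve_left hi.ne'
  have hzero : ∀ i, 0 < t i → f (z i).1 = 0 := by
    intro i hi
    by_contra hne
    have := comb (fun j => f (z j).1) (SignType.sign (f (z i).1) : ℝ) (fun j => ?_)
      (hsum1 ▸ h1) i hi
    · rw [sign_mul_self] at this
      exact hne (abs_eq_zero.mp this)
    · refine mul_nonneg (ht0 j) ?_
      by_cases hj : f (z j).1 = 0
      · simp only [hj, mul_zero, le_refl]
      · rw [hface i j hne hj, sign_mul_self]
        exact abs_nonneg _
  obtain ⟨c, hc⟩ := (x m).isChamber.1.nonempty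
  have hcne : f c ≠ 0 := (x m).isChamber.2 f hf c hc
  have hsgn : ∀ j, 0 < t j → SignType.sign (f.linear (z j).2) = SignType.sign (f c) := by
    intro j hj
    have hvj := (x j).isFace.vanish (hz j).1 hf (hzero j hj)
    have hvm := (x m).isFace.vanish (hz m).1 hf (hzero m hm)
    obtain ⟨b, hb⟩ := (x j).isChamber.1.nonempty
    rw [(hz j).2 f hf hvj b hb]
    rcases le_total j m with h | h
    · exact (hx h).2 f hf hvj b hb c hc
    · exact ((hx h).2 f hf hvm c hc b hb).symm
  have := comb (fun j => f.linear (z j).2) (SignType.sign (f c) : ℝ) (fun j => ?_)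
    (hsum2 ▸ h2) m hm
  · rw [← hsgn m hm, sign_mul_self, abs_eq_zero] at this
    have h := hsgn m hm
    rw [this, sign_zero, eq_comm, sign_eq_zero_iff] at h
    exact hcne h
  · rcases (ht0 j).eq_or_lt with h | h
    · rw [← h, zero_mul]
    · refine mul_nonneg h.le ?_
      rw [← hsgn j h, sign_mul_self]
      exact abs_nonneg _

theorem toTorus_mem_complement {z : Vec d × Vec d}
    (h : ∀ f ∈ A.lift, f z.1 = 0 → f.linear z.2 ≠ 0) : toTorus z ∈ A.complement := by
  rintro _ ⟨p, hp, rfl⟩ hmem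
  change ((∏ i, toTorus z i ^ p.1 i : ℂˣ) : ℂ) = (p.2 : ℂ) at hmem
  rw [toTorus_char] at hmem
  have hnorm := congrArg norm hmem
  rw [Circle.norm_coe, Complex.norm_exp] at hnorm
  have hre : (2 * (Real.pi : ℂ) * Complex.I *
      ((charForm p.1 z.1 : ℂ) + (charForm p.1 z.2 : ℂ) * Complex.I)).re =
      -(2 * Real.pi * charForm p.1 z.2) := by
    simp
  rw [hre, Real.exp_eq_one_iff, neg_eq_zero] at hnorm
  have h2 : charForm p.1 z.2 = 0 :=
    (mul_eq_zero.mp hnorm).resolve_left (by positivity)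
  refine h (affForm p.1 (charForm p.1 z.1)) ⟨p, hp, _, ?_, rfl⟩ ?_ ?_
  · apply Circle.ext
    rw [← hmem, h2, Circle.coe_exp]
    congr 1
    push_cast
    ring
  · rw [affForm_apply, sub_self]
  · rw [affForm_linear, h2]

/-- The lift of a simplex of `S(A^↾) / ℤ^d` to a chain ending at the chosen representative of the
last vertex. -/
def liftChain {n : ℕ} (s : ComposableArrows A.SalQuot n) (i : Fin (n + 1)) : Sal A.lift :=
  (s.map (homOfLE (Fin.le_last i))).1 +ᵥ (s.obj i).rep

theorem liftChain_monotone {n : ℕ} (s : ComposableArrows A.SalQuot n) :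
    Monotone (liftChain s) := by
  intro i j hij
  have h : s.map (homOfLE (Fin.le_last i)) = s.map (homOfLE hij) ≫ s.map (homOfLE (Fin.le_last j)) := by
    rw [← s.map_comp]
    rfl
  unfold liftChain
  rw [h, OrbitCat.comp_val, add_vadd]
  exact OrbitCat.vadd_le_vadd' _ (s.map (homOfLE hij)).2

/-- The affine extension of a choice of points to a simplex. -/
def simplexPoint (p : A.PointChoice) {n : ℕ} (s : ComposableArrows A.SalQuot n)
    (t : stdSimplex ℝ (Fin (n + 1))) : Vec d × Vec d :=
  ∑ i, t i • p.point (liftChain s i)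

theorem simplexPoint_mem (p : A.PointChoice) {n : ℕ} (s : ComposableArrows A.SalQuot n)
    (t : stdSimplex ℝ (Fin (n + 1))) : toTorus (simplexPoint p s t) ∈ A.complement :=
  toTorus_mem_complement fun _ hf h1 h2 =>
    chain_avoids (liftChain s) (liftChain_monotone s) _ (fun _ => p.mem _) t hf h1 h2

/-- The map of a simplex of `S(A^↾) / ℤ^d` into the complement. -/
def simplexMap (p : A.PointChoice) {n : ℕ} (s : ComposableArrows A.SalQuot n) :
    C(stdSimplex ℝ (Fin (n + 1)), A.complement) where
  toFun t := ⟨toTorus (simplexPoint p s t), simplexPoint_mem p s t⟩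
  continuous_toFun := by
    refine Continuous.subtype_mk (toTorus_continuous.comp ?_) _
    unfold simplexPoint
    refine continuous_finsetSum _ fun i _ => ?_
    exact ((continuous_apply i).comp continuous_subtype_val).smul continuous_const

theorem simplexMap_natural (p : A.PointChoice) {m n : SimplexCategory} (θ : m ⟶ n)
    (s : ComposableArrows A.SalQuot n.len) (t : stdSimplex ℝ (Fin (m.len + 1))) :
    simplexMap p s (stdSimplex.map θ.toOrderHom t) =
      simplexMap p ((nerve A.SalQuot).map θ.op s) t := by
  apply Subtype.ext
  change toTorus (simplexPoint p s _) = toTorus (simplexPoint p _ t)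
  set s' : ComposableArrows A.SalQuot m.len := (nerve A.SalQuot).map θ.op s with hs'
  set k := (s.map (homOfLE (Fin.le_last (θ.toOrderHom (Fin.last _))))).1 with hk
  have hchain : ∀ j, liftChain s (θ.toOrderHom j) = k +ᵥ liftChain s' j := by
    intro j
    have h1 : s.map (homOfLE (Fin.le_last (θ.toOrderHom j))) =
        s.map (homOfLE (θ.toOrderHom.monotone (Fin.le_last j))) ≫
          s.map (homOfLE (Fin.le_last (θ.toOrderHom (Fin.last _)))) := by
      rw [← s.map_comp]
      rfl
    unfold liftChain
    rw [h1, OrbitCat.comp_val, add_vadd]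
    rfl
  have hpt : simplexPoint p s (stdSimplex.map θ.toOrderHom t) =
      simplexPoint p s' t + (intVec k, 0) := by
    have ht1 : ∑ i, t i = 1 := t.2.2
    unfold simplexPoint
    have e1 : ∑ i, (stdSimplex.map θ.toOrderHom t) i • p.point (liftChain s i) =
        ∑ j, t j • p.point (liftChain s (θ.toOrderHom j)) := by
      simp only [stdSimplex.map_coe, FunOnFinite.linearMap_apply_apply, Finset.sum_smul]
      rw [Finset.sum_comm' (t' := Finset.univ) (s' := fun j => {θ.toOrderHom j})]
      · simp
      · intro i j
        simp [eq_comm]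
    rw [e1]
    simp only [hchain, p.equivariant, smul_add]
    rw [Finset.sum_add_distrib, ← Finset.sum_smul, ht1, one_smul]
  rw [hpt, toTorus_add_int]

/-- The map of simplicial sets adjoint to `inclusion`. -/
def inclusionSSet (p : A.PointChoice) :
    nerve A.SalQuot ⟶ TopCat.toSSet.obj (TopCat.of A.complement) where
  app n := ↾fun s => (TopCat.toSSetObjEquiv (TopCat.of A.complement) n).symm (simplexMap p s)
  naturality m n θ := by
    ext s
    apply (TopCat.toSSetObjEquiv (TopCat.of A.complement) n).injective
    ext1 t
    exact (simplexMap_natural p θ.unop s t).symm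

/-- The map from the realization of `S(A^↾) / ℤ^d` into the complement `M(A)` obtained by
affine extension from a choice of points. -/
def inclusion (p : A.PointChoice) : Realization A.SalQuot ⟶ TopCat.of A.complement :=
  (sSetTopAdj.homEquiv (nerve A.SalQuot) (TopCat.of A.complement)).symm (inclusionSSet p)

end Inclusion

/-! ### The subcomplexes `S_{L,F₀}` -/

/-- The objects `(F, [G, C])` of `∫ D` with `F ⊆ L` and `[G, C] ∈ S^{F₀}(A[F])`, that is, with
`C = B_G` for some chamber `B ≥ F₀` of `A[F]`. -/
def subcomplexObj (L : Set (Torus d)) (F₀ : Set (Vec d)) : ObjectProperty A.ToricSal := fun X =>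
  X.base.toSet ⊆ L ∧ ∃ B, IsChamber (A.localArr X.base) B ∧ F₀ ⊆ closure B ∧
    AgreeAt (A.localArr X.base) X.pair.face B X.pair.chamber

/-- The category `S_{L,F₀}`: the Grothendieck construction of the subdiagram of the posets
`S^{F₀}(A[F])` on the faces `F` in `L`, as a (full) subcategory of `∫ D`. -/
abbrev Subcomplex (L : Set (Torus d)) (F₀ : Set (Vec d)) : Type :=
  (A.subcomplexObj L F₀).FullSubcategory

variable {A} in
theorem mul_mem_complement {g : Torus d} (hg : A.IsInvariant g) {t : Torus d}
    (ht : t ∈ A.complement) : g * t ∈ A.complement := by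
  intro H hH hmem
  unfold IsInvariant at hg
  rw [← hg] at hH
  obtain ⟨H', hH', rfl⟩ := hH
  obtain ⟨t', ht', he⟩ := hmem
  have h : t' = t := mul_left_cancel (he : g * t' = g * t)
  exact ht H' hH' (h ▸ ht')

variable {A} in
/-- Multiplication by `g` on the complement. -/
def mulComplement {g : Torus d} (hg : A.IsInvariant g) : C(A.complement, A.complement) where
  toFun t := ⟨g * t.1, mul_mem_complement hg t.2⟩
  continuous_toFun := (continuous_const.mul continuous_subtype_val).subtype_mk _

end ToricArrangement
end ToricSalvetti
end

/-!
Translations by real vectors `v` with `q(v)` preserving the arrangement form a group `periods A`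
containing `ℤ^d`. It permutes the hyperplanes of the lifted arrangement, possibly rescaling their
equations (`exists_translate`), and since the arrangement is essential it acts freely on faces
(`IsEssential.translation_eq_zero`), while every symmetry of the arrangement is covered by a period
(`IsEssential.exists_period`). Freeness gives choices of points equivariant under all periods, makes
`[G, C] ↦ [v + G, v + C]` and `(F, [G, C]) ↦ (gF, [G, C])` functors on the quotients, and shows that
they are compatible with the comparison functor. Multiplication by `g` followed by comparison with
the inclusion of `p` amounts to replacing `p` by its translate (`inclusion_translate`), and since the
points allowed for a pair form a convex set, any two choices give homotopic inclusions
(`inclusion_homotopic`).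

The substantial claim is that a translation preserving a layer `L` acts on `S_{L, F₀}` by a map
homotopic to the identity. After adding a lattice vector the translation is by a vector `w` along
the direction `X_L` of `L` (`exists_int_sub_mem_flat`, from the description `mem_layer_iff` of layers
as orbits of subtori). The periodic version of `S_{L, F₀}` is a poset `Stratum`, whose elements are
pairs of a lifted face `F` in `L` and a pair `[G, C]` with `F ≤ G`, with `C` lying in a direction
`e₀ ∈ F₀` from the hyperplanes that contain `G` but are not parallel to `e₀`. A translation by `w`
is not isotopic to the identity inside the discrete poset, so the poset is compared with a region
near the layer: triples `(a, x, y)` of a point `a` of the layer, a nearby point `x` and a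
direction `y`, generic at `x` and on the side of `e₀` of the hyperplanes not parallel to `e₀`. All
these conditions are invariant under moving `a` and `x` along `X_L`, because a hyperplane that is
parallel to `e₀` contains the linear hull `X_L` of `F₀` in its direction (`center_add_inRegion`).
Each stratum has an open star in the space of triples (`Sees`) and a vertex in its star. The stars
are locally finite and cover the region, and the strata visible from a point have a common lower
bound, the stratum of the barycenter of their vertices (`thickening`).

To keep the homotopies explicit, a point of the realization of a poset is presented as a monotone
step function on `[0, 1)` (`stepPoint`); the lengths of the pieces are its barycentric coordinates.
A point of the region determines the step function whose value at `r` is the lower bound of the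
strata whose bump function exceeds `r` times the maximal one (`Thickening.strataFun`). Applied to
the barycenters of the simplices this gives a self-map of the realization which is homotopic to the
identity, and applied to their translates by `w` one that is homotopic to the translation
(`Motion.homotopyFun`: cut the step function of a point at time `s` and replace the rest). Sliding
the barycenters from one position to the other connects the two (`slideHomotopy`). All of this is
equivariant under `ℤ^d`, and simplices of the subcomplex lift to chains of strata (`strataCovering`),
so the homotopy descends (`Thickening.Covering.homotopic_id`).
-/

noncomputable section

namespace ToricSalvetti

section

/-! ### Maps out of a geometric realization -/

section Realization

variable {C C' : Type} [Category.{0} C] [Category.{0} C'] {W : Type} [TopologicalSpace W]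

theorem sset_naturality_apply {X Y : SSet.{0}} (η : X ⟶ Y) {m n : SimplexCategory} (θ : m ⟶ n)
    (s : X.obj (op n)) : η.app (op m) (X.map θ.op s) = Y.map θ.op (η.app (op n) s) :=
  ConcreteCategory.congr_hom (η.naturality θ.op) s

theorem sset_congr_app {X Y : SSet.{0}} {η η' : X ⟶ Y} (h : η = η') {n : SimplexCategory}
    (s : X.obj (op n)) : η.app (op n) s = η'.app (op n) s := by
  rw [h]

/-- The closed simplex of the realization of a simplicial set spanned by a simplex. -/
def cellIncl (X : SSet.{0}) {n : ℕ} (s : X.obj (op (SimplexCategory.mk n))) :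
    C(stdSimplex ℝ (Fin (n + 1)), SSet.toTop.obj X) :=
  TopCat.toSSetObjEquiv (SSet.toTop.obj X) (op (SimplexCategory.mk n))
    ((sSetTopAdj.unit.app X).app (op (SimplexCategory.mk n)) s)

theorem cellIncl_map (X : SSet.{0}) {m n : ℕ} (θ : SimplexCategory.mk m ⟶ SimplexCategory.mk n)
    (s : X.obj (op (SimplexCategory.mk n))) (t : stdSimplex ℝ (Fin (m + 1))) :
    cellIncl X s (stdSimplex.map θ t) = cellIncl X (X.map θ.op s) t := by
  have h : (sSetTopAdj.unit.app X).app (op (SimplexCategory.mk m)) (X.map θ.op s) =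
      (TopCat.toSSet.obj (SSet.toTop.obj X)).map θ.op
        ((sSetTopAdj.unit.app X).app (op (SimplexCategory.mk n)) s) :=
    sset_naturality_apply (sSetTopAdj.unit.app X) θ s
  unfold cellIncl
  rw [h]
  exact (TopCat.toSSetObjEquiv_naturality_apply (X := SSet.toTop.obj X) θ _ t).symm

theorem toTop_map_cellIncl {X Y : SSet.{0}} (φ : X ⟶ Y) {n : ℕ}
    (s : X.obj (op (SimplexCategory.mk n))) (t : stdSimplex ℝ (Fin (n + 1))) :
    SSet.toTop.map φ (cellIncl X s t) = cellIncl Y (φ.app _ s) t := by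
  have h : (sSetTopAdj.unit.app Y).app (op (SimplexCategory.mk n)) (φ.app _ s) =
      (TopCat.toSSet.map (SSet.toTop.map φ)).app (op (SimplexCategory.mk n))
        ((sSetTopAdj.unit.app X).app (op (SimplexCategory.mk n)) s) :=
    sset_congr_app (sSetTopAdj.unit.naturality φ) s
  unfold cellIncl
  rw [h]
  rfl

/-- The closed simplex of the realization spanned by an `n`-simplex of the nerve. -/
def simplexIncl {n : ℕ} (s : ComposableArrows C n) :
    C(stdSimplex ℝ (Fin (n + 1)), Realization C) :=
  cellIncl (nerve C) s

/-- The simplex of the nerve obtained by restriction along a monotone map of vertices. -/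
abbrev reindex {m n : ℕ} (θ : Fin (m + 1) →o Fin (n + 1)) (s : ComposableArrows C n) :
    ComposableArrows C m :=
  θ.monotone.functor ⋙ s

theorem simplexIncl_map {m n : ℕ} (θ : Fin (m + 1) →o Fin (n + 1)) (s : ComposableArrows C n)
    (t : stdSimplex ℝ (Fin (m + 1))) :
    simplexIncl s (stdSimplex.map θ t) = simplexIncl (reindex θ s) t := by
  exact cellIncl_map (nerve C) (SimplexCategory.mkHom θ) s t

/-- A compatible family of maps on the simplices of a nerve. -/
structure SimplexFamily (C W : Type) [Category.{0} C] [TopologicalSpace W] where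
  map : ∀ {n : ℕ}, ComposableArrows C n → C(stdSimplex ℝ (Fin (n + 1)), W)
  natural : ∀ {m n : ℕ} (θ : Fin (m + 1) →o Fin (n + 1)) (s : ComposableArrows C n)
    (t : stdSimplex ℝ (Fin (m + 1))), map s (stdSimplex.map θ t) = map (reindex θ s) t

/-- The map of simplicial sets attached to a compatible family of maps on simplices. -/
def SimplexFamily.sset (h : SimplexFamily C W) : nerve C ⟶ TopCat.toSSet.obj (TopCat.of W) where
  app n := ↾fun s => (TopCat.toSSetObjEquiv (TopCat.of W) n).symm (h.map s)
  naturality m n θ := by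
    ext s
    apply (TopCat.toSSetObjEquiv (TopCat.of W) n).injective
    ext1 t
    exact (h.natural θ.unop.toOrderHom s t).symm

/-- The map out of a realization attached to a compatible family of maps on simplices. -/
def SimplexFamily.desc (h : SimplexFamily C W) : C(Realization C, W) :=
  ((sSetTopAdj.homEquiv (nerve C) (TopCat.of W)).symm h.sset).hom

theorem comp_simplexIncl (f : C(Realization C, W)) {n : ℕ} (s : ComposableArrows C n) :
    f.comp (simplexIncl s) = TopCat.toSSetObjEquiv (TopCat.of W) (op (SimplexCategory.mk n))
      ((sSetTopAdj.homEquiv (nerve C) (TopCat.of W) (TopCat.ofHom f)).app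
        (op (SimplexCategory.mk n)) s) := by
  rw [Adjunction.homEquiv_unit]
  rfl

theorem homEquiv_symm_simplexIncl (σ : nerve C ⟶ TopCat.toSSet.obj (TopCat.of W)) {n : ℕ}
    (s : ComposableArrows C n) :
    (((sSetTopAdj.homEquiv (nerve C) (TopCat.of W)).symm σ).hom).comp (simplexIncl s) =
      TopCat.toSSetObjEquiv (TopCat.of W) (op (SimplexCategory.mk n))
        (σ.app (op (SimplexCategory.mk n)) s) := by
  rw [comp_simplexIncl, TopCat.ofHom_hom, Equiv.apply_symm_apply]

theorem SimplexFamily.desc_simplexIncl (h : SimplexFamily C W) {n : ℕ}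
    (s : ComposableArrows C n) (t : stdSimplex ℝ (Fin (n + 1))) :
    h.desc (simplexIncl s t) = h.map s t :=
  DFunLike.congr_fun (homEquiv_symm_simplexIncl h.sset s) t

/-- A map out of a realization is determined by its restrictions to the closed simplices, degenerate
ones included. -/
theorem realization_hom_ext {f g : C(Realization C, W)}
    (h : ∀ {n : ℕ} (s : ComposableArrows C n) (t : stdSimplex ℝ (Fin (n + 1))),
      f (simplexIncl s t) = g (simplexIncl s t)) : f = g := by
  have : TopCat.ofHom f = TopCat.ofHom g := by
    apply (sSetTopAdj.homEquiv (nerve C) (TopCat.of W)).injective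
    ext n s
    apply (TopCat.toSSetObjEquiv (TopCat.of W) n).injective
    ext1 t
    have := h (n := n.unop.len) s t
    have e1 := DFunLike.congr_fun (comp_simplexIncl f (n := n.unop.len) s) t
    have e2 := DFunLike.congr_fun (comp_simplexIncl g (n := n.unop.len) s) t
    exact e1.symm.trans (this.trans e2)
  exact congrArg TopCat.Hom.hom this

theorem realize_simplexIncl (Φ : C ⥤ C') {n : ℕ} (s : ComposableArrows C n)
    (t : stdSimplex ℝ (Fin (n + 1))) :
    realize Φ (simplexIncl s t) = simplexIncl (s ⋙ Φ) t := by
  exact toTop_map_cellIncl (nerveMap Φ) s t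

/-- A compatible family of homotopies on the simplices of a nerve. -/
structure SimplexHomotopy (C W : Type) [Category.{0} C] [TopologicalSpace W] where
  map : ∀ {n : ℕ}, ComposableArrows C n → stdSimplex ℝ (Fin (n + 1)) → unitInterval → W
  continuous : ∀ {n : ℕ} (s : ComposableArrows C n),
    Continuous fun x : stdSimplex ℝ (Fin (n + 1)) × unitInterval => map s x.1 x.2
  natural : ∀ {m n : ℕ} (θ : Fin (m + 1) →o Fin (n + 1)) (s : ComposableArrows C n)
    (t : stdSimplex ℝ (Fin (m + 1))) r, map s (stdSimplex.map θ t) r = map (reindex θ s) t r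

/-- The homotopy seen as a family of maps into a space of paths. -/
def SimplexHomotopy.curry (h : SimplexHomotopy C W) : SimplexFamily C C(unitInterval, W) where
  map s := ContinuousMap.curry ⟨fun x => h.map s x.1 x.2, h.continuous s⟩
  natural θ s t := by
    ext r
    exact h.natural θ s t r

/-- A compatible family of homotopies on simplices gives a homotopy on the realization.  Paths in the
target form a space, and the realization has a universal property only for maps out of it, so the
homotopy is obtained as a map into that path space. -/
theorem SimplexHomotopy.homotopic (h : SimplexHomotopy C W) {f g : C(Realization C, W)}
    (hf : ∀ {n : ℕ} (s : ComposableArrows C n) t, f (simplexIncl s t) = h.map s t 0)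
    (hg : ∀ {n : ℕ} (s : ComposableArrows C n) t, g (simplexIncl s t) = h.map s t 1) :
    ContinuousMap.Homotopic f g := by
  have key : ∀ (r : unitInterval) {k : C(Realization C, W)},
      (∀ {n : ℕ} (s : ComposableArrows C n) t, k (simplexIncl s t) = h.map s t r) →
      ∀ x, h.curry.desc x r = k x := by
    intro r k hk
    have : (⟨fun x => h.curry.desc x r,
        (continuous_eval_const r).comp h.curry.desc.continuous⟩ :
        C(Realization C, W)) = k := by
      refine realization_hom_ext fun s t => ?_
      rw [hk]
      change h.curry.desc (simplexIncl s t) r = _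
      rw [h.curry.desc_simplexIncl]
      rfl
    exact fun x => DFunLike.congr_fun this x
  exact ⟨{ toFun := fun x => h.curry.desc x.2 x.1
           continuous_toFun :=
            (ContinuousEval.continuous_eval).comp
              ((h.curry.desc.continuous.comp continuous_snd).prodMk continuous_fst)
           map_zero_left := fun x => key 0 hf x
           map_one_left := fun x => key 1 hg x }⟩

/-- The map obtained by fixing the time of a compatible family of homotopies. -/
def SimplexHomotopy.at (h : SimplexHomotopy C W) (r : unitInterval) : SimplexFamily C W where
  map s := ⟨fun t => h.map s t r, (h.continuous s).comp (continuous_id.prodMk continuous_const)⟩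
  natural θ s t := h.natural θ s t r

end Realization

end

section

/-! ### Points of the order complex as monotone step functions -/

section Steps

variable {P : Type} [PartialOrder P]

/-- The closed simplex of the order complex spanned by a chain. -/
def chainIncl {n : ℕ} (σ : Fin (n + 1) →o P) : C(stdSimplex ℝ (Fin (n + 1)), Realization P) :=
  simplexIncl σ.monotone.functor

theorem chainIncl_map {m n : ℕ} (θ : Fin (m + 1) →o Fin (n + 1)) (σ : Fin (n + 1) →o P)
    (t : stdSimplex ℝ (Fin (m + 1))) :
    chainIncl σ (stdSimplex.map θ t) = chainIncl (σ.comp θ) t :=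
  simplexIncl_map θ σ.monotone.functor t

theorem stdSimplex_map_apply {m n : ℕ} (θ : Fin m → Fin n) (t : stdSimplex ℝ (Fin m))
    (j : Fin n) : stdSimplex.map θ t j = ∑ i with θ i = j, t i := by
  simp [stdSimplex.map_coe, FunOnFinite.linearMap_apply_apply]

/-- Every point of a simplex is an interior point of some face. -/
theorem exists_positive_face {n : ℕ} (t : stdSimplex ℝ (Fin (n + 1))) :
    ∃ (m : ℕ) (θ : Fin (m + 1) →o Fin (n + 1)) (t' : stdSimplex ℝ (Fin (m + 1))),
      stdSimplex.map θ t' = t ∧ ∀ i, 0 < t' i := by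
  classical
  set K : Finset (Fin (n + 1)) := Finset.univ.filter fun i => 0 < t i with hK
  have hne : K.Nonempty := by
    by_contra h
    rw [Finset.not_nonempty_iff_eq_empty] at h
    have h0 : ∑ i, t i ≤ 0 := Finset.sum_nonpos fun i _ => by
      by_contra hi
      have : i ∈ K := by simp [hK, not_le.mp hi]
      simp [h] at this
    rw [stdSimplex.sum_eq_one] at h0
    linarith
  obtain ⟨m, hm⟩ : ∃ m, K.card = m + 1 := ⟨K.card - 1, by have := hne.card_pos; omega⟩
  have hsum : ∑ i, t (K.orderEmbOfFin hm i) = 1 := by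
    rw [← stdSimplex.sum_eq_one t, ← Finset.sum_subset (Finset.subset_univ K)]
    · rw [← Finset.sum_coe_sort K, ← Equiv.sum_comp (K.orderIsoOfFin hm).toEquiv]
      rfl
    · intro i _ hi
      have : ¬ 0 < t i := fun h => hi (by simp [hK, h])
      exact le_antisymm (not_lt.mp this) (t.2.1 i)
  refine ⟨m, (K.orderEmbOfFin hm).toOrderHom, ⟨fun i => t (K.orderEmbOfFin hm i),
    fun i => t.2.1 _, hsum⟩, ?_, ?_⟩
  · ext j
    rw [stdSimplex_map_apply]
    by_cases hj : j ∈ K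
    · obtain ⟨i, rfl⟩ : ∃ i, K.orderEmbOfFin hm i = j := by
        have : j ∈ Set.range (K.orderEmbOfFin hm) := by
          rw [Finset.range_orderEmbOfFin]; exact hj
        exact this
      have : (Finset.univ.filter fun i' => (K.orderEmbOfFin hm).toOrderHom i' =
          K.orderEmbOfFin hm i) = {i} := by
        ext i'; simp
      rw [this, Finset.sum_singleton]
      rfl
    · have : ¬ 0 < t j := fun h => hj (by simp [hK, h])
      rw [le_antisymm (not_lt.mp this) (t.2.1 j)]
      refine Finset.sum_eq_zero fun i hi => absurd ?_ hj
      rw [Finset.mem_filter] at hi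
      rw [← hi.2]
      exact Finset.orderEmbOfFin_mem K hm i
  · intro i
    have := Finset.orderEmbOfFin_mem K hm i
    exact (Finset.mem_filter.mp this).2

/-- The mass that the point with coordinates `t` of the simplex of a chain puts on `p`. -/
def chainMass {n : ℕ} (σ : Fin (n + 1) →o P) (t : stdSimplex ℝ (Fin (n + 1))) (p : P) : ℝ := by
  classical
  exact ∑ i with σ i = p, t i

theorem chainMass_map {m n : ℕ} (θ : Fin (m + 1) →o Fin (n + 1)) (σ : Fin (n + 1) →o P)
    (t : stdSimplex ℝ (Fin (m + 1))) (p : P) :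
    chainMass σ (stdSimplex.map θ t) p = chainMass (σ.comp θ) t p := by
  classical
  unfold chainMass
  simp only [stdSimplex_map_apply]
  rw [Finset.sum_sigma', Finset.sum_bij' (fun x _ => x.2) (fun i _ => ⟨θ i, i⟩)]
  · rintro ⟨a, b⟩ h
    simp only [Finset.mem_sigma, Finset.mem_filter, Finset.mem_univ, true_and] at h ⊢
    rw [← h.1, ← h.2]
    rfl
  · simp
  · rintro ⟨a, b⟩ h
    simp only [Finset.mem_sigma, Finset.mem_filter, Finset.mem_univ, true_and] at h
    rw [h.2]
  · simp
  · simp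

/-- A point of the order complex is determined by the masses it puts on the vertices.  Both chains
are pulled back from a third one, on which the values of the second chain appear once each. -/
theorem chainIncl_eq_of_mass {n n' : ℕ} {σ : Fin (n + 1) →o P} {σ' : Fin (n' + 1) →o P}
    {t : stdSimplex ℝ (Fin (n + 1))} {t' : stdSimplex ℝ (Fin (n' + 1))}
    (h : chainMass σ t = chainMass σ' t') : chainIncl σ t = chainIncl σ' t' := by
  classical
  obtain ⟨m, θ, u, rfl, hu⟩ := exists_positive_face t
  rw [chainIncl_map]
  have h1 : chainMass (σ.comp θ) u = chainMass σ' t' := by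
    rw [← h]; funext p; rw [chainMass_map]
  generalize σ.comp θ = ρ at h1
  have hex : ∀ i, ∃ j, σ' j = ρ i := by
    intro i
    by_contra! hno
    have h2 : chainMass σ' t' (ρ i) = 0 := Finset.sum_eq_zero fun j hj =>
      absurd (Finset.mem_filter.mp hj).2 (hno j)
    rw [← h1] at h2
    have h3 : u i ≤ chainMass ρ u (ρ i) :=
      Finset.single_le_sum (f := fun i => u i) (fun j _ => u.2.1 j)
        (Finset.mem_filter.mpr ⟨Finset.mem_univ i, rfl⟩)
    linarith [hu i]
  -- the first index at which `σ'` takes a given value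
  have hfirst : ∀ q : P, (∃ j, σ' j = q) → ∃ j, σ' j = q ∧ ∀ j', σ' j' = q → j ≤ j' := by
    rintro q ⟨j, hj⟩
    have hne : (Finset.univ.filter fun j => σ' j = q).Nonempty := ⟨j, by simp [hj]⟩
    refine ⟨_, (Finset.mem_filter.mp (Finset.min'_mem _ hne)).2, fun j' hj' => ?_⟩
    exact Finset.min'_le _ _ (by simp [hj'])
  choose! a ha hmin using hfirst
  have hmono : ∀ q q', (∃ j, σ' j = q) → (∃ j, σ' j = q') → q ≤ q' → a q ≤ a q' := by
    intro q q' hq hq' hle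
    by_contra hlt
    have := σ'.monotone (not_le.mp hlt).le
    rw [ha q hq, ha q' hq'] at this
    have := le_antisymm hle this
    subst this
    exact hlt le_rfl
  let φ : Fin (m + 1) →o Fin (n' + 1) :=
    ⟨fun i => a (ρ i), fun i j hij => hmono _ _ (hex i) (hex j) (ρ.monotone hij)⟩
  let φ' : Fin (n' + 1) →o Fin (n' + 1) :=
    ⟨fun i => a (σ' i), fun i j hij => hmono _ _ ⟨i, rfl⟩ ⟨j, rfl⟩ (σ'.monotone hij)⟩
  have e1 : σ'.comp φ = ρ := OrderHom.ext _ _ (funext fun i => ha _ (hex i))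
  have e2 : σ'.comp φ' = σ' := OrderHom.ext _ _ (funext fun i => ha _ ⟨i, rfl⟩)
  have e3 : stdSimplex.map φ u = stdSimplex.map φ' t' := by
    ext j
    rw [stdSimplex_map_apply, stdSimplex_map_apply]
    by_cases hj : ∃ q, (∃ j', σ' j' = q) ∧ a q = j
    · obtain ⟨q, hq, rfl⟩ := hj
      have hinj : ∀ q', (∃ j', σ' j' = q') → (a q' = a q ↔ q' = q) := fun q' hq' =>
        ⟨fun h => by rw [← ha q hq, ← ha q' hq', h], fun h => by rw [h]⟩
      have := congrFun h1 q
      unfold chainMass at this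
      rw [show (Finset.univ.filter fun i => φ i = a q) = Finset.univ.filter fun i => ρ i = q from
          Finset.filter_congr fun i _ => hinj _ (hex i),
        show (Finset.univ.filter fun i => φ' i = a q) = Finset.univ.filter fun i => σ' i = q from
          Finset.filter_congr fun i _ => hinj _ ⟨i, rfl⟩]
      exact this
    · rw [Finset.sum_eq_zero, Finset.sum_eq_zero]
      · exact fun i hi => absurd ⟨_, ⟨i, rfl⟩, (Finset.mem_filter.mp hi).2⟩ hj
      · exact fun i hi => absurd ⟨_, hex i, (Finset.mem_filter.mp hi).2⟩ hj
  rw [← e1, ← chainIncl_map, e3, chainIncl_map, e2]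

/-- The partial sums of the barycentric coordinates. -/
def partialSum {n : ℕ} (t : stdSimplex ℝ (Fin n)) (k : ℕ) : ℝ := ∑ i with i.val < k, t i

theorem partialSum_zero {n : ℕ} (t : stdSimplex ℝ (Fin n)) : partialSum t 0 = 0 := by
  simp [partialSum]

theorem partialSum_last {n : ℕ} (t : stdSimplex ℝ (Fin n)) : partialSum t n = 1 := by
  rw [← stdSimplex.sum_eq_one t, partialSum, Finset.filter_true_of_mem fun i _ => i.isLt]

theorem partialSum_succ {n : ℕ} (t : stdSimplex ℝ (Fin n)) (j : Fin n) :
    partialSum t (j + 1) = partialSum t j + t j := by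
  classical
  unfold partialSum
  have : (Finset.univ.filter fun i : Fin n => i.val < j.val + 1) =
      insert j (Finset.univ.filter fun i : Fin n => i.val < j.val) := by
    ext i
    simp only [Finset.mem_filter, Finset.mem_univ, true_and, Finset.mem_insert, Fin.ext_iff]
    omega
  rw [this, Finset.sum_insert (by simp), add_comm]

theorem partialSum_mono {n : ℕ} (t : stdSimplex ℝ (Fin n)) : Monotone (partialSum t) := by
  intro k l hkl
  refine Finset.sum_le_sum_of_subset_of_nonneg ?_ fun i _ _ => t.2.1 i
  intro i hi
  simp only [Finset.mem_filter, Finset.mem_univ, true_and] at hi ⊢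
  omega

/-- The subinterval of `[0, 1)` belonging to a vertex. -/
def piece {n : ℕ} (t : stdSimplex ℝ (Fin n)) (j : Fin n) : Set ℝ :=
  Set.Ico (partialSum t j) (partialSum t (j + 1))

theorem exists_piece {n : ℕ} (t : stdSimplex ℝ (Fin n)) {r : ℝ} (hr : r ∈ Set.Ico (0 : ℝ) 1) :
    ∃ j, r ∈ piece t j := by
  have hex : ∃ k, r < partialSum t k := ⟨n, by rw [partialSum_last]; exact hr.2⟩
  classical
  have h1 := Nat.find_spec hex
  have h2 := fun k => Nat.find_min hex (m := k)
  have h3 : Nat.find hex ≤ n := Nat.find_min' hex (by rw [partialSum_last]; exact hr.2)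
  obtain ⟨k, hk⟩ : ∃ k, Nat.find hex = k + 1 := by
    refine Nat.exists_eq_succ_of_ne_zero fun h0 => ?_
    rw [h0, partialSum_zero] at h1
    exact absurd hr.1 (not_le.mpr h1)
  refine ⟨⟨k, by omega⟩, not_lt.mp (h2 k (by omega)), ?_⟩
  rw [hk] at h1
  exact h1

theorem piece_subset {n : ℕ} (t : stdSimplex ℝ (Fin n)) (j : Fin n) :
    piece t j ⊆ Set.Ico 0 1 := by
  intro r hr
  refine ⟨?_, ?_⟩
  · rw [← partialSum_zero t]
    exact (partialSum_mono t (Nat.zero_le _)).trans hr.1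
  · rw [← partialSum_last t]
    exact hr.2.trans_le (partialSum_mono t j.isLt)

theorem piece_le {n : ℕ} {t : stdSimplex ℝ (Fin n)} {i j : Fin n} {r r' : ℝ} (hr : r ∈ piece t i)
    (hr' : r' ∈ piece t j) (h : r ≤ r') : i ≤ j := by
  by_contra hlt
  have h1 : j.val + 1 ≤ i.val := not_le.mp hlt
  have := partialSum_mono t h1
  have := hr.1
  have := hr'.2
  linarith

theorem piece_unique {n : ℕ} {t : stdSimplex ℝ (Fin n)} {i j : Fin n} {r : ℝ}
    (hr : r ∈ piece t i) (hr' : r ∈ piece t j) : i = j :=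
  le_antisymm (piece_le hr hr' le_rfl) (piece_le hr' hr le_rfl)

/-- The step function `τ` takes the value `σ j` on an interval of length `t j`, in this order. -/
def Presents {n : ℕ} (τ : ℝ → P) (σ : Fin (n + 1) →o P) (t : stdSimplex ℝ (Fin (n + 1))) : Prop :=
  ∀ j, ∀ r ∈ piece t j, τ r = σ j

/-- The masses of a point are the lengths of the level sets of the step function, so they depend
only on the step function. -/
theorem Presents.mass {n : ℕ} {τ : ℝ → P} {σ : Fin (n + 1) →o P}
    {t : stdSimplex ℝ (Fin (n + 1))} (h : Presents τ σ t) (p : P) :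
    chainMass σ t p = (MeasureTheory.volume {r | r ∈ Set.Ico (0 : ℝ) 1 ∧ τ r = p}).toReal := by
  classical
  have hset : {r | r ∈ Set.Ico (0 : ℝ) 1 ∧ τ r = p} =
      ⋃ j ∈ Finset.univ.filter fun j => σ j = p, piece t j := by
    ext r
    simp only [Set.mem_ofPred_eq, Set.mem_iUnion, Finset.mem_filter, Finset.mem_univ, true_and]
    constructor
    · rintro ⟨hr, rfl⟩
      obtain ⟨j, hj⟩ := exists_piece t hr
      exact ⟨j, (h j r hj).symm, hj⟩
    · rintro ⟨j, rfl, hj⟩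
      exact ⟨piece_subset t j hj, h j r hj⟩
  rw [hset, MeasureTheory.measure_biUnion_finset]
  · rw [ENNReal.toReal_sum]
    · refine Finset.sum_congr rfl fun j _ => ?_
      rw [piece, Real.volume_Ico, partialSum_succ, add_sub_cancel_left]
      exact (ENNReal.toReal_ofReal (t.2.1 j)).symm
    · intro j _
      rw [piece, Real.volume_Ico]
      exact ENNReal.ofReal_ne_top
  · intro i _ j _ hij
    exact Set.disjoint_left.mpr fun r hr hr' => hij (piece_unique hr hr')
  · intro j _
    exact measurableSet_Ico

theorem Presents.unique {n n' : ℕ} {τ : ℝ → P} {σ : Fin (n + 1) →o P}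
    {t : stdSimplex ℝ (Fin (n + 1))} (h : Presents τ σ t) {σ' : Fin (n' + 1) →o P}
    {t' : stdSimplex ℝ (Fin (n' + 1))} (h' : Presents τ σ' t') :
    chainIncl σ t = chainIncl σ' t' :=
  chainIncl_eq_of_mass (funext fun p => by rw [h.mass, h'.mass])

/-- The point of the order complex given by a monotone step function on `[0, 1)`.  For any other
function this is the vertex `τ 0`. -/
def stepPoint (τ : ℝ → P) : Realization P := by
  classical
  exact if h : ∃ x : (Σ n : ℕ, (Fin (n + 1) →o P) × stdSimplex ℝ (Fin (n + 1))),
      Presents τ x.2.1 x.2.2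
    then chainIncl h.choose.2.1 h.choose.2.2
    else chainIncl (n := 0) ⟨fun _ => τ 0, fun _ _ _ => le_rfl⟩ (stdSimplex.vertex 0)

theorem Presents.stepPoint_eq {n : ℕ} {τ : ℝ → P} {σ : Fin (n + 1) →o P}
    {t : stdSimplex ℝ (Fin (n + 1))} (h : Presents τ σ t) : stepPoint τ = chainIncl σ t := by
  have hex : ∃ x : (Σ n : ℕ, (Fin (n + 1) →o P) × stdSimplex ℝ (Fin (n + 1))),
      Presents τ x.2.1 x.2.2 := ⟨⟨n, σ, t⟩, h⟩
  unfold stepPoint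
  rw [dif_pos hex]
  exact hex.choose_spec.unique h

/-- A map that is monotone on a nonempty set of indices agrees there with a chain. -/
theorem exists_chain_extension {n : ℕ} (S : Fin (n + 1) → P) (K : Finset (Fin (n + 1)))
    (hK : K.Nonempty) (hS : ∀ i ∈ K, ∀ j ∈ K, i ≤ j → S i ≤ S j) :
    ∃ σ : Fin (n + 1) →o P, ∀ k ∈ K, σ k = S k := by
  classical
  -- an index `j` is sent to the last element of `K` up to `j`, or else to the first one of `K`
  let A : Fin (n + 1) → Finset (Fin (n + 1)) := fun j => insert (K.min' hK) (K.filter (· ≤ j))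
  have hA : ∀ j, (A j).Nonempty := fun j => ⟨_, Finset.mem_insert_self _ _⟩
  have hsub : ∀ j, (A j).max' (hA j) ∈ K := fun j => by
    rcases Finset.mem_insert.mp (Finset.max'_mem (A j) (hA j)) with h | h
    · rw [h]; exact K.min'_mem hK
    · exact (Finset.mem_filter.mp h).1
  refine ⟨⟨fun j => S ((A j).max' (hA j)), fun i j hij => hS _ (hsub i) _ (hsub j) ?_⟩, ?_⟩
  · refine Finset.max'_subset _ (Finset.insert_subset_insert _ fun k hk => ?_)
    rw [Finset.mem_filter] at hk ⊢
    exact ⟨hk.1, hk.2.trans hij⟩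
  · intro k hk
    have : (A k).max' (hA k) = k := by
      refine le_antisymm (Finset.max'_le _ _ _ fun i hi => ?_) (Finset.le_max' _ _ ?_)
      · rcases Finset.mem_insert.mp hi with h | h
        · rw [h]; exact K.min'_le k hk
        · exact (Finset.mem_filter.mp h).2
      · exact Finset.mem_insert_of_mem (Finset.mem_filter.mpr ⟨hk, le_rfl⟩)
    change S ((A k).max' (hA k)) = S k
    rw [this]

/-- Functions of the form `r ↦ m {i | r < c i}`, with thresholds `c i` that depend continuously on
a parameter, give points of the order complex that depend continuously on the parameter. -/
theorem continuous_stepPoint {X ι : Type} [TopologicalSpace X] [Fintype ι] (c : ι → X → ℝ)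
    (hc : ∀ i, Continuous (c i)) (h0 : ∀ i x, 0 ≤ c i x) (h1 : ∀ i x, c i x ≤ 1)
    (m : Set ι → P) (τ : X → ℝ → P)
    (hτ : ∀ x, ∀ r ∈ Set.Ico (0 : ℝ) 1, τ x r = m {i | r < c i x})
    (hmono : ∀ x, MonotoneOn (τ x) (Set.Ico 0 1)) :
    (Continuous fun x => stepPoint (τ x)) ∧
      ∀ x, ∃ (n : ℕ) (σ : Fin (n + 1) →o P) (t : stdSimplex ℝ (Fin (n + 1))),
        Presents (τ x) σ t := by
  classical
  set N := Fintype.card ι with hN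
  -- for an ordering `e` of the thresholds, `b e x` lists the breakpoints
  let b : (Fin N ≃ ι) → X → ℕ → ℝ := fun e x k =>
    if k = 0 then 0 else if h : k - 1 < N then c (e ⟨k - 1, h⟩) x else 1
  have hb0 : ∀ e x, b e x 0 = 0 := fun e x => if_pos rfl
  have hbs : ∀ e x k (h : k < N), b e x (k + 1) = c (e ⟨k, h⟩) x := fun e x k h => by
    simp [b, h]
  have hbl : ∀ e x, b e x (N + 1) = 1 := fun e x => by simp [b]
  have hbc : ∀ e k, Continuous fun x => b e x k := by
    intro e k
    by_cases hk : k = 0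
    · simp only [b, hk, if_true]; exact continuous_const
    · by_cases h : k - 1 < N
      · simp only [b, hk, if_false, h, dif_pos]; exact hc _
      · simp only [b, hk, if_false, h, dif_neg, not_false_eq_true]; exact continuous_const
  -- `w e x k` is the length of the `k`-th piece, and `S e k` the value taken on it
  let w : (Fin N ≃ ι) → X → Fin (N + 1) → ℝ := fun e x k => b e x (k + 1) - b e x k
  let S : (Fin N ≃ ι) → Fin (N + 1) → P := fun e k => m {i | k.val ≤ (e.symm i).val}
  -- `Y (e, K)` is the closed set where `e` sorts the thresholds and only pieces in `K` have
  -- positive length; the values on these pieces form a chain that does not vary with `x`, so the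
  -- map is continuous there, and finitely many sets of this form cover `X`
  let Y : (Fin N ≃ ι) × Finset (Fin (N + 1)) → Set X := fun q =>
    {x | (∀ k, 0 ≤ w q.1 x k) ∧ (∀ k, k ∉ q.2 → w q.1 x k = 0) ∧
      (∀ i ∈ q.2, ∀ j ∈ q.2, i ≤ j → S q.1 i ≤ S q.1 j)}
  have hwc : ∀ e k, Continuous fun x => w e x k := fun e k => (hbc e _).sub (hbc e _)
  have hYcl : ∀ q, IsClosed (Y q) := by
    intro q
    have h1 : IsClosed {x | ∀ k, 0 ≤ w q.1 x k} := by
      simp only [Set.ofPred_forall]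
      exact isClosed_iInter fun k => isClosed_le continuous_const (hwc _ k)
    have h2 : IsClosed {x | ∀ k, k ∉ q.2 → w q.1 x k = 0} := by
      simp only [Set.ofPred_forall]
      exact isClosed_iInter fun k => isClosed_iInter fun _ =>
        isClosed_eq (hwc _ k) continuous_const
    exact h1.inter (h2.inter isClosed_const)
  have hwsum : ∀ e x, ∑ k, w e x k = 1 := by
    intro e x
    rw [Fin.sum_univ_eq_sum_range (fun k => b e x (k + 1) - b e x k) (N + 1),
      Finset.sum_range_sub, hbl, hb0, sub_zero]
  have hbmono : ∀ e x, (∀ k, 0 ≤ w e x k) → ∀ k l, k ≤ l → l ≤ N + 1 → b e x k ≤ b e x l := by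
    intro e x hw k l hkl hl
    induction l, hkl using Nat.le_induction with
    | base => exact le_rfl
    | succ l _ ih =>
      have := hw ⟨l, by omega⟩
      have h3 : b e x l ≤ b e x (l + 1) := by simpa [w] using this
      exact (ih (by omega)).trans h3
  have hset : ∀ e x, (∀ k, 0 ≤ w e x k) → ∀ (j : Fin (N + 1)) (r : ℝ), b e x j ≤ r →
      r < b e x (j + 1) → τ x r = S e j := by
    intro e x hw j r hr hr'
    have hmem : r ∈ Set.Ico (0 : ℝ) 1 := by
      constructor
      · have := hbmono e x hw 0 j (Nat.zero_le _) (by omega)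
        rw [hb0] at this
        exact this.trans hr
      · have := hbmono e x hw (j + 1) (N + 1) (by omega) le_rfl
        rw [hbl] at this
        exact hr'.trans_le this
    rw [hτ x r hmem]
    change m _ = m _
    congr 1
    ext i
    obtain ⟨l, rfl⟩ := e.surjective i
    change r < c (e l) x ↔ j.val ≤ (e.symm (e l)).val
    rw [Equiv.symm_apply_apply]
    have hl : b e x (l.val + 1) = c (e l) x := hbs e x l.val l.isLt
    rw [← hl]
    constructor
    · intro h
      by_contra hlt
      have := hbmono e x hw (l + 1) j (by omega) (by omega)
      linarith
    · intro h
      exact hr'.trans_le (hbmono e x hw (j + 1) (l + 1) (by omega) (by omega))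
  have hcover : ⋃ q, Y q = Set.univ := by
    refine Set.eq_univ_of_forall fun x => Set.mem_iUnion.mpr ?_
    let e0 : Fin N ≃ ι := (Fintype.equivFin ι).symm
    let e : Fin N ≃ ι := (Tuple.sort fun k => c (e0 k) x).trans e0
    have hsort : Monotone fun k => c (e k) x := Tuple.monotone_sort fun k => c (e0 k) x
    have hw : ∀ k, 0 ≤ w e x k := by
      rintro ⟨k, hk⟩
      change 0 ≤ b e x (k + 1) - b e x k
      rcases Nat.eq_zero_or_pos k with rfl | hpos
      · rw [hb0, sub_zero]
        rcases Nat.eq_zero_or_pos N with hN0 | hN0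
        · have : b e x (0 + 1) = 1 := by
            have := hbl e x
            rwa [hN0] at this
          rw [this]; exact zero_le_one
        · rw [hbs e x 0 hN0]; exact h0 _ _
      · obtain ⟨l, rfl⟩ : ∃ l, k = l + 1 := ⟨k - 1, by omega⟩
        rw [hbs e x l (by omega)]
        rcases Nat.lt_or_ge (l + 1) N with h | h
        · rw [hbs e x (l + 1) h, sub_nonneg]
          exact hsort (by simp)
        · have hl : l + 1 = N := by omega
          have := hbl e x
          rw [← hl] at this
          rw [this, sub_nonneg]
          exact h1 _ _
    refine ⟨(e, Finset.univ.filter fun k => 0 < w e x k), hw, ?_, ?_⟩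
    · intro k hk
      rw [Finset.mem_filter, not_and] at hk
      exact le_antisymm (not_lt.mp (hk (Finset.mem_univ k))) (hw k)
    · intro i hi j hj hij
      rw [Finset.mem_filter] at hi hj
      have hi' : b e x i < b e x (i + 1) := sub_pos.mp hi.2
      have hj' : b e x j < b e x (j + 1) := sub_pos.mp hj.2
      have hrange : ∀ k : Fin (N + 1), b e x k < b e x (k + 1) → b e x k ∈ Set.Ico (0 : ℝ) 1 := by
        intro k hk
        refine ⟨?_, hk.trans_le ?_⟩
        · rw [← hb0 e x]; exact hbmono e x hw 0 k (Nat.zero_le _) (by omega)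
        · rw [← hbl e x]; exact hbmono e x hw (k + 1) (N + 1) (by omega) le_rfl
      rw [← hset e x hw i _ le_rfl hi', ← hset e x hw j _ le_rfl hj']
      exact hmono x (hrange i hi') (hrange j hj') (hbmono e x hw i j hij (by omega))
  have hKne : ∀ e K x, x ∈ Y (e, K) → K.Nonempty := by
    intro e K x hx
    by_contra hK
    rw [Finset.not_nonempty_iff_eq_empty] at hK
    have : ∑ k, w e x k = 0 := Finset.sum_eq_zero fun k _ => hx.2.1 k (by simp [hK])
    rw [hwsum] at this
    exact one_ne_zero this
  let t : ∀ e K, Y (e, K) → stdSimplex ℝ (Fin (N + 1)) :=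
    fun e K x => ⟨w e x, x.2.1, hwsum e x⟩
  have hpres : ∀ e K (x : Y (e, K)) (σ : Fin (N + 1) →o P), (∀ k ∈ K, σ k = S e k) →
      Presents (τ x) σ (t e K x) := by
    intro e K x σ hσ j r hr
    have hps : ∀ k, k ≤ N + 1 → partialSum (t e K x) k = b e x k := by
      intro k hk
      induction k with
      | zero => rw [partialSum_zero, hb0]
      | succ k ih =>
        have := partialSum_succ (t e K x) ⟨k, hk⟩
        simp only at this
        rw [this, ih (by omega)]
        change b e x k + (b e x (k + 1) - b e x k) = _
        ring
    rw [piece, hps j (by omega), hps (j + 1) (by omega)] at hr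
    have hj : j ∈ K := by
      by_contra hj
      have : b e x (j + 1) - b e x j = 0 := x.2.2.1 j hj
      have := hr.1.trans_lt hr.2
      linarith
    rw [hσ j hj]
    exact hset e x x.2.1 j r hr.1 hr.2
  constructor
  · refine (locallyFinite_of_finite Y).continuous hcover hYcl ?_
    rintro ⟨e, K⟩
    rcases (Y (e, K)).eq_empty_or_nonempty with hempty | ⟨x₀, hx₀⟩
    · rw [hempty]; exact continuousOn_empty _
    obtain ⟨σ, hσ⟩ := exists_chain_extension (S e) K (hKne e K x₀ hx₀) hx₀.2.2
    have htc : Continuous (t e K) := Continuous.subtype_mk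
      (continuous_pi fun k => (hwc e k).comp continuous_subtype_val) _
    rw [continuousOn_iff_continuous_domRestrict]
    have heq : (Y (e, K)).domRestrict (fun x => stepPoint (τ x)) =
        fun x => chainIncl σ (t e K x) :=
      funext fun x => (hpres e K x σ hσ).stepPoint_eq
    rw [heq]
    exact (chainIncl σ).continuous.comp htc
  · intro x
    have : x ∈ ⋃ q, Y q := by rw [hcover]; trivial
    obtain ⟨⟨e, K⟩, hx⟩ := Set.mem_iUnion.mp this
    obtain ⟨σ, hσ⟩ := exists_chain_extension (S e) K (hKne e K x hx) hx.2.2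
    exact ⟨N, σ, t e K ⟨x, hx⟩, hpres e K ⟨x, hx⟩ σ hσ⟩

theorem stepPoint_congr {τ τ' : ℝ → P} (h : ∀ r ∈ Set.Ico (0 : ℝ) 1, τ r = τ' r) :
    stepPoint τ = stepPoint τ' := by
  have hiff : ∀ (n : ℕ) (σ : Fin (n + 1) →o P) t, Presents τ σ t ↔ Presents τ' σ t :=
    fun n σ t => forall₃_congr fun j r hr => by rw [h r (piece_subset t j hr)]
  by_cases hex : ∃ (n : ℕ) (σ : Fin (n + 1) →o P) (t : stdSimplex ℝ (Fin (n + 1))),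
      Presents τ σ t
  · obtain ⟨n, σ, t, hp⟩ := hex
    rw [hp.stepPoint_eq, ((hiff n σ t).mp hp).stepPoint_eq]
  · have h1 : ¬ ∃ x : (Σ n : ℕ, (Fin (n + 1) →o P) × stdSimplex ℝ (Fin (n + 1))),
        Presents τ x.2.1 x.2.2 := fun ⟨x, hx⟩ => hex ⟨_, _, _, hx⟩
    have h2 : ¬ ∃ x : (Σ n : ℕ, (Fin (n + 1) →o P) × stdSimplex ℝ (Fin (n + 1))),
        Presents τ' x.2.1 x.2.2 := fun ⟨x, hx⟩ => hex ⟨_, _, _, (hiff _ _ _).mpr hx⟩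
    unfold stepPoint
    rw [dif_neg h1, dif_neg h2]
    exact congrArg (fun p : P => chainIncl (n := 0) ⟨fun _ => p, fun _ _ _ => le_rfl⟩
      (stdSimplex.vertex 0)) (h 0 ⟨le_rfl, one_pos⟩)

theorem Presents.realize_stepPoint {C : Type} [Category.{0} C] (Φ : P ⥤ C) {n : ℕ} {τ : ℝ → P}
    {σ : Fin (n + 1) →o P} {t : stdSimplex ℝ (Fin (n + 1))} (h : Presents τ σ t) :
    realize Φ (stepPoint τ) = simplexIncl (σ.monotone.functor ⋙ Φ) t := by
  rw [h.stepPoint_eq]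
  exact realize_simplexIncl Φ σ.monotone.functor t

theorem Presents.comp {P' : Type} [PartialOrder P'] (f : P →o P') {n : ℕ} {τ : ℝ → P}
    {σ : Fin (n + 1) →o P} {t : stdSimplex ℝ (Fin (n + 1))} (h : Presents τ σ t) :
    Presents (fun r => f (τ r)) (f.comp σ) t :=
  fun j r hr => congrArg f (h j r hr)

/-- The step function of the point with coordinates `t` of the simplex of a chain. -/
def stepFun {n : ℕ} (σ : Fin (n + 1) →o P) (t : stdSimplex ℝ (Fin (n + 1))) (r : ℝ) : P := by
  classical
  exact if h : ∃ j, r ∈ piece t j then σ h.choose else σ 0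

theorem stepFun_eq {n : ℕ} (σ : Fin (n + 1) →o P) {t : stdSimplex ℝ (Fin (n + 1))} {r : ℝ}
    {j : Fin (n + 1)} (hr : r ∈ piece t j) : stepFun σ t r = σ j := by
  have h : ∃ j, r ∈ piece t j := ⟨j, hr⟩
  unfold stepFun
  rw [dif_pos h, piece_unique h.choose_spec hr]

theorem presents_stepFun {n : ℕ} (σ : Fin (n + 1) →o P) (t : stdSimplex ℝ (Fin (n + 1))) :
    Presents (stepFun σ t) σ t := fun _ _ hr => stepFun_eq σ hr

theorem stepFun_comp {P' : Type} [PartialOrder P'] (f : P →o P') {n : ℕ} (σ : Fin (n + 1) →o P)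
    (t : stdSimplex ℝ (Fin (n + 1))) (r : ℝ) : stepFun (f.comp σ) t r = f (stepFun σ t r) := by
  unfold stepFun
  split_ifs <;> rfl

theorem partialSum_map {m n : ℕ} (θ : Fin (m + 1) →o Fin (n + 1))
    (t : stdSimplex ℝ (Fin (m + 1))) (k : ℕ) :
    partialSum (stdSimplex.map θ t) k = ∑ i with (θ i).val < k, t i := by
  classical
  unfold partialSum
  simp only [stdSimplex_map_apply]
  rw [Finset.sum_sigma', Finset.sum_bij' (fun x _ => x.2) (fun i _ => ⟨θ i, i⟩)]
  · rintro ⟨a, b⟩ h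
    simp only [Finset.mem_sigma, Finset.mem_filter, Finset.mem_univ, true_and] at h ⊢
    rw [h.2]
    exact h.1
  · simp
  · rintro ⟨a, b⟩ h
    simp only [Finset.mem_sigma, Finset.mem_filter, Finset.mem_univ, true_and] at h
    rw [h.2]
  · simp
  · simp

/-- The partial sums after a degeneracy or a face map are partial sums of the old coordinates. -/
theorem exists_partialSum_map {m n : ℕ} (θ : Fin (m + 1) →o Fin (n + 1)) (k : ℕ) :
    ∃ l, (∀ i : Fin (m + 1), (θ i).val < k ↔ i.val < l) ∧
      ∀ t : stdSimplex ℝ (Fin (m + 1)), partialSum (stdSimplex.map θ t) k = partialSum t l := by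
  classical
  have hex : ∃ l, ∀ i : Fin (m + 1), (θ i).val < k ↔ i.val < l := by
    by_cases h : ∃ l, ∃ hl : l < m + 1, k ≤ (θ ⟨l, hl⟩).val
    · refine ⟨Nat.find h, fun i => ⟨fun hi => ?_, fun hi => ?_⟩⟩
      · obtain ⟨h1, h2⟩ := Nat.find_spec h
        by_contra hlt
        have := θ.monotone (show (⟨Nat.find h, h1⟩ : Fin (m + 1)) ≤ i from not_lt.mp hlt)
        exact absurd (h2.trans this) (not_le.mpr hi)
      · by_contra hlt
        exact Nat.find_min h hi ⟨i.isLt, not_lt.mp hlt⟩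
    · push Not at h
      exact ⟨m + 1, fun i => ⟨fun _ => i.isLt, fun _ => h i i.isLt⟩⟩
  obtain ⟨l, hl⟩ := hex
  refine ⟨l, hl, fun t => ?_⟩
  rw [partialSum_map, partialSum]
  exact Finset.sum_congr (Finset.filter_congr fun i _ => hl i) fun _ _ => rfl

theorem piece_map {m n : ℕ} (θ : Fin (m + 1) →o Fin (n + 1)) {t : stdSimplex ℝ (Fin (m + 1))}
    {j : Fin (m + 1)} {r : ℝ} (hr : r ∈ piece t j) : r ∈ piece (stdSimplex.map θ t) (θ j) := by
  obtain ⟨l, hl, hl'⟩ := exists_partialSum_map θ (θ j)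
  obtain ⟨l₁, hl₁, hl₁'⟩ := exists_partialSum_map θ (θ j + 1)
  constructor
  · rw [hl']
    refine (partialSum_mono t ?_).trans hr.1
    by_contra h
    exact lt_irrefl _ ((hl j).mpr (not_le.mp h))
  · rw [hl₁']
    exact hr.2.trans_le (partialSum_mono t ((hl₁ j).mp (Nat.lt_succ_self _)))

theorem stepFun_map {m n : ℕ} (θ : Fin (m + 1) →o Fin (n + 1)) (σ : Fin (n + 1) →o P)
    (t : stdSimplex ℝ (Fin (m + 1))) {r : ℝ} (hr : r ∈ Set.Ico (0 : ℝ) 1) :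
    stepFun σ (stdSimplex.map θ t) r = stepFun (σ.comp θ) t r := by
  obtain ⟨j, hj⟩ := exists_piece t hr
  rw [stepFun_eq _ hj, stepFun_eq _ (piece_map θ hj)]
  rfl

theorem ext_of_partialSum {n : ℕ} {t t' : stdSimplex ℝ (Fin n)}
    (h : ∀ k, k ≤ n → partialSum t k = partialSum t' k) : t = t' := by
  ext j
  have h1 := h (j + 1) j.isLt
  rw [partialSum_succ, partialSum_succ, h j j.isLt.le] at h1
  exact add_left_cancel h1

theorem continuous_partialSum {n : ℕ} (k : ℕ) :
    Continuous fun t : stdSimplex ℝ (Fin n) => partialSum t k :=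
  continuous_finsetSum _ fun i _ => (continuous_apply i).comp continuous_subtype_val

/-- The coordinates of the normalized restriction of a step function to `[s, 1)`. -/
def cutCoord {n : ℕ} (t : stdSimplex ℝ (Fin n)) (s : ℝ) (hs : s ∈ Set.Ico (0 : ℝ) 1) :
    stdSimplex ℝ (Fin n) :=
  ⟨fun j => (max (partialSum t (j + 1)) s - max (partialSum t j) s) / (1 - s),
    fun j => div_nonneg (sub_nonneg.mpr (max_le_max (partialSum_mono t (Nat.le_succ _)) le_rfl))
      (sub_nonneg.mpr hs.2.le), by
    rw [← Finset.sum_div, Fin.sum_univ_eq_sum_range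
      (fun k => max (partialSum t (k + 1)) s - max (partialSum t k) s) n,
      Finset.sum_range_sub (fun k => max (partialSum t k) s), partialSum_last, partialSum_zero,
      max_eq_left hs.2.le, max_eq_right hs.1, div_self (sub_pos.mpr hs.2).ne']⟩

theorem partialSum_cutCoord {n : ℕ} (t : stdSimplex ℝ (Fin n)) {s : ℝ}
    (hs : s ∈ Set.Ico (0 : ℝ) 1) (k : ℕ) (hk : k ≤ n) :
    partialSum (cutCoord t s hs) k = (max (partialSum t k) s - s) / (1 - s) := by
  induction k with
  | zero => rw [partialSum_zero, partialSum_zero, max_eq_right hs.1, sub_self, zero_div]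
  | succ k ih =>
    have := partialSum_succ (cutCoord t s hs) ⟨k, hk⟩
    simp only at this
    rw [this, ih (by omega)]
    change _ + (max (partialSum t (k + 1)) s - max (partialSum t k) s) / (1 - s) = _
    ring

theorem cutCoord_map {m n : ℕ} (θ : Fin (m + 1) →o Fin (n + 1)) (t : stdSimplex ℝ (Fin (m + 1)))
    {s : ℝ} (hs : s ∈ Set.Ico (0 : ℝ) 1) :
    cutCoord (stdSimplex.map θ t) s hs = stdSimplex.map θ (cutCoord t s hs) := by
  refine ext_of_partialSum fun k hk => ?_
  obtain ⟨l, hl, hl'⟩ := exists_partialSum_map θ k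
  have hmin : ∀ u : stdSimplex ℝ (Fin (m + 1)), partialSum u l = partialSum u (min l (m + 1)) := by
    intro u
    unfold partialSum
    refine Finset.sum_congr (Finset.filter_congr fun i _ => ?_) fun _ _ => rfl
    omega
  rw [partialSum_cutCoord _ _ _ hk, hl', hl', hmin, hmin (cutCoord t s hs),
    partialSum_cutCoord _ _ _ (min_le_right _ _)]

theorem cutCoord_zero {n : ℕ} (t : stdSimplex ℝ (Fin n)) (h : (0 : ℝ) ∈ Set.Ico (0 : ℝ) 1) :
    cutCoord t 0 h = t := by
  refine ext_of_partialSum fun k hk => ?_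
  rw [partialSum_cutCoord _ _ _ hk, sub_zero, sub_zero, div_one, max_eq_left]
  rw [← partialSum_zero t]
  exact partialSum_mono t (Nat.zero_le k)

/-- A vertex carries mass after the cut at `s` only if its piece extends beyond `s`. -/
theorem lt_partialSum_of_cutCoord_pos {n : ℕ} {t : stdSimplex ℝ (Fin n)} {s : ℝ}
    {hs : s ∈ Set.Ico (0 : ℝ) 1} {j : Fin n} (h : 0 < cutCoord t s hs j) :
    s < partialSum t (j + 1) := by
  by_contra hle
  have h1 : max (partialSum t (j + 1)) s = s := max_eq_right (not_lt.mp hle)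
  have h2 : cutCoord t s hs j =
    (max (partialSum t (j + 1)) s - max (partialSum t j) s) / (1 - s) := rfl
  rw [h2, h1] at h
  have : s - max (partialSum t j) s ≤ 0 := sub_nonpos.mpr (le_max_right _ _)
  exact absurd h (not_lt.mpr (div_nonpos_of_nonpos_of_nonneg this (sub_nonneg.mpr hs.2.le)))

end Steps

end

section

/-! ### Comparing an order complex with a space by means of bump functions -/

/-- A poset `P` of "strata" of a region in a vector space: each `i` has a point `vertex i` and a bump
function, and finite sets of strata whose bump functions are simultaneously positive somewhere
in the region have a stratum `meet`, which decreases when the set grows. -/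
structure Thickening (P E : Type) [PartialOrder P] [NormedAddCommGroup E] [NormedSpace ℝ E] where
  vertex : P → E
  bump : P → E → ℝ
  bump_continuous : ∀ i, Continuous (bump i)
  bump_nonneg : ∀ i z, 0 ≤ bump i z
  bump_le_one : ∀ i z, bump i z ≤ 1
  locallyFinite : LocallyFinite fun i => {z | 0 < bump i z}
  meet : Set P → P
  region : Set E
  cover : ∀ z ∈ region, ∃ i, 0 < bump i z
  meet_anti : ∀ z ∈ region, ∀ A A' : Set P, A.Nonempty → A ⊆ A' → (∀ i ∈ A', 0 < bump i z) →
    meet A' ≤ meet A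

namespace Thickening

variable {P E : Type} [PartialOrder P] [NormedAddCommGroup E] [NormedSpace ℝ E]
  (𝒯 : Thickening P E)

/-- The largest value of a bump function at a point. -/
def height (z : E) : ℝ := ⨆ i, 𝒯.bump i z

/-- The strata whose bump function exceeds the fraction `r` of the largest value. -/
def level (z : E) (r : ℝ) : Set P := {i | r * 𝒯.height z < 𝒯.bump i z}

theorem bump_le_height (i : P) (z : E) : 𝒯.bump i z ≤ 𝒯.height z :=
  le_ciSup (f := fun i => 𝒯.bump i z) ⟨1, by rintro _ ⟨i, rfl⟩; exact 𝒯.bump_le_one i z⟩ i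

theorem height_nonneg (z : E) : 0 ≤ 𝒯.height z := Real.iSup_nonneg fun i => 𝒯.bump_nonneg i z

theorem height_pos {z : E} (hz : z ∈ 𝒯.region) : 0 < 𝒯.height z := by
  obtain ⟨i, hi⟩ := 𝒯.cover z hz
  exact hi.trans_le (𝒯.bump_le_height i z)

theorem bump_pos_of_mem_level {z : E} {r : ℝ} (hr : 0 ≤ r) {i : P} (hi : i ∈ 𝒯.level z r) :
    0 < 𝒯.bump i z :=
  (mul_nonneg hr (𝒯.height_nonneg z)).trans_lt hi

theorem level_nonempty {z : E} (hz : z ∈ 𝒯.region) {r : ℝ} (hr : r < 1) :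
    (𝒯.level z r).Nonempty := by
  obtain ⟨i₀, -⟩ := 𝒯.cover z hz
  have : Nonempty P := ⟨i₀⟩
  have h1 : r * 𝒯.height z < 𝒯.height z := by
    have := 𝒯.height_pos hz
    nlinarith
  exact exists_lt_of_lt_ciSup h1

theorem level_anti (z : E) {r r' : ℝ} (h : r ≤ r') : 𝒯.level z r' ⊆ 𝒯.level z r := fun _ hi =>
  (mul_le_mul_of_nonneg_right h (𝒯.height_nonneg z)).trans_lt hi

theorem meet_level_mono {z : E} (hz : z ∈ 𝒯.region) {r r' : ℝ} (hr : 0 ≤ r) (h : r ≤ r')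
    (hr' : r' < 1) : 𝒯.meet (𝒯.level z r) ≤ 𝒯.meet (𝒯.level z r') :=
  𝒯.meet_anti z hz _ _ (𝒯.level_nonempty hz hr') (𝒯.level_anti z h)
    fun _ hi => 𝒯.bump_pos_of_mem_level hr hi

section Ratio

variable {X : Type} [TopologicalSpace X] [CompactSpace X] {γ : X → E} (hγ : Continuous γ)

include hγ in
theorem finite_active : {i | ∃ x, 0 < 𝒯.bump i (γ x)}.Finite := by
  refine (𝒯.locallyFinite.finite_nonempty_inter_compact (isCompact_range hγ)).subset ?_
  rintro i ⟨x, hx⟩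
  exact ⟨γ x, hx, x, rfl⟩

include hγ in
/-- Along a compact family of points only finitely many bump functions are active, so the height is a
finite maximum. -/
theorem continuous_ratio (hmem : ∀ x, γ x ∈ 𝒯.region) (i : P) :
    Continuous fun x => 𝒯.bump i (γ x) / 𝒯.height (γ x) := by
  refine ((𝒯.bump_continuous i).comp hγ).div ?_ fun x => (𝒯.height_pos (hmem x)).ne'
  rcases isEmpty_or_nonempty X with hX | ⟨⟨x₀⟩⟩
  · exact continuous_of_const fun x => (hX.false x).elim
  set I := (𝒯.finite_active hγ).toFinset with hI
  have hne : I.Nonempty := by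
    obtain ⟨i, hi⟩ := 𝒯.cover _ (hmem x₀)
    exact ⟨i, by rw [hI, Set.Finite.mem_toFinset]; exact ⟨x₀, hi⟩⟩
  have heq : (fun x => 𝒯.height (γ x)) = fun x => I.sup' hne fun i => 𝒯.bump i (γ x) := by
    funext x
    have : Nonempty P := ⟨hne.choose⟩
    refine le_antisymm (ciSup_le fun i => ?_)
      (Finset.sup'_le _ _ fun i _ => 𝒯.bump_le_height i (γ x))
    by_cases hi : i ∈ I
    · exact Finset.le_sup' (fun i => 𝒯.bump i (γ x)) hi
    · have h0 : 𝒯.bump i (γ x) ≤ 0 := by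
        by_contra hlt
        exact hi (by rw [hI, Set.Finite.mem_toFinset]; exact ⟨x, not_le.mp hlt⟩)
      exact h0.trans ((𝒯.bump_nonneg hne.choose (γ x)).trans
        (Finset.le_sup' (fun i => 𝒯.bump i (γ x)) hne.choose_spec))
  rw [heq]
  exact Continuous.finset_sup'_apply hne fun i _ => (𝒯.bump_continuous i).comp hγ

end Ratio

/-- The affine extension of the points `vertex i` to the simplex of a chain. -/
def bary {n : ℕ} (σ : Fin (n + 1) →o P) (t : stdSimplex ℝ (Fin (n + 1))) : E :=
  ∑ j, t j • 𝒯.vertex (σ j)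

theorem continuous_bary {n : ℕ} (σ : Fin (n + 1) →o P) : Continuous (𝒯.bary σ) :=
  continuous_finsetSum _ fun i _ =>
    ((continuous_apply i).comp continuous_subtype_val).smul continuous_const

theorem bary_map {m n : ℕ} (θ : Fin (m + 1) →o Fin (n + 1)) (σ : Fin (n + 1) →o P)
    (t : stdSimplex ℝ (Fin (m + 1))) :
    𝒯.bary σ (stdSimplex.map θ t) = 𝒯.bary (σ.comp θ) t := by
  classical
  unfold bary
  simp only [stdSimplex_map_apply, Finset.sum_smul]
  rw [Finset.sum_comm' (t' := Finset.univ) (s' := fun j => {θ j})]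
  · simp
  · intro i j
    simp [eq_comm]

/-- The step function of strata seen at a point of the region. -/
def strataFun (z : E) (r : ℝ) : P := 𝒯.meet (𝒯.level z r)

/-- Strata seen along a continuous family of points of the region. -/
theorem continuous_strata {X : Type} [TopologicalSpace X] [CompactSpace X] {γ : X → E}
    (hγ : Continuous γ) (hmem : ∀ x, γ x ∈ 𝒯.region) :
    (Continuous fun x => stepPoint (𝒯.strataFun (γ x))) ∧
      ∀ x, ∃ (n : ℕ) (σ : Fin (n + 1) →o P) (t : stdSimplex ℝ (Fin (n + 1))),
        Presents (𝒯.strataFun (γ x)) σ t := by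
  have : Fintype {i | ∃ x, 0 < 𝒯.bump i (γ x)} := (𝒯.finite_active hγ).fintype
  refine continuous_stepPoint (ι := {i | ∃ x, 0 < 𝒯.bump i (γ x)})
    (fun i x => 𝒯.bump i (γ x) / 𝒯.height (γ x)) (fun i => 𝒯.continuous_ratio hγ hmem i)
    (fun i x => div_nonneg (𝒯.bump_nonneg _ _) (𝒯.height_nonneg _))
    (fun i x => div_le_one_of_le₀ (𝒯.bump_le_height _ _) (𝒯.height_nonneg _))
    (fun J => 𝒯.meet (Subtype.val '' J)) _ ?_ ?_
  · intro x r hr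
    unfold strataFun
    congr 1
    ext i
    have hpos := 𝒯.height_pos (hmem x)
    simp only [Set.mem_image, Set.mem_ofPred_eq, Subtype.exists, exists_and_right,
      exists_eq_right, lt_div_iff₀ hpos]
    exact ⟨fun h => ⟨⟨x, 𝒯.bump_pos_of_mem_level hr.1 h⟩, h⟩, fun ⟨_, h⟩ => h⟩
  · intro x r hr r' hr' h
    exact 𝒯.meet_level_mono (hmem x) hr.1 h hr'.2

/-- A translation of the vector space together with a monotone self-map of the poset of strata, such
that near a translated simplex of a chain only strata above the image of the chain are
visible. -/
structure Motion where
  shift : E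
  toHom : P →o P
  mem_region : ∀ {n : ℕ} (σ : Fin (n + 1) →o P) (t : stdSimplex ℝ (Fin (n + 1))),
    𝒯.bary σ t + shift ∈ 𝒯.region
  le_meet : ∀ {n : ℕ} (σ : Fin (n + 1) →o P) (t : stdSimplex ℝ (Fin (n + 1))) (i₀ : Fin (n + 1)),
    0 < t i₀ → (∀ j, 0 < t j → i₀ ≤ j) → ∀ A : Set P, A.Nonempty →
    (∀ i ∈ A, 0 < 𝒯.bump i (𝒯.bary σ t + shift)) → toHom (σ i₀) ≤ 𝒯.meet A

variable {𝒯}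

/-- The homotopy from the strata seen at the translate of a simplex to the image of the simplex:
the step function of the simplex is cut at `s`, and the part beyond `s` is replaced by the
strata seen at the translate of the corresponding point. -/
def Motion.homotopyFun (w : 𝒯.Motion) {n : ℕ} (σ : Fin (n + 1) →o P)
    (t : stdSimplex ℝ (Fin (n + 1))) (s r : ℝ) : P := by
  classical
  exact if r < s then w.toHom (stepFun σ t r) else
    if hs : s ∈ Set.Ico (0 : ℝ) 1 then
      𝒯.strataFun (𝒯.bary σ (cutCoord t s hs) + w.shift) ((r - s) / (1 - s))
    else w.toHom (σ 0)

theorem exists_min_pos {n : ℕ} (t : stdSimplex ℝ (Fin (n + 1))) :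
    ∃ i₀, 0 < t i₀ ∧ ∀ j, 0 < t j → i₀ ≤ j := by
  classical
  obtain ⟨m, θ, t', rfl, h⟩ := exists_positive_face t
  have hne : (Finset.univ.filter fun j => 0 < stdSimplex.map θ t' j).Nonempty := by
    refine ⟨θ 0, Finset.mem_filter.mpr ⟨Finset.mem_univ _, ?_⟩⟩
    rw [stdSimplex_map_apply]
    exact Finset.sum_pos (fun i _ => h i) ⟨0, by simp⟩
  refine ⟨_, (Finset.mem_filter.mp (Finset.min'_mem _ hne)).2, fun j hj => ?_⟩
  exact Finset.min'_le _ _ (Finset.mem_filter.mpr ⟨Finset.mem_univ j, hj⟩)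

/-- At the time `s` the values before `s` lie below the values beyond `s`: the mass beyond `s` lies on a
face of the simplex whose least stratum bounds the former from above, and by `le_meet` the image
of that stratum lies below all strata seen from the translate of the face. -/
theorem Motion.homotopyFun_mono (w : 𝒯.Motion) {n : ℕ} (σ : Fin (n + 1) →o P)
    (t : stdSimplex ℝ (Fin (n + 1))) {s : ℝ} (hs0 : 0 ≤ s) :
    MonotoneOn (w.homotopyFun σ t s) (Set.Ico 0 1) := by
  intro r hr r' hr' h
  unfold Motion.homotopyFun
  by_cases h' : r' < s
  · rw [if_pos h', if_pos (h.trans_lt h')]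
    obtain ⟨j, hj⟩ := exists_piece t hr
    obtain ⟨j', hj'⟩ := exists_piece t hr'
    rw [stepFun_eq σ hj, stepFun_eq σ hj']
    exact w.toHom.monotone (σ.monotone (piece_le hj hj' h))
  · have hs : s ∈ Set.Ico (0 : ℝ) 1 := ⟨hs0, (not_lt.mp h').trans_lt hr'.2⟩
    have hs1 : 0 < 1 - s := sub_pos.mpr hs.2
    rw [if_neg h', dif_pos hs]
    have hlt : (r' - s) / (1 - s) < 1 := (div_lt_one hs1).mpr (by linarith [hr'.2])
    have hnn : 0 ≤ (r' - s) / (1 - s) := div_nonneg (sub_nonneg.mpr (not_lt.mp h')) hs1.le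
    split_ifs with h1
    · obtain ⟨j, hj⟩ := exists_piece t hr
      rw [stepFun_eq σ hj]
      obtain ⟨i₀, hi₀, hmin⟩ := exists_min_pos (cutCoord t s hs)
      refine le_trans (w.toHom.monotone (σ.monotone ?_))
        (w.le_meet σ (cutCoord t s hs) i₀ hi₀ hmin _
          (𝒯.level_nonempty (w.mem_region _ _) hlt)
          fun i hi => 𝒯.bump_pos_of_mem_level hnn hi)
      have := lt_partialSum_of_cutCoord_pos hi₀
      by_contra hcon
      have h2 : i₀.val + 1 ≤ j.val := not_le.mp hcon
      have := partialSum_mono t h2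
      have := hj.1
      linarith
    · refine 𝒯.meet_level_mono (w.mem_region _ _) (div_nonneg (by linarith) hs1.le) ?_ hlt
      gcongr

/-- The step functions of the homotopy satisfy the hypotheses of `continuous_stepPoint`, the
thresholds being the cut `s`, the partial sums of `t`, and rescaled values of the active bump
functions. -/
theorem Motion.continuous_homotopy (w : 𝒯.Motion) {n : ℕ} (σ : Fin (n + 1) →o P) :
    (Continuous fun x : stdSimplex ℝ (Fin (n + 1)) × unitInterval =>
        stepPoint (w.homotopyFun σ x.1 x.2)) ∧
      ∀ x : stdSimplex ℝ (Fin (n + 1)) × unitInterval,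
        ∃ (m : ℕ) (ρ : Fin (m + 1) →o P) (t : stdSimplex ℝ (Fin (m + 1))),
          Presents (w.homotopyFun σ x.1 x.2) ρ t := by
  classical
  have hγ : Continuous fun t => 𝒯.bary σ t + w.shift := (𝒯.continuous_bary σ).add continuous_const
  let I := {i | ∃ t, 0 < 𝒯.bump i (𝒯.bary σ t + w.shift)}
  have : Fintype I := (𝒯.finite_active hγ).fintype
  let ρ : P → stdSimplex ℝ (Fin (n + 1)) → ℝ := fun i t =>
    𝒯.bump i (𝒯.bary σ t + w.shift) / 𝒯.height (𝒯.bary σ t + w.shift)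
  have hρ : ∀ i, Continuous (ρ i) := 𝒯.continuous_ratio hγ fun t => w.mem_region σ t
  have hρ0 : ∀ i t, 0 ≤ ρ i t := fun i t => div_nonneg (𝒯.bump_nonneg _ _) (𝒯.height_nonneg _)
  have hρ1 : ∀ i t, ρ i t ≤ 1 := fun i t =>
    div_le_one_of_le₀ (𝒯.bump_le_height _ _) (𝒯.height_nonneg _)
  let X := stdSimplex ℝ (Fin (n + 1)) × unitInterval
  -- `cutCoord` has no limit as `s` tends to `1`, but the thresholds tend to `1` there
  let c : I → X → ℝ := fun i x => if hs : (x.2 : ℝ) ∈ Set.Ico (0 : ℝ) 1 then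
    x.2 + (1 - x.2) * ρ i (cutCoord x.1 x.2 hs) else 1
  have hcl : ∀ i x, (x.2 : ℝ) ≤ c i x := by
    intro i x
    simp only [c]
    split_ifs with hs
    · have := mul_nonneg (sub_nonneg.mpr hs.2.le) (hρ0 i (cutCoord x.1 x.2 hs))
      linarith
    · exact x.2.2.2
  have hcu : ∀ i x, c i x ≤ 1 := by
    intro i x
    simp only [c]
    split_ifs with hs
    · have := mul_le_mul_of_nonneg_left (hρ1 i (cutCoord x.1 x.2 hs)) (sub_nonneg.mpr hs.2.le)
      linarith
    · exact le_rfl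
  have hsc : Continuous fun x : X => (x.2 : ℝ) := continuous_subtype_val.comp continuous_snd
  have hcc : ∀ i, Continuous (c i) := by
    intro i
    rw [continuous_iff_continuousAt]
    intro x
    rcases lt_or_eq_of_le x.2.2.2 with hx | hx
    · have hopen : IsOpen {x : X | (x.2 : ℝ) < 1} := isOpen_lt hsc continuous_const
      refine ContinuousOn.continuousAt (s := {x : X | (x.2 : ℝ) < 1}) ?_ (hopen.mem_nhds hx)
      rw [continuousOn_iff_continuous_domRestrict]
      let g : {x : X | (x.2 : ℝ) < 1} → stdSimplex ℝ (Fin (n + 1)) := fun x =>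
        cutCoord x.1.1 x.1.2 ⟨x.1.2.2.1, x.2⟩
      have hg : Continuous g := by
        refine Continuous.subtype_mk (continuous_pi fun j => ?_) _
        have h1 : Continuous fun x : {x : X | (x.2 : ℝ) < 1} => (x.1.2 : ℝ) :=
          hsc.comp continuous_subtype_val
        have h2 : ∀ k, Continuous fun x : {x : X | (x.2 : ℝ) < 1} => partialSum x.1.1 k :=
          fun k => (continuous_partialSum k).comp (continuous_fst.comp continuous_subtype_val)
        exact (((h2 _).max h1).sub ((h2 _).max h1)).div (continuous_const.sub h1)
          fun x => (sub_pos.mpr x.2).ne'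
      have heq : Set.domRestrict {x : X | (x.2 : ℝ) < 1} (c i) =
          fun x => (x.1.2 : ℝ) + (1 - x.1.2) * ρ i (g x) := by
        funext x
        exact dif_pos ⟨x.1.2.2.1, x.2⟩
      rw [heq]
      have h1 : Continuous fun x : {x : X | (x.2 : ℝ) < 1} => (x.1.2 : ℝ) :=
        hsc.comp continuous_subtype_val
      exact h1.add ((continuous_const.sub h1).mul ((hρ i).comp hg))
    · have hval : c i x = 1 := dif_neg fun h => h.2.ne hx
      unfold ContinuousAt
      rw [hval]
      refine tendsto_of_tendsto_of_tendsto_of_le_of_le (g := fun x : X => (x.2 : ℝ))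
        (h := fun _ => 1) ?_ tendsto_const_nhds (hcl i) (hcu i)
      have := hsc.tendsto x
      rwa [hx] at this
  -- the value determined by the set `J` of the thresholds above `r`: `none` stands for the cut, and
  -- before the cut the first partial sum above `r` gives the vertex of the simplex
  let m : Set (Option (Fin (n + 1) ⊕ I)) → P := fun J =>
    if none ∈ J then
      (if h : ∃ j, some (Sum.inl j) ∈ J ∧ ∀ j' < j, some (Sum.inl j') ∉ J then
        w.toHom (σ h.choose) else w.toHom (σ 0))
    else if ∃ i, some (Sum.inr i) ∈ J then
      𝒯.meet {i | ∃ h : i ∈ I, some (Sum.inr ⟨i, h⟩) ∈ J} else w.toHom (σ 0)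
  have hm1 : ∀ J : Set (Option (Fin (n + 1) ⊕ I)), none ∈ J → ∀ j, some (Sum.inl j) ∈ J →
      (∀ j' < j, some (Sum.inl j') ∉ J) → m J = w.toHom (σ j) := by
    intro J hJ j hj hlt
    have hex : ∃ j, some (Sum.inl j) ∈ J ∧ ∀ j' < j, some (Sum.inl j') ∉ J := ⟨j, hj, hlt⟩
    have : hex.choose = j := by
      rcases lt_trichotomy hex.choose j with h | h | h
      · exact absurd hex.choose_spec.1 (hlt _ h)
      · exact h
      · exact absurd hj (hex.choose_spec.2 j h)
    simp only [m]
    rw [if_pos hJ, dif_pos hex, this]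
  have hm2 : ∀ J : Set (Option (Fin (n + 1) ⊕ I)), none ∉ J → (∃ i, some (Sum.inr i) ∈ J) →
      m J = 𝒯.meet {i | ∃ h : i ∈ I, some (Sum.inr ⟨i, h⟩) ∈ J} := by
    intro J hJ hex
    simp only [m]
    rw [if_neg hJ, if_pos hex]
  refine continuous_stepPoint (ι := Option (Fin (n + 1) ⊕ I))
    (fun o x => o.elim (x.2 : ℝ) (Sum.elim (fun j => partialSum x.1 (j + 1)) fun i => c i x))
    ?_ ?_ ?_ m _ ?_ ?_
  · rintro (_ | _ | i)
    · exact hsc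
    · exact (continuous_partialSum _).comp continuous_fst
    · exact hcc i
  · rintro (_ | j | i) x
    · exact x.2.2.1
    · change 0 ≤ partialSum x.1 (j + 1)
      rw [← partialSum_zero x.1]
      exact partialSum_mono _ (Nat.zero_le _)
    · exact x.2.2.1.trans (hcl i x)
  · rintro (_ | j | i) x
    · exact x.2.2.2
    · change partialSum x.1 (j + 1) ≤ 1
      rw [← partialSum_last x.1]
      exact partialSum_mono _ j.isLt
    · exact hcu i x
  · rintro ⟨t, s⟩ r hr
    by_cases hrs : r < s
    · obtain ⟨j, hj⟩ := exists_piece t hr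
      refine Eq.trans ?_ (hm1 _ hrs j hj.2 fun j' hj' => (not_lt.mpr
        ((partialSum_mono t (Fin.lt_def.mp hj')).trans hj.1) : ¬ r < partialSum t (j' + 1))).symm
      unfold Motion.homotopyFun
      rw [if_pos hrs, stepFun_eq σ hj]
    · have hs : (s : ℝ) ∈ Set.Ico (0 : ℝ) 1 := ⟨s.2.1, (not_lt.mp hrs).trans_lt hr.2⟩
      have hs1 : 0 < 1 - (s : ℝ) := sub_pos.mpr hs.2
      have hz := w.mem_region σ (cutCoord t s hs)
      have hpos := 𝒯.height_pos hz
      have hmem : ∀ i : I, r < c i (t, s) ↔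
          i.1 ∈ 𝒯.level (𝒯.bary σ (cutCoord t s hs) + w.shift) ((r - s) / (1 - s)) := by
        intro i
        have : c i (t, s) = s + (1 - s) * ρ i (cutCoord t s hs) := dif_pos hs
        rw [this]
        change _ ↔ (r - s) / (1 - s) * 𝒯.height _ < _
        rw [← lt_div_iff₀ hpos, div_lt_iff₀ hs1, sub_lt_iff_lt_add', mul_comm]
      have hnn : 0 ≤ (r - s) / (1 - (s : ℝ)) := div_nonneg (sub_nonneg.mpr (not_lt.mp hrs)) hs1.le
      have hI : ∀ i, i ∈ 𝒯.level (𝒯.bary σ (cutCoord t s hs) + w.shift) ((r - s) / (1 - s)) →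
          i ∈ I := fun i hi => ⟨_, 𝒯.bump_pos_of_mem_level hnn hi⟩
      obtain ⟨i, hi⟩ := 𝒯.level_nonempty hz (r := (r - s) / (1 - s))
        ((div_lt_one hs1).mpr (by linarith [hr.2]))
      refine Eq.trans ?_ (hm2 _ hrs ⟨⟨i, hI i hi⟩, (hmem _).mpr hi⟩).symm
      unfold Motion.homotopyFun
      rw [if_neg hrs, dif_pos hs]
      unfold strataFun
      congr 1
      ext i
      constructor
      · exact fun hi => ⟨hI i hi, (hmem ⟨i, hI i hi⟩).mpr hi⟩
      · rintro ⟨h, hi⟩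
        exact (hmem ⟨i, h⟩).mp hi
  · rintro ⟨t, s⟩
    exact w.homotopyFun_mono σ t s.2.1

theorem Motion.homotopyFun_one (w : 𝒯.Motion) {n : ℕ} (σ : Fin (n + 1) →o P)
    (t : stdSimplex ℝ (Fin (n + 1))) {r : ℝ} (hr : r ∈ Set.Ico (0 : ℝ) 1) :
    w.homotopyFun σ t 1 r = w.toHom (stepFun σ t r) := if_pos hr.2

theorem Motion.homotopyFun_zero (w : 𝒯.Motion) {n : ℕ} (σ : Fin (n + 1) →o P)
    (t : stdSimplex ℝ (Fin (n + 1))) {r : ℝ} (hr : r ∈ Set.Ico (0 : ℝ) 1) :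
    w.homotopyFun σ t 0 r = 𝒯.strataFun (𝒯.bary σ t + w.shift) r := by
  unfold Motion.homotopyFun
  have h0 : (0 : ℝ) ∈ Set.Ico (0 : ℝ) 1 := ⟨le_rfl, one_pos⟩
  rw [if_neg (not_lt.mpr hr.1), dif_pos h0, cutCoord_zero, sub_zero, sub_zero,
    div_one]

theorem Motion.homotopyFun_map (w : 𝒯.Motion) {m n : ℕ} (θ : Fin (m + 1) →o Fin (n + 1))
    (σ : Fin (n + 1) →o P) (t : stdSimplex ℝ (Fin (m + 1))) {s r : ℝ}
    (hs : s ∈ Set.Icc (0 : ℝ) 1) (hr : r ∈ Set.Ico (0 : ℝ) 1) :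
    w.homotopyFun σ (stdSimplex.map θ t) s r = w.homotopyFun (σ.comp θ) t s r := by
  unfold Motion.homotopyFun
  by_cases hrs : r < s
  · rw [if_pos hrs, if_pos hrs, stepFun_map θ σ t hr]
  · have hs' : s ∈ Set.Ico (0 : ℝ) 1 := ⟨hs.1, (not_lt.mp hrs).trans_lt hr.2⟩
    rw [if_neg hrs, if_neg hrs, dif_pos hs', dif_pos hs', cutCoord_map, 𝒯.bary_map]

variable (𝒯) in
/-- A translation of the vector space and a compatible automorphism of the poset of strata. -/
structure Symmetry where
  shift : E
  toIso : P ≃o P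
  vertex_eq : ∀ i, 𝒯.vertex (toIso i) = 𝒯.vertex i + shift
  bump_eq : ∀ i z, 𝒯.bump (toIso i) (z + shift) = 𝒯.bump i z
  meet_eq : ∀ z ∈ 𝒯.region, ∀ A : Set P, A.Nonempty → (∀ i ∈ A, 0 < 𝒯.bump i z) →
    𝒯.meet (toIso '' A) = toIso (𝒯.meet A)

theorem Symmetry.bary_eq (k : 𝒯.Symmetry) {n : ℕ} (σ : Fin (n + 1) →o P)
    (t : stdSimplex ℝ (Fin (n + 1))) :
    𝒯.bary ((k.toIso : P →o P).comp σ) t = 𝒯.bary σ t + k.shift := by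
  unfold bary
  change ∑ j, t j • 𝒯.vertex (k.toIso (σ j)) = _
  simp only [k.vertex_eq, smul_add]
  rw [Finset.sum_add_distrib, ← Finset.sum_smul, stdSimplex.sum_eq_one, one_smul]

theorem Symmetry.level_eq (k : 𝒯.Symmetry) (z : E) (r : ℝ) :
    𝒯.level (z + k.shift) r = k.toIso '' 𝒯.level z r := by
  have hh : 𝒯.height (z + k.shift) = 𝒯.height z := by
    unfold height
    rw [← k.toIso.toEquiv.iSup_comp]
    exact iSup_congr fun i => k.bump_eq i z
  ext i
  obtain ⟨i, rfl⟩ := k.toIso.surjective i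
  rw [k.toIso.injective.mem_set_image]
  change r * _ < _ ↔ r * _ < _
  rw [hh, k.bump_eq]

theorem Symmetry.strataFun_eq (k : 𝒯.Symmetry) {z : E} (hz : z ∈ 𝒯.region) {r : ℝ}
    (hr : r ∈ Set.Ico (0 : ℝ) 1) : 𝒯.strataFun (z + k.shift) r = k.toIso (𝒯.strataFun z r) := by
  unfold strataFun
  rw [k.level_eq, k.meet_eq z hz _ (𝒯.level_nonempty hz hr.2)
    fun i hi => 𝒯.bump_pos_of_mem_level hr.1 hi]

theorem Motion.homotopyFun_symmetry (w : 𝒯.Motion) (k : 𝒯.Symmetry)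
    (hcomm : ∀ i, w.toHom (k.toIso i) = k.toIso (w.toHom i)) {n : ℕ} (σ : Fin (n + 1) →o P)
    (t : stdSimplex ℝ (Fin (n + 1))) {s r : ℝ} (hs : s ∈ Set.Icc (0 : ℝ) 1)
    (hr : r ∈ Set.Ico (0 : ℝ) 1) :
    w.homotopyFun ((k.toIso : P →o P).comp σ) t s r = k.toIso (w.homotopyFun σ t s r) := by
  unfold Motion.homotopyFun
  by_cases hrs : r < s
  · rw [if_pos hrs, if_pos hrs, stepFun_comp]
    exact hcomm _
  · have hs' : s ∈ Set.Ico (0 : ℝ) 1 := ⟨hs.1, (not_lt.mp hrs).trans_lt hr.2⟩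
    have hs1 : 0 < 1 - s := sub_pos.mpr hs'.2
    rw [if_neg hrs, if_neg hrs, dif_pos hs', dif_pos hs', k.bary_eq, add_right_comm]
    exact k.strataFun_eq (w.mem_region _ _) ⟨div_nonneg (sub_nonneg.mpr (not_lt.mp hrs)) hs1.le,
      (div_lt_one hs1).mpr (by linarith [hr.2])⟩

end Thickening

end

section

/-! ### Homotopies on a quotient of the poset of strata -/

namespace Thickening

variable {P E C : Type} [PartialOrder P] [NormedAddCommGroup E] [NormedSpace ℝ E]
  [Category.{0} C] {𝒯 : Thickening P E}

variable (𝒯 C) in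
/-- A category `C` that is the quotient of the poset of strata by a group of symmetries: each
simplex of the nerve of `C` lifts to a chain, and the lifts of faces differ by symmetries. -/
structure Covering where
  proj : P ⥤ C
  lift : ∀ {n : ℕ}, ComposableArrows C n → (Fin (n + 1) →o P)
  lift_proj : ∀ {n : ℕ} (s : ComposableArrows C n), (lift s).monotone.functor ⋙ proj = s
  deck : 𝒯.Symmetry → Prop
  deck_proj : ∀ k, deck k → k.toIso.monotone.functor ⋙ proj = proj
  lift_reindex : ∀ {m n : ℕ} (θ : Fin (m + 1) →o Fin (n + 1)) (s : ComposableArrows C n),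
    ∃ k, deck k ∧ (lift s).comp θ = (k.toIso : P →o P).comp (lift (reindex θ s))

/-- A natural, equivariant and continuous family of step functions attached to the points of chains. -/
structure StepHomotopy (cov : Covering C 𝒯) where
  fn : ∀ {n : ℕ}, (Fin (n + 1) →o P) → stdSimplex ℝ (Fin (n + 1)) → unitInterval → ℝ → P
  continuous : ∀ {n : ℕ} (σ : Fin (n + 1) →o P),
    Continuous fun x : stdSimplex ℝ (Fin (n + 1)) × unitInterval => stepPoint (fn σ x.1 x.2)
  presents : ∀ {n : ℕ} (σ : Fin (n + 1) →o P) t s, ∃ (m : ℕ) (ρ : Fin (m + 1) →o P)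
    (u : stdSimplex ℝ (Fin (m + 1))), Presents (fn σ t s) ρ u
  map_eq : ∀ {m n : ℕ} (θ : Fin (m + 1) →o Fin (n + 1)) (σ : Fin (n + 1) →o P)
    (t : stdSimplex ℝ (Fin (m + 1))) s, ∀ r ∈ Set.Ico (0 : ℝ) 1,
    fn σ (stdSimplex.map θ t) s r = fn (σ.comp θ) t s r
  deck_eq : ∀ k, cov.deck k → ∀ {n : ℕ} (σ : Fin (n + 1) →o P) t s, ∀ r ∈ Set.Ico (0 : ℝ) 1,
    fn ((k.toIso : P →o P).comp σ) t s r = k.toIso (fn σ t s r)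

/-- The homotopy on the realization of the quotient defined by a family of step functions. -/
def StepHomotopy.simplexHomotopy {cov : Covering C 𝒯} (h : StepHomotopy cov) :
    SimplexHomotopy C (Realization C) where
  map s t r := realize cov.proj (stepPoint (h.fn (cov.lift s) t r))
  continuous s := (realize cov.proj).hom.continuous.comp (h.continuous (cov.lift s))
  natural θ s t r := by
    obtain ⟨k, hk, hlift⟩ := cov.lift_reindex θ s
    rw [stepPoint_congr (h.map_eq θ (cov.lift s) t r), hlift,
      stepPoint_congr (h.deck_eq k hk (cov.lift (reindex θ s)) t r)]
    obtain ⟨m, ρ, u, hp⟩ := h.presents (cov.lift (reindex θ s)) t r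
    rw [hp.realize_stepPoint]
    refine ((hp.comp (k.toIso : P →o P)).realize_stepPoint cov.proj).trans ?_
    have : ((k.toIso : P →o P).comp ρ).monotone.functor ⋙ cov.proj =
        ρ.monotone.functor ⋙ (k.toIso.monotone.functor ⋙ cov.proj) := rfl
    rw [this, cov.deck_proj k hk]

theorem Covering.realize_stepPoint_stepFun (cov : Covering C 𝒯) (T : P →o P) (ν : C ⥤ C)
    (hT : T.monotone.functor ⋙ cov.proj = cov.proj ⋙ ν) {n : ℕ} (s : ComposableArrows C n)
    (t : stdSimplex ℝ (Fin (n + 1))) :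
    realize cov.proj (stepPoint fun r => T (stepFun (cov.lift s) t r)) =
      realize ν (simplexIncl s t) := by
  refine (((presents_stepFun (cov.lift s) t).comp T).realize_stepPoint cov.proj).trans ?_
  rw [realize_simplexIncl]
  have : (T.comp (cov.lift s)).monotone.functor ⋙ cov.proj =
      (cov.lift s).monotone.functor ⋙ (T.monotone.functor ⋙ cov.proj) := rfl
  rw [this, hT, ← Functor.assoc, cov.lift_proj]

/-- The step homotopy of a motion that commutes with the symmetries. -/
def Motion.stepHomotopy (w : 𝒯.Motion) (cov : Covering C 𝒯)
    (hcomm : ∀ k, cov.deck k → ∀ i, w.toHom (k.toIso i) = k.toIso (w.toHom i)) :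
    StepHomotopy cov where
  fn σ t s := w.homotopyFun σ t s
  continuous σ := (w.continuous_homotopy σ).1
  presents σ t s := (w.continuous_homotopy σ).2 (t, s)
  map_eq θ σ t s _ hr := w.homotopyFun_map θ σ t s.2 hr
  deck_eq k hk _ σ t s _ hr := w.homotopyFun_symmetry k (hcomm k hk) σ t s.2 hr

/-- The step homotopy of strata seen along a translation. -/
def slideHomotopy (cov : Covering C 𝒯) (v : E)
    (hmem : ∀ {n : ℕ} (σ : Fin (n + 1) →o P) t, ∀ s : unitInterval,
      𝒯.bary σ t + (s : ℝ) • v ∈ 𝒯.region) : StepHomotopy cov where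
  fn σ t s := 𝒯.strataFun (𝒯.bary σ t + (s : ℝ) • v)
  continuous {n} σ := (𝒯.continuous_strata (X := stdSimplex ℝ (Fin (n + 1)) × unitInterval)
    (γ := fun x => 𝒯.bary σ x.1 + (x.2 : ℝ) • v)
    (((𝒯.continuous_bary σ).comp continuous_fst).add
      ((continuous_subtype_val.comp continuous_snd).smul continuous_const))
    fun x => hmem σ x.1 x.2).1
  presents {n} σ t s := (𝒯.continuous_strata (X := stdSimplex ℝ (Fin (n + 1)) × unitInterval)
    (γ := fun x => 𝒯.bary σ x.1 + (x.2 : ℝ) • v)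
    (((𝒯.continuous_bary σ).comp continuous_fst).add
      ((continuous_subtype_val.comp continuous_snd).smul continuous_const))
    fun x => hmem σ x.1 x.2).2 (t, s)
  map_eq θ σ t s r _ := by rw [𝒯.bary_map]
  deck_eq k _ n σ t s r hr := by
    rw [k.bary_eq, add_right_comm]
    exact k.strataFun_eq (hmem σ t s) hr

/-- If translations by all `s • v` keep the simplices of chains inside the region, then the
self-map of the quotient covered by the translation by `v` is homotopic to the identity. -/
theorem Covering.homotopic_id (cov : Covering C 𝒯) (w₀ w₁ : 𝒯.Motion) (h₀ : w₀.shift = 0)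
    (h₀' : w₀.toHom = OrderHom.id)
    (hcomm : ∀ k, cov.deck k → ∀ i, w₁.toHom (k.toIso i) = k.toIso (w₁.toHom i))
    (hmem : ∀ {n : ℕ} (σ : Fin (n + 1) →o P) t, ∀ s : unitInterval,
      𝒯.bary σ t + (s : ℝ) • w₁.shift ∈ 𝒯.region)
    (ν : C ⥤ C) (hν : w₁.toHom.monotone.functor ⋙ cov.proj = cov.proj ⋙ ν) :
    ContinuousMap.Homotopic (realize ν).hom (ContinuousMap.id (Realization C)) := by
  let H₀ := (w₀.stepHomotopy cov fun k _ i => by rw [h₀']; rfl).simplexHomotopy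
  let H₁ := (w₁.stepHomotopy cov hcomm).simplexHomotopy
  let K := (slideHomotopy cov w₁.shift hmem).simplexHomotopy
  let D : unitInterval → C(Realization C, Realization C) := fun r => (K.at r).desc
  have hD : ∀ r {n : ℕ} (s : ComposableArrows C n) t, D r (simplexIncl s t) = K.map s t r :=
    fun r {n} s t => (K.at r).desc_simplexIncl s t
  have e1 : ContinuousMap.Homotopic (D 0) (ContinuousMap.id (Realization C)) := by
    refine H₀.homotopic (fun s t => ?_) fun s t => ?_
    · rw [hD]
      refine congrArg (realize cov.proj) (stepPoint_congr fun r hr => ?_)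
      refine Eq.trans ?_ (w₀.homotopyFun_zero _ _ hr).symm
      rw [h₀]
      change 𝒯.strataFun (_ + (0 : ℝ) • w₁.shift) r = _
      rw [zero_smul]
    · have h1 : OrderHom.id.monotone.functor ⋙ cov.proj = cov.proj ⋙ 𝟭 C := rfl
      have h2 := cov.realize_stepPoint_stepFun OrderHom.id (𝟭 C) h1 s t
      rw [realize_simplexIncl] at h2
      refine h2.symm.trans (congrArg (realize cov.proj) (stepPoint_congr fun r hr => ?_))
      refine Eq.trans ?_ (w₀.homotopyFun_one _ _ hr).symm
      rw [h₀']
  have e2 : ContinuousMap.Homotopic (D 0) (D 1) :=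
    K.homotopic (fun s t => hD 0 s t) fun s t => hD 1 s t
  have e3 : ContinuousMap.Homotopic (D 1) (realize ν).hom := by
    refine H₁.homotopic (fun s t => ?_) fun s t => ?_
    · rw [hD]
      refine congrArg (realize cov.proj) (stepPoint_congr fun r hr => ?_)
      refine Eq.trans ?_ (w₁.homotopyFun_zero _ _ hr).symm
      change 𝒯.strataFun (_ + (1 : ℝ) • w₁.shift) r = _
      rw [one_smul]
    · refine (cov.realize_stepPoint_stepFun w₁.toHom ν hν s t).symm.trans
        (congrArg (realize cov.proj) (stepPoint_congr fun r hr => ?_))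
      exact (w₁.homotopyFun_one _ _ hr).symm
  exact (e3.symm.trans e2.symm).trans e1

end Thickening

end

section

variable {d : ℕ}

/-! ### The covering map and the lifted hyperplanes -/

theorem toTorus_add (z w : Vec d × Vec d) : toTorus (z + w) = toTorus z * toTorus w := by
  funext j
  apply Units.ext
  change Complex.exp _ = Complex.exp _ * Complex.exp _
  rw [← Complex.exp_add]
  congr 1
  simp only [Prod.fst_add, Prod.snd_add, Pi.add_apply]
  push_cast
  ring

theorem toTorus_zero : toTorus (0 : Vec d × Vec d) = 1 := by
  funext j
  apply Units.ext
  change Complex.exp _ = 1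
  simp

theorem toTorus_neg (z : Vec d × Vec d) : toTorus (-z) = (toTorus z)⁻¹ := by
  rw [eq_inv_iff_mul_eq_one, ← toTorus_add, neg_add_cancel, toTorus_zero]

theorem toTorus_surjective (t : Torus d) : ∃ z, toTorus z = t := by
  have h : ∀ j, ∃ ζ : ℂ, Complex.exp (2 * Real.pi * Complex.I * ζ) = t j := fun j => by
    refine ⟨Complex.log (t j) / (2 * Real.pi * Complex.I), ?_⟩
    rw [mul_div_cancel₀ _ Complex.two_pi_I_ne_zero, Complex.exp_log (t j).ne_zero]
  choose ζ hζ using h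
  refine ⟨(fun j => (ζ j).re, fun j => (ζ j).im), ?_⟩
  funext j
  apply Units.ext
  change Complex.exp (2 * Real.pi * Complex.I * (((ζ j).re : ℂ) + ((ζ j).im : ℂ) * Complex.I)) = _
  rw [Complex.re_add_im, hζ]

/-- The kernel of the covering map is `ℤ^d`. -/
theorem toTorus_eq_one {z : Vec d × Vec d} (h : toTorus z = 1) : ∃ k, z = (intVec k, 0) := by
  have hj : ∀ j, ∃ n : ℤ, z.1 j = n ∧ z.2 j = 0 := fun j => by
    have h1 := congrArg Units.val (congrFun h j)
    change Complex.exp _ = 1 at h1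
    obtain ⟨n, hn⟩ := Complex.exp_eq_one_iff.mp h1
    rw [mul_comm (n : ℂ)] at hn
    have h2 := mul_left_cancel₀ Complex.two_pi_I_ne_zero hn
    exact ⟨n, by simpa using congrArg Complex.re h2, by simpa using congrArg Complex.im h2⟩
  choose k hk using hj
  exact ⟨k, Prod.ext (funext fun j => (hk j).1) (funext fun j => (hk j).2)⟩

theorem toTorus_eq_iff {z w : Vec d × Vec d} :
    toTorus z = toTorus w ↔ ∃ k, z = w + (intVec k, 0) := by
  constructor
  · intro h
    obtain ⟨k, hk⟩ := toTorus_eq_one (z := z - w) (by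
      rw [sub_eq_add_neg, toTorus_add, toTorus_neg, h, mul_inv_cancel])
    exact ⟨k, by rw [← hk, add_sub_cancel]⟩
  · rintro ⟨k, rfl⟩
    exact toTorus_add_int w k

/-- The equation of a hypertorus, split into argument and modulus. -/
theorem mem_hypertorus_iff {p : (Fin d → ℤ) × Circle} {z : Vec d × Vec d} :
    toTorus z ∈ hypertorus p ↔
      Circle.exp (2 * Real.pi * charForm p.1 z.1) = p.2 ∧ charForm p.1 z.2 = 0 := by
  have hsplit : 2 * (Real.pi : ℂ) * Complex.I *
      ((charForm p.1 z.1 : ℂ) + (charForm p.1 z.2 : ℂ) * Complex.I) =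
      ((-(2 * Real.pi * charForm p.1 z.2) : ℝ) : ℂ) +
        ((2 * Real.pi * charForm p.1 z.1 : ℝ) : ℂ) * Complex.I := by
    push_cast
    linear_combination (2 * (Real.pi : ℂ) * (charForm p.1 z.2 : ℂ)) * Complex.I_mul_I
  have h0 : toTorus z ∈ hypertorus p ↔ ((∏ i, toTorus z i ^ p.1 i : ℂˣ) : ℂ) = (p.2 : ℂ) := Iff.rfl
  rw [h0, toTorus_char, hsplit, Complex.exp_add]
  constructor
  · intro h
    have hn := congrArg norm h
    rw [norm_mul, Complex.norm_exp_ofReal_mul_I, Circle.norm_coe, mul_one, ← Complex.ofReal_exp,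
      Complex.norm_real, Real.norm_eq_abs, abs_of_pos (Real.exp_pos _), Real.exp_eq_one_iff,
      neg_eq_zero] at hn
    have h2 : charForm p.1 z.2 = 0 := (mul_eq_zero.mp hn).resolve_left (by positivity)
    refine ⟨Circle.ext ?_, h2⟩
    rw [Circle.coe_exp, ← h, h2]
    simp
  · rintro ⟨h1, h2⟩
    rw [← h1, h2, Circle.coe_exp]
    simp

theorem exists_charForm_eq_one {χ : Fin d → ℤ} (h : χ ≠ 0) : ∃ e : Vec d, charForm χ e = 1 := by
  obtain ⟨j, hj⟩ := Function.ne_iff.mp h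
  refine ⟨Pi.single j ((χ j : ℝ)⁻¹), ?_⟩
  have : (χ j : ℝ) ≠ 0 := by exact_mod_cast hj
  rw [charForm_apply, Finset.sum_eq_single j]
  · simp [this]
  · intro i _ hi
    simp [Pi.single_eq_of_ne hi]
  · simp

/-- A real number all of whose multiples are integers is zero. -/
theorem eq_zero_of_forall_int {a : ℝ} (h : ∀ s : ℝ, ∃ n : ℤ, s * a = n) : a = 0 := by
  by_contra ha
  obtain ⟨n, hn⟩ := h ((2 * a)⁻¹)
  have h1 : (2 * a)⁻¹ * a = 1 / 2 := by field_simp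
  rw [h1] at hn
  have h2 : (1 : ℝ) = 2 * n := by linarith
  have h3 : (1 : ℤ) = 2 * n := by exact_mod_cast h2
  omega

theorem exists_phase (a : Circle) : ∃ c : ℝ, Circle.exp (2 * Real.pi * c) = a := by
  refine ⟨Complex.arg a / (2 * Real.pi), ?_⟩
  rw [mul_div_cancel₀ _ (by positivity), Circle.exp_arg]

namespace ToricArrangement

variable {A : ToricArrangement d}

theorem affForm_mem_lift {p : (Fin d → ℤ) × Circle} (hp : p ∈ A.data) {c : ℝ}
    (hc : Circle.exp (2 * Real.pi * c) = p.2) : affForm p.1 c ∈ A.lift := ⟨p, hp, c, hc, rfl⟩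

/-- An essential arrangement has enough characters to separate points: a direction `u` killed by all
of them would give a path in a layer that is a point. -/
theorem IsEssential.eq_zero (hA : A.IsEssential) {u : Vec d}
    (hu : ∀ p ∈ A.data, charForm p.1 u = 0) : u = 0 := by
  obtain ⟨L, ⟨B, hB, t, ht, rfl⟩, hL⟩ := hA
  obtain ⟨z, rfl⟩ := toTorus_surjective t
  let γ : ℝ → Torus d := fun s => toTorus (z + (s • u, 0))
  have hγ : Continuous γ := toTorus_continuous.comp (by fun_prop)
  have hmem : ∀ s, γ s ∈ ⋂₀ B := by
    intro s H hH
    obtain ⟨p, hp, rfl⟩ := hB hH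
    have := mem_hypertorus_iff.mp (ht _ hH)
    refine mem_hypertorus_iff.mpr ?_
    simpa [hu p hp] using this
  have hsub : Set.range γ ⊆ connectedComponentIn (⋂₀ B) (toTorus z) :=
    (isPreconnected_range hγ).subset_connectedComponentIn ⟨0, by
      change toTorus (z + ((0 : ℝ) • u, 0)) = _
      rw [zero_smul]
      exact congrArg toTorus (add_zero z)⟩
      (by rintro _ ⟨s, rfl⟩; exact hmem s)
  have hint : ∀ s : ℝ, ∃ k : Fin d → ℤ, s • u = intVec k := by
    intro s
    have h1 : toTorus (z + (s • u, 0)) = toTorus z :=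
      hL (hsub ⟨s, rfl⟩) (mem_connectedComponentIn ht)
    obtain ⟨k, hk⟩ := toTorus_eq_iff.mp h1
    exact ⟨k, congrArg Prod.fst (add_left_cancel hk)⟩
  funext j
  exact eq_zero_of_forall_int fun s => by
    obtain ⟨k, hk⟩ := hint s
    exact ⟨k j, congrFun hk j⟩

/-- No nonzero translation preserves a face of the lift of an essential arrangement.  Iterating the
translation would move a point across one of the integral translates of a hyperplane. -/
theorem IsEssential.translation_eq_zero (hA : A.IsEssential) {G : Set (Vec d)}
    (hG : IsFace A.lift G) {w : Vec d} (hw : w +ᵥ G = G) : w = 0 := by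
  obtain ⟨x, hx⟩ := hG.nonempty
  have hmul : ∀ n : ℕ, x + (n : ℝ) • w ∈ G := by
    intro n
    induction n with
    | zero => simpa using hx
    | succ n ih =>
      rw [← hw]
      refine ⟨_, ih, ?_⟩
      change w + (x + (n : ℝ) • w) = _
      push_cast
      module
  refine hA.eq_zero fun p hp => ?_
  obtain ⟨c, hc⟩ := exists_phase p.2
  have key : ∀ (m : ℤ) (n : ℕ), SignType.sign (charForm p.1 x - c - m + n * charForm p.1 w) =
      SignType.sign (charForm p.1 x - c - m) := by
    intro m n
    have hf : affForm p.1 (c - (-m : ℤ)) ∈ A.lift :=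
      affForm_mem_lift hp (by rw [circle_exp_sub_int, hc])
    have := hG.sign_eq (hmul n) hx hf
    rw [form_add, affForm_apply, affForm_linear, map_smul, smul_eq_mul] at this
    push_cast at this
    convert this using 2 <;> ring
  by_contra hne
  rcases lt_or_gt_of_ne hne with hlt | hgt
  · obtain ⟨m, hm⟩ := exists_int_lt (charForm p.1 x - c)
    have h0 : 0 < charForm p.1 x - c - m := by linarith
    obtain ⟨n, hn⟩ := exists_nat_gt ((charForm p.1 x - c - m) / (-charForm p.1 w))
    rw [div_lt_iff₀ (by linarith)] at hn
    have := key m n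
    rw [sign_pos h0, sign_eq_one_iff] at this
    linarith
  · obtain ⟨m, hm⟩ := exists_int_gt (charForm p.1 x - c)
    have h0 : charForm p.1 x - c - m < 0 := by linarith
    obtain ⟨n, hn⟩ := exists_nat_gt (-(charForm p.1 x - c - m) / charForm p.1 w)
    rw [div_lt_iff₀ hgt] at hn
    have := key m n
    rw [sign_neg h0, sign_eq_neg_one_iff] at this
    linarith

/-! ### Translations that preserve the arrangement -/

theorem isInvariant_iff {g : Torus d} : A.IsInvariant g ↔ g • A.hypertori = A.hypertori := Iff.rfl

variable (A) in
/-- The group of real translations that cover elements of the torus preserving the arrangement. -/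
def periods : AddSubgroup (Vec d) where
  carrier := {w | A.IsInvariant (toTorus (w, 0))}
  zero_mem' := by
    change A.IsInvariant (toTorus 0)
    rw [toTorus_zero, isInvariant_iff, one_smul]
  add_mem' {a b} ha hb := by
    have : ((a + b, 0) : Vec d × Vec d) = (a, 0) + (b, 0) := by simp
    change A.IsInvariant (toTorus (a + b, 0))
    rw [this, toTorus_add, isInvariant_iff, mul_smul, isInvariant_iff.mp hb, isInvariant_iff.mp ha]
  neg_mem' {a} ha := by
    have : ((-a, 0) : Vec d × Vec d) = -(a, 0) := by simp
    change A.IsInvariant (toTorus (-a, 0))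
    rw [this, toTorus_neg, isInvariant_iff, inv_smul_eq_iff, isInvariant_iff.mp ha]

/-- A translation in `ℤ^d` as a translation preserving the arrangement. -/
def intPeriod (k : Fin d → ℤ) : A.periods := ⟨intVec k, by
  have : ((intVec k, 0) : Vec d × Vec d) = 0 + (intVec k, 0) := by simp
  change A.IsInvariant (toTorus (intVec k, 0))
  rw [this, toTorus_add_int, toTorus_zero, isInvariant_iff, one_smul]⟩

/-- A form vanishing wherever another one does is a multiple of it. -/
theorem charForm_eq_smul {χ χ' : Fin d → ℤ} (hχ : χ ≠ 0) (hχ' : χ' ≠ 0)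
    (h : ∀ u, charForm χ u = 0 → charForm χ' u = 0) :
    ∃ c : ℝ, c ≠ 0 ∧ ∀ u, charForm χ u = c * charForm χ' u := by
  obtain ⟨e, he⟩ := exists_charForm_eq_one hχ
  have key : ∀ u, charForm χ' u = charForm χ u * charForm χ' e := fun u => by
    have := h (u - charForm χ u • e) (by rw [map_sub, map_smul, he, smul_eq_mul, mul_one, sub_self])
    rw [map_sub, map_smul, smul_eq_mul] at this
    linarith
  have hne : charForm χ' e ≠ 0 := by
    obtain ⟨e', he'⟩ := exists_charForm_eq_one hχ'
    intro h0
    rw [key, h0, mul_zero] at he'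
    exact zero_ne_one he'
  refine ⟨(charForm χ' e)⁻¹, inv_ne_zero hne, fun u => ?_⟩
  rw [key u]
  field_simp

/-- The translate of a hyperplane of the lifted arrangement is again one, though its equation may
have to be rescaled. -/
theorem exists_translate (w : A.periods) {f : Form d} (hf : f ∈ A.lift) :
    ∃ f' ∈ A.lift, ∃ c : ℝ, c ≠ 0 ∧ (∀ x, f (w.1 + x) = c * f' x) ∧
      ∀ u, f.linear u = c * f'.linear u := by
  obtain ⟨p, hp, c, hc, rfl⟩ := hf
  have hw : A.IsInvariant (toTorus (w.1, 0)) := w.2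
  have hH : hypertorus p ∈ toTorus (w.1, 0) • A.hypertori := by
    rw [isInvariant_iff.mp hw]
    exact ⟨p, hp, rfl⟩
  obtain ⟨_, ⟨p', hp', rfl⟩, hgp⟩ := hH
  have hmem : ∀ x : Vec d, charForm p.1 (w.1 + x) = c →
      Circle.exp (2 * Real.pi * charForm p'.1 x) = p'.2 := by
    intro x hx
    have h1 : toTorus (w.1 + x, 0) ∈ hypertorus p :=
      mem_hypertorus_iff.mpr ⟨by rw [hx, hc], by simp⟩
    have h2 : ((w.1 + x, 0) : Vec d × Vec d) = (w.1, 0) + (x, 0) := by simp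
    rw [← hgp, h2, toTorus_add] at h1
    obtain ⟨t, ht, he⟩ := h1
    have h3 : t = toTorus (x, 0) := mul_left_cancel (he : toTorus (w.1, 0) * t = _)
    rw [h3] at ht
    exact (mem_hypertorus_iff.mp ht).1
  obtain ⟨e, he⟩ := exists_charForm_eq_one (A.ne_zero p hp)
  set x₀ := c • e - w.1 with hx₀
  have h0 : charForm p.1 (w.1 + x₀) = c := by
    rw [hx₀, add_sub_cancel, map_smul, he, smul_eq_mul, mul_one]
  obtain ⟨b, hb, hlin⟩ := charForm_eq_smul (A.ne_zero p hp) (A.ne_zero p' hp') (fun u hu =>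
    eq_zero_of_forall_int fun s => by
      have h1 := hmem (x₀ + s • u) (by rw [← add_assoc, map_add, h0, map_smul, hu]; simp)
      obtain ⟨n, hn⟩ := circle_exp_eq (h1.trans (hmem x₀ h0).symm)
      rw [map_add, map_smul, smul_eq_mul] at hn
      exact ⟨n, by linarith⟩)
  refine ⟨affForm p'.1 (charForm p'.1 x₀), affForm_mem_lift hp' (hmem x₀ h0), b, hb, fun x => ?_,
    fun u => by rw [affForm_linear, affForm_linear, hlin]⟩
  rw [affForm_apply, affForm_apply]
  have h3 : charForm p.1 (w.1 + x) = c + charForm p.1 (x - x₀) := by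
    rw [← h0, ← map_add]; congr 1; abel
  rw [h3, hlin, map_sub]
  ring

/-- The translate, in the opposite direction, of a hyperplane of the lifted arrangement. -/
theorem exists_translate' (w : A.periods) {f : Form d} (hf : f ∈ A.lift) :
    ∃ f' ∈ A.lift, ∃ c : ℝ, c ≠ 0 ∧ (∀ x, f x = c * f' (w.1 + x)) ∧
      ∀ u, f.linear u = c * f'.linear u := by
  obtain ⟨f', hf', c, hc, h1, h2⟩ := exists_translate (-w) hf
  refine ⟨f', hf', c, hc, fun x => ?_, h2⟩
  rw [← h1]
  simp

theorem sign_translate (w : A.periods) {x y : Vec d}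
    (h : ∀ f ∈ A.lift, SignType.sign (f x) = SignType.sign (f y)) {f : Form d} (hf : f ∈ A.lift) :
    SignType.sign (f (w.1 + x)) = SignType.sign (f (w.1 + y)) := by
  obtain ⟨f', hf', c, -, h1, -⟩ := exists_translate w hf
  rw [h1, h1, sign_mul, sign_mul, h f' hf']

theorem period_vadd_signCell (w : A.periods) (x : Vec d) :
    w.1 +ᵥ signCell A.lift x = signCell A.lift (w.1 + x) := by
  ext y
  rw [Set.mem_vadd_set_iff_neg_vadd_mem, vadd_eq_add]
  constructor
  · intro h f hf
    have := sign_translate w h hf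
    rwa [add_neg_cancel_left] at this
  · intro h f hf
    have := sign_translate (-w) h hf
    simpa using this

theorem period_isFace {F : Set (Vec d)} (h : IsFace A.lift F) (w : A.periods) :
    IsFace A.lift (w.1 +ᵥ F) := by
  obtain ⟨x, rfl⟩ := h
  exact ⟨_, period_vadd_signCell w x⟩

theorem period_isChamber {F : Set (Vec d)} (h : IsChamber A.lift F) (w : A.periods) :
    IsChamber A.lift (w.1 +ᵥ F) := by
  refine ⟨period_isFace h.1 w, ?_⟩
  rintro f hf _ ⟨x, hx, rfl⟩
  obtain ⟨f', hf', c, hc, h1, -⟩ := exists_translate w hf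
  change f (w.1 + x) ≠ 0
  rw [h1]
  exact mul_ne_zero hc (h.2 f' hf' x hx)

theorem period_agreeAt {G C C' : Set (Vec d)} (h : AgreeAt A.lift G C C') (w : A.periods) :
    AgreeAt A.lift (w.1 +ᵥ G) (w.1 +ᵥ C) (w.1 +ᵥ C') := by
  rintro f hf h0 _ ⟨c, hc, rfl⟩ _ ⟨c', hc', rfl⟩
  obtain ⟨f', hf', a, ha, h1, -⟩ := exists_translate w hf
  have := h f' hf' (fun x hx => by
    have := h0 _ (Set.vadd_mem_vadd_set hx)
    rw [vadd_eq_add, h1] at this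
    exact (mul_eq_zero.mp this).resolve_left ha) c hc c' hc'
  change SignType.sign (f (w.1 + c)) = SignType.sign (f (w.1 + c'))
  rw [h1, h1, sign_mul, sign_mul, this]

instance : AddAction A.periods A.Cell where
  vadd w F := ⟨w.1 +ᵥ F.carrier, period_isFace F.isFace w⟩
  zero_vadd F := Face.ext (zero_vadd (Vec d) F.carrier)
  add_vadd v w F := Face.ext (add_vadd v.1 w.1 F.carrier)

instance : AddAction A.periods (Sal A.lift) where
  vadd w x := ⟨w.1 +ᵥ x.face, w.1 +ᵥ x.chamber, period_isFace x.isFace w,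
    period_isChamber x.isChamber w, le_vadd x.le _⟩
  zero_vadd x := Sal.ext (zero_vadd (Vec d) x.face) (zero_vadd (Vec d) x.chamber)
  add_vadd v w x := Sal.ext (add_vadd v.1 w.1 x.face) (add_vadd v.1 w.1 x.chamber)

instance : CovariantClass A.periods A.Cell (· +ᵥ ·) (· ≤ ·) :=
  ⟨fun w _ _ h => le_vadd h w.1⟩

instance : CovariantClass A.periods (Sal A.lift) (· +ᵥ ·) (· ≤ ·) :=
  ⟨fun w _ _ h => ⟨le_vadd h.1 w.1, period_agreeAt h.2 w⟩⟩

theorem period_comm_cell (w : A.periods) (k : Fin d → ℤ) (F : A.Cell) :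
    w +ᵥ (k +ᵥ F) = k +ᵥ (w +ᵥ F) := vadd_comm w (intPeriod k : A.periods) F

theorem period_comm_sal (w : A.periods) (k : Fin d → ℤ) (x : Sal A.lift) :
    w +ᵥ (k +ᵥ x) = k +ᵥ (w +ᵥ x) := vadd_comm w (intPeriod k : A.periods) x

theorem IsEssential.cell_period (hA : A.IsEssential) {w : A.periods} {F : A.Cell}
    (h : w +ᵥ F = F) : w = 0 :=
  Subtype.ext (hA.translation_eq_zero F.isFace (congrArg Face.carrier h))

theorem IsEssential.sal_period (hA : A.IsEssential) {w : A.periods} {x : Sal A.lift}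
    (h : w +ᵥ x = x) : w = 0 :=
  Subtype.ext (hA.translation_eq_zero x.isFace (congrArg Sal.face h))

theorem intPeriod_injective {k : Fin d → ℤ} (h : (intPeriod k : A.periods) = 0) : k = 0 := by
  funext j
  have h1 : (k j : ℝ) = 0 := congrFun (congrArg Subtype.val h) j
  exact_mod_cast h1

/-- Every element of the torus preserving an essential arrangement is covered by a real
translation, because all hypertori are defined by phases of modulus one. -/
theorem IsEssential.exists_period (hA : A.IsEssential) {g : Torus d} (hg : A.IsInvariant g) :
    ∃ v : A.periods, toTorus (v.1, 0) = g := by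
  obtain ⟨⟨x, y⟩, rfl⟩ := toTorus_surjective g
  have hy : y = 0 := hA.eq_zero fun p hp => by
    have hH : hypertorus p ∈ toTorus (x, y) • A.hypertori := by
      rw [isInvariant_iff.mp hg]
      exact ⟨p, hp, rfl⟩
    obtain ⟨_, ⟨p', hp', rfl⟩, hgp⟩ := hH
    obtain ⟨e, he⟩ := exists_charForm_eq_one (A.ne_zero p' hp')
    obtain ⟨c, hc⟩ := exists_phase p'.2
    have h1 : toTorus (c • e, 0) ∈ hypertorus p' :=
      mem_hypertorus_iff.mpr ⟨by rw [map_smul, he, smul_eq_mul, mul_one, hc], by simp⟩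
    have h2 : toTorus (x, y) * toTorus (c • e, 0) ∈ hypertorus p := by
      rw [← hgp]
      exact Set.smul_mem_smul_set h1
    rw [← toTorus_add] at h2
    simpa using (mem_hypertorus_iff.mp h2).2
  subst hy
  exact ⟨⟨x, hg⟩, rfl⟩

end ToricArrangement

/-! ### Quotients by free actions -/

namespace OrbitCat

variable {Γ P : Type} [AddCommGroup Γ] [AddAction Γ P]

theorem mk'_vadd (k : Γ) (x : P) : mk' Γ (k +ᵥ x) = mk' Γ x :=
  congrArg OrbitCat.mk (Quotient.sound (AddAction.mem_orbit_iff.mpr ⟨k, rfl⟩))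

theorem mk'_rep (X : OrbitCat Γ P) : mk' Γ X.rep = X :=
  congrArg OrbitCat.mk (Quotient.out_eq X.orbit)

theorem shift_vadd_eq (hfree : ∀ (k : Γ) (x : P), k +ᵥ x = x → k = 0) (k : Γ) (x : P) :
    shift Γ (k +ᵥ x) = shift Γ x - k := by
  have h1 := shift_vadd (Γ := Γ) (k +ᵥ x)
  rw [mk'_vadd, ← shift_vadd (Γ := Γ) x, ← add_vadd] at h1
  have h2 := hfree (-shift Γ x + (shift Γ (k +ᵥ x) + k)) x (by
    rw [add_vadd, h1, neg_vadd_vadd])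
  have h3 : shift Γ (k +ᵥ x) + k = shift Γ x := by
    rwa [neg_add_eq_zero, eq_comm] at h2
  exact eq_sub_of_add_eq h3

variable [Preorder P] [CovariantClass Γ P (· +ᵥ ·) (· ≤ ·)]

theorem hom_heq {X Y X' Y' : OrbitCat Γ P} (hX : X = X') (hY : Y = Y') {f : X ⟶ Y} {f' : X' ⟶ Y'}
    (h : f.1 = f'.1) : HEq f f' := by
  subst hX hY
  exact heq_of_eq (Subtype.ext h)

end OrbitCat

end

section

variable {d : ℕ}

/-! ### Rescaling the equations of an arrangement -/

/-- The forms of `E` and of `E'` agree up to nonzero factors, that is, `E` and `E'` are equations of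
the same arrangement. -/
structure SameArr (E E' : Set (Form d)) : Prop where
  fwd : ∀ f ∈ E, ∃ f' ∈ E', ∃ c : ℝ, c ≠ 0 ∧ (∀ x, f x = c * f' x) ∧
    ∀ u, f.linear u = c * f'.linear u
  bwd : ∀ f ∈ E', ∃ f' ∈ E, ∃ c : ℝ, c ≠ 0 ∧ (∀ x, f x = c * f' x) ∧
    ∀ u, f.linear u = c * f'.linear u

namespace SameArr

variable {E E' : Set (Form d)}

theorem symm (h : SameArr E E') : SameArr E' E := ⟨h.bwd, h.fwd⟩

theorem signCell (h : SameArr E E') (x : Vec d) : signCell E x = signCell E' x := by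
  ext y
  constructor
  · intro hy f hf
    obtain ⟨f', hf', c, -, h1, -⟩ := h.bwd f hf
    rw [h1, h1, sign_mul, sign_mul, hy f' hf']
  · intro hy f hf
    obtain ⟨f', hf', c, -, h1, -⟩ := h.fwd f hf
    rw [h1, h1, sign_mul, sign_mul, hy f' hf']

theorem isFace (h : SameArr E E') {F : Set (Vec d)} (hF : IsFace E F) : IsFace E' F := by
  obtain ⟨x, rfl⟩ := hF
  exact ⟨x, h.signCell x⟩

theorem isChamber (h : SameArr E E') {F : Set (Vec d)} (hF : IsChamber E F) : IsChamber E' F := by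
  refine ⟨h.isFace hF.1, fun f hf x hx => ?_⟩
  obtain ⟨f', hf', c, hc, h1, -⟩ := h.bwd f hf
  rw [h1]
  exact mul_ne_zero hc (hF.2 f' hf' x hx)

theorem agreeAt (h : SameArr E E') {G C C' : Set (Vec d)} (hG : AgreeAt E G C C') :
    AgreeAt E' G C C' := by
  intro f hf h0 c hc c' hc'
  obtain ⟨f', hf', a, ha, h1, -⟩ := h.bwd f hf
  rw [h1, h1, sign_mul, sign_mul, hG f' hf' (fun x hx => by
    have := h0 x hx
    rw [h1] at this
    exact (mul_eq_zero.mp this).resolve_left ha) c hc c' hc']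

/-- The Salvetti poset does not depend on the choice of equations. -/
def sal (h : SameArr E E') (x : Sal E) : Sal E' :=
  ⟨x.face, x.chamber, h.isFace x.isFace, h.isChamber x.isChamber, x.le⟩

theorem sal_le (h : SameArr E E') {x y : Sal E} (hxy : x ≤ y) : h.sal x ≤ h.sal y :=
  ⟨hxy.1, h.agreeAt hxy.2⟩

theorem glue_subset (h : SameArr E E') (W K : Set (Vec d)) : glue E W K ⊆ glue E' W K := by
  rintro u ⟨w, hw, v, hv, hu⟩
  refine ⟨w, hw, v, hv, fun f hf => ?_⟩
  obtain ⟨f', hf', c, hc, h1, h2⟩ := h.bwd f hf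
  have h3 : f w = 0 ↔ f' w = 0 := by rw [h1, mul_eq_zero, or_iff_right hc]
  rw [h1 u, sign_mul, hu f' hf']
  by_cases h4 : f' w = 0
  · rw [if_pos h4, if_pos (h3.mpr h4), h2, sign_mul]
  · rw [if_neg h4, if_neg (mt h3.mp h4), h1 w, sign_mul]

theorem glue_eq (h : SameArr E E') (W K : Set (Vec d)) : glue E W K = glue E' W K :=
  (h.glue_subset W K).antisymm (h.symm.glue_subset W K)

end SameArr

namespace ToricArrangement

variable {A : ToricArrangement d}

theorem localForms_period (w : A.periods) (F : Set (Vec d)) :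
    SameArr (localForms A.lift F) (localForms A.lift (w.1 +ᵥ F)) where
  fwd := by
    rintro _ ⟨f, hf, h0, rfl⟩
    obtain ⟨f', hf', c, hc, h1, h2⟩ := exists_translate' w hf
    refine ⟨f'.linear.toAffineMap, ⟨f', hf', ?_, rfl⟩, c, hc, h2, h2⟩
    rintro _ ⟨x, hx, rfl⟩
    have := h0 x hx
    rw [h1] at this
    exact (mul_eq_zero.mp this).resolve_left hc
  bwd := by
    rintro _ ⟨f, hf, h0, rfl⟩
    obtain ⟨f', hf', c, hc, h1, h2⟩ := exists_translate w hf
    refine ⟨f'.linear.toAffineMap, ⟨f', hf', fun x hx => ?_, rfl⟩, c, hc, h2, h2⟩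
    have := h0 _ (Set.vadd_mem_vadd_set hx)
    rw [vadd_eq_add, h1] at this
    exact (mul_eq_zero.mp this).resolve_left hc

/-! ### Morphisms of the toric Salvetti category -/

namespace ToricSal

theorem hom_ext {X Y : A.ToricSal} {f f' : X ⟶ Y} (h : f.base.unop.1 = f'.base.unop.1) :
    f = f' := by
  have hb : f.base = f'.base := Quiver.Hom.unop_inj (Subtype.ext h)
  exact Grothendieck.ext f f' hb (ULift.ext _ _ (Subsingleton.elim (α := PLift _) _ _))

/-- The object `(F, [G, C])`. -/
def mk (F : A.FaceCat) (x : Sal (A.localArr F)) : A.ToricSal := ⟨op F, x⟩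

/-- The morphism of `∫ D` over a morphism of faces. -/
def homMk {X Y : A.ToricSal} (m : Y.base ⟶ X.base) (h : transition m X.pair ≤ Y.pair) : X ⟶ Y where
  base := m.op
  fiber := (homOfLE h : (transition m X.pair : Sal (A.localArr Y.base)) ⟶ Y.pair)

theorem obj_ext {X Y : A.ToricSal} (h : X.base = Y.base) (h1 : X.pair.face = Y.pair.face)
    (h2 : X.pair.chamber = Y.pair.chamber) : X = Y := by
  obtain ⟨F, x⟩ := X
  obtain ⟨G, y⟩ := Y
  have hFG : F = G := congrArg op h
  subst hFG
  have : x = y := Sal.ext h1 h2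
  rw [this]

theorem comp_val {X Y Z : A.ToricSal} (f : X ⟶ Y) (f' : Y ⟶ Z) :
    (f ≫ f').base.unop.1 = f.base.unop.1 + f'.base.unop.1 := rfl

end ToricSal

/-! ### The functors induced by a translation -/

/-- The action of a translation on the orbits of faces or of pairs. -/
def moveSal (v : A.periods) (X : A.SalQuot) : A.SalQuot := OrbitCat.mk' (Fin d → ℤ) (v +ᵥ X.rep)

theorem moveSal_mk (v : A.periods) (x : Sal A.lift) :
    moveSal v (OrbitCat.mk' (Fin d → ℤ) x) = OrbitCat.mk' (Fin d → ℤ) (v +ᵥ x) := by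
  unfold moveSal
  rw [← OrbitCat.shift_vadd, period_comm_sal, OrbitCat.mk'_vadd]

/-- The functor `[G, C] ↦ [v + G, v + C]`. -/
def salFunctor (v : A.periods) : A.SalQuot ⥤ A.SalQuot where
  obj X := moveSal v X
  map {X Y} f := ⟨OrbitCat.shift (Fin d → ℤ) (v +ᵥ Y.rep) + f.1 -
      OrbitCat.shift (Fin d → ℤ) (v +ᵥ X.rep), by
    unfold moveSal
    rw [← OrbitCat.shift_vadd, ← OrbitCat.shift_vadd, ← add_vadd, sub_add_cancel, add_vadd,
      ← period_comm_sal]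
    exact OrbitCat.vadd_le_vadd' _ (OrbitCat.vadd_le_vadd' v f.2)⟩
  map_id X := by
    apply Subtype.ext
    change _ + (0 : Fin d → ℤ) - _ = (0 : Fin d → ℤ)
    rw [add_zero, sub_self]
  map_comp f g := by
    apply Subtype.ext
    simp only [OrbitCat.comp_val]
    abel

/-- The image of a face of the toric arrangement under a translation. -/
def moveFace (v : A.periods) (F : A.FaceCat) : A.FaceCat := OrbitCat.mk' (Fin d → ℤ) (v +ᵥ F.rep)

theorem moveFace_mk (v : A.periods) (F : A.Cell) :
    moveFace v (OrbitCat.mk' (Fin d → ℤ) F) = OrbitCat.mk' (Fin d → ℤ) (v +ᵥ F) := by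
  unfold moveFace
  rw [← OrbitCat.shift_vadd, period_comm_cell, OrbitCat.mk'_vadd]

theorem moveFace_rep (v : A.periods) (F : A.FaceCat) : (moveFace v F).rep =
    OrbitCat.shift (Fin d → ℤ) (v +ᵥ F.rep) +ᵥ (v +ᵥ F.rep) :=
  (OrbitCat.shift_vadd _).symm

theorem toSet_mk (F : A.Cell) : FaceCat.toSet (OrbitCat.mk' (Fin d → ℤ) F) =
    (fun x => toTorus (x, 0)) '' F.carrier := by
  unfold FaceCat.toSet
  rw [← OrbitCat.shift_vadd, Cell.vadd_carrier, ← Set.image_vadd, Set.image_image]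
  refine Set.image_congr fun x _ => ?_
  have := toTorus_add_int (x, 0) (OrbitCat.shift (Fin d → ℤ) F)
  rw [← this]
  congr 1
  ext i <;> simp [add_comm]

theorem toSet_moveFace (v : A.periods) (F : A.FaceCat) :
    (moveFace v F).toSet = toTorus (v.1, 0) • F.toSet := by
  unfold moveFace
  rw [toSet_mk]
  change _ '' (v.1 +ᵥ F.rep.carrier) = _
  unfold FaceCat.toSet
  rw [← Set.image_vadd, ← Set.image_smul, Set.image_image, Set.image_image]
  refine Set.image_congr fun x _ => ?_
  rw [smul_eq_mul, ← toTorus_add]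
  simp

/-- Translations only rescale the equations of the local arrangements, so the local arrangement of a
face and that of its translate have the same faces. -/
theorem localArr_moveFace (v : A.periods) (F : A.FaceCat) :
    SameArr (A.localArr F) (A.localArr (moveFace v F)) := by
  have h := localForms_period v F.rep.carrier
  unfold localArr
  rw [moveFace_rep, Cell.vadd_carrier, localForms_vadd]
  exact h

theorem vadd_sub_vadd_set (w : Vec d) (S S' : Set (Vec d)) : (w +ᵥ S) - (w +ᵥ S') = S - S' := by
  ext x
  constructor
  · rintro ⟨_, ⟨y, hy, rfl⟩, _, ⟨z, hz, rfl⟩, rfl⟩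
    exact ⟨y, hy, z, hz, (add_sub_add_left_eq_sub y z w).symm⟩
  · rintro ⟨y, hy, z, hz, rfl⟩
    exact ⟨w + y, ⟨y, hy, rfl⟩, w + z, ⟨z, hz, rfl⟩, add_sub_add_left_eq_sub y z w⟩

/-- The morphism of faces obtained from another one by translation. -/
def moveHom (v : A.periods) {F G : A.FaceCat} (m : F ⟶ G) : moveFace v F ⟶ moveFace v G :=
  ⟨OrbitCat.shift (Fin d → ℤ) (v +ᵥ G.rep) + m.1 - OrbitCat.shift (Fin d → ℤ) (v +ᵥ F.rep), by
    rw [moveFace_rep, moveFace_rep, ← add_vadd, sub_add_cancel, add_vadd, ← period_comm_cell]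
    exact OrbitCat.vadd_le_vadd' _ (OrbitCat.vadd_le_vadd' v m.2)⟩

/-- The directions between two faces, which determine the transition maps, do not change under
translation. -/
theorem move_differences (v : A.periods) {F G : A.FaceCat} (m : F ⟶ G) :
    (moveFace v G).rep.carrier - ((moveHom v m).1 +ᵥ (moveFace v F).rep).carrier =
      G.rep.carrier - (m.1 +ᵥ F.rep).carrier := by
  have h1 : (moveFace v G).rep.carrier = (intVec (OrbitCat.shift (Fin d → ℤ) (v +ᵥ G.rep)) + v.1) +ᵥ
      G.rep.carrier := by
    rw [moveFace_rep, add_vadd]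
    rfl
  have h2 : ((moveHom v m).1 +ᵥ (moveFace v F).rep).carrier =
      (intVec (OrbitCat.shift (Fin d → ℤ) (v +ᵥ G.rep)) + v.1) +ᵥ (m.1 +ᵥ F.rep).carrier := by
    have h3 : (moveHom v m).1 +ᵥ (moveFace v F).rep =
        OrbitCat.shift (Fin d → ℤ) (v +ᵥ G.rep) +ᵥ (v +ᵥ (m.1 +ᵥ F.rep)) := by
      have h4 : (moveHom v m).1 = OrbitCat.shift (Fin d → ℤ) (v +ᵥ G.rep) + m.1 -
        OrbitCat.shift (Fin d → ℤ) (v +ᵥ F.rep) := rfl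
      rw [h4]
      exact (congrArg _ (moveFace_rep v F)).trans
        (by rw [← add_vadd, sub_add_cancel, add_vadd, ← period_comm_cell])
    rw [h3, add_vadd]
    rfl
  rw [h1, h2]
  exact vadd_sub_vadd_set _ _ _

theorem transition_move (v : A.periods) {F G : A.FaceCat} (m : F ⟶ G) (x : Sal (A.localArr G)) :
    transition (moveHom v m) ((localArr_moveFace v G).sal x) =
      (localArr_moveFace v F).sal (transition m x) := by
  refine Sal.ext ?_ ?_
  · change glue _ _ x.face = glue _ _ x.face
    rw [move_differences, (localArr_moveFace v F).glue_eq]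
  · change glue _ _ x.chamber = glue _ _ x.chamber
    rw [move_differences, (localArr_moveFace v F).glue_eq]

/-- The functor `(F, [G, C]) ↦ (q(v) F, [G, C])`. -/
def toricFunctor (v : A.periods) : A.ToricSal ⥤ A.ToricSal where
  obj X := ToricSal.mk (moveFace v X.base) ((localArr_moveFace v X.base).sal X.pair)
  map {X Y} f := ToricSal.homMk (moveHom v f.base.unop) (by
    refine (transition_move v f.base.unop X.pair).trans_le ?_
    exact (localArr_moveFace v Y.base).sal_le (ToricSal.hom_le f))
  map_id X := by
    apply ToricSal.hom_ext
    change _ + (0 : Fin d → ℤ) - _ = (0 : Fin d → ℤ)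
    rw [add_zero, sub_self]
  map_comp {X Y Z} f g := by
    apply ToricSal.hom_ext
    rw [ToricSal.comp_val]
    change _ + (f ≫ g).base.unop.1 - _ = (_ + f.base.unop.1 - _) + (_ + g.base.unop.1 - _)
    rw [ToricSal.comp_val]
    abel

theorem glue_period (w : A.periods) {W K : Set (Vec d)} :
    glue A.lift (w.1 +ᵥ W) K = w.1 +ᵥ glue A.lift W K := by
  have key : ∀ (w : A.periods) (W : Set (Vec d)), w.1 +ᵥ glue A.lift W K ⊆
      glue A.lift (w.1 +ᵥ W) K := by
    rintro w W _ ⟨u, ⟨x, hx, y, hy, hu⟩, rfl⟩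
    refine ⟨w.1 + x, Set.vadd_mem_vadd_set hx, y, hy, fun f hf => ?_⟩
    obtain ⟨f', hf', c, hc, h1, h2⟩ := exists_translate w hf
    have h3 : f (w.1 + x) = 0 ↔ f' x = 0 := by rw [h1, mul_eq_zero, or_iff_right hc]
    change SignType.sign (f (w.1 + u)) = _
    rw [h1 u, sign_mul, hu f' hf']
    by_cases h4 : f' x = 0
    · rw [if_pos h4, if_pos (h3.mpr h4), h2, sign_mul]
    · rw [if_neg h4, if_neg (mt h3.mp h4), h1 x, sign_mul]
  refine (subset_antisymm ?_ (key w W))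
  have := key (-w) (w.1 +ᵥ W)
  have hneg : (-w : A.periods).1 = -w.1 := rfl
  rw [hneg, neg_vadd_vadd] at this
  rwa [Set.subset_vadd_set_iff]

theorem star_period (w : A.periods) {E : Set (Form d)} {F : A.Cell}
    (hE : E = localForms A.lift F.carrier) {E' : Set (Form d)} {F' : A.Cell} (hF : F' = w +ᵥ F)
    (hE' : E' = localForms A.lift F'.carrier) {x : Sal E} {x' : Sal E'} (h1 : x'.face = x.face)
    (h2 : x'.chamber = x.chamber) : star F' hE' x' = w +ᵥ star F hE x := by
  subst hF
  refine Sal.ext ?_ ?_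
  · change glue A.lift (w.1 +ᵥ F.carrier) x'.face = w.1 +ᵥ glue A.lift F.carrier x.face
    rw [h1, glue_period]
  · change glue A.lift (w.1 +ᵥ F.carrier) x'.chamber = w.1 +ᵥ glue A.lift F.carrier x.chamber
    rw [h2, glue_period]

/-- The lift of the pair of a translated object, up to the shift relating the chosen representative
of the translated face to the translate of the chosen representative. -/
theorem star_move (v : A.periods) (X : A.ToricSal) :
    star ((toricFunctor v).obj X).base.rep rfl ((toricFunctor v).obj X).pair =
      OrbitCat.shift (Fin d → ℤ) (v +ᵥ X.base.rep) +ᵥ (v +ᵥ star X.base.rep rfl X.pair) := by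
  have h := star_period (intPeriod (OrbitCat.shift (Fin d → ℤ) (v +ᵥ X.base.rep)) + v)
    (E := A.localArr X.base) (F := X.base.rep) rfl (F' := (moveFace v X.base).rep) (E' := A.localArr (moveFace v X.base)) ?_ rfl (x := X.pair)
    (x' := (localArr_moveFace v X.base).sal X.pair) rfl rfl
  · rw [add_vadd] at h
    exact h
  · rw [moveFace_rep, add_vadd]
    rfl

theorem IsEssential.cell_free (hA : A.IsEssential) (k : Fin d → ℤ) (F : A.Cell) (h : k +ᵥ F = F) :
    k = 0 := intPeriod_injective (hA.cell_period h)

theorem IsEssential.sal_free (hA : A.IsEssential) (k : Fin d → ℤ) (x : Sal A.lift)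
    (h : k +ᵥ x = x) : k = 0 := intPeriod_injective (hA.sal_period h)

/-- The comparison functor commutes with the functors induced by a translation. -/
theorem toricFunctor_comparison (hA : A.IsEssential) (v : A.periods) :
    toricFunctor v ⋙ A.comparison = A.comparison ⋙ salFunctor v := by
  have hobj : ∀ X, A.comparison.obj ((toricFunctor v).obj X) =
      (salFunctor v).obj (A.comparison.obj X) := by
    intro X
    change OrbitCat.mk' _ (star ((toricFunctor v).obj X).base.rep rfl _) =
      moveSal v (OrbitCat.mk' _ _)
    rw [moveSal_mk, star_move, OrbitCat.mk'_vadd]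
  refine CategoryTheory.Functor.hext hobj fun X Y f => OrbitCat.hom_heq (hobj X) (hobj Y) ?_
  have hX : ∀ X : A.ToricSal, OrbitCat.shift (Fin d → ℤ) (star ((toricFunctor v).obj X).base.rep rfl
      ((toricFunctor v).obj X).pair) = OrbitCat.shift (Fin d → ℤ) (v +ᵥ star X.base.rep rfl X.pair) -
        OrbitCat.shift (Fin d → ℤ) (v +ᵥ X.base.rep) := fun X => by
    rw [star_move, OrbitCat.shift_vadd_eq hA.sal_free]
  have hX' : ∀ x : Sal A.lift, OrbitCat.shift (Fin d → ℤ)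
      (v +ᵥ (OrbitCat.mk' (Fin d → ℤ) x).rep) =
      OrbitCat.shift (Fin d → ℤ) (v +ᵥ x) - OrbitCat.shift (Fin d → ℤ) x := fun x => by
    rw [← OrbitCat.shift_vadd, period_comm_sal, OrbitCat.shift_vadd_eq hA.sal_free]
  change OrbitCat.shift (Fin d → ℤ) (star ((toricFunctor v).obj Y).base.rep rfl
      ((toricFunctor v).obj Y).pair) - (_ + f.base.unop.1 - _) -
      OrbitCat.shift (Fin d → ℤ) (star ((toricFunctor v).obj X).base.rep rfl
      ((toricFunctor v).obj X).pair) = OrbitCat.shift (Fin d → ℤ)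
      (v +ᵥ (OrbitCat.mk' (Fin d → ℤ) (star Y.base.rep rfl Y.pair)).rep) + (_ - _ - _) -
      OrbitCat.shift (Fin d → ℤ) (v +ᵥ (OrbitCat.mk' (Fin d → ℤ) (star X.base.rep rfl X.pair)).rep)
  rw [hX, hX, hX', hX']
  abel

/-! ### Choices of points -/

theorem sal_eq_of_vadd (w : A.periods) {x y : Sal A.lift} (h1 : y.face = w.1 +ᵥ x.face)
    (h2 : y.chamber = w.1 +ᵥ x.chamber) : y = w +ᵥ x := Sal.ext h1 h2

theorem convexPiece_nonempty {E : Set (Form d)} (x : Sal E) : (convexPiece x).Nonempty := by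
  obtain ⟨a, ha⟩ := x.isFace.nonempty
  obtain ⟨c, hc⟩ := x.isChamber.1.nonempty
  refine ⟨(a, c - a), ha, fun f hf h0 c' hc' => ?_⟩
  change SignType.sign (f.linear (c - a)) = _
  rw [form_sub, h0 a ha, sub_zero]
  exact x.isChamber.1.sign_eq hc hc' hf

theorem convexPiece_vadd (w : A.periods) {x : Sal A.lift} {z : Vec d × Vec d}
    (hz : z ∈ convexPiece x) : z + (w.1, 0) ∈ convexPiece (w +ᵥ x) := by
  refine ⟨⟨z.1, hz.1, add_comm _ _⟩, ?_⟩
  rintro f hf h0 _ ⟨c, hc, rfl⟩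
  obtain ⟨f', hf', a, ha, h1, h2⟩ := exists_translate w hf
  have h3 : ∀ y ∈ x.face, f' y = 0 := fun y hy => by
    have : f (w.1 + y) = 0 := h0 _ ⟨y, hy, rfl⟩
    rw [h1] at this
    exact (mul_eq_zero.mp this).resolve_left ha
  change SignType.sign (f.linear (z.2 + 0)) = SignType.sign (f (w.1 + c))
  rw [add_zero, h1, h2, sign_mul, sign_mul, hz.2 f' hf' h3 c hc]

theorem sign_convex {a b c s : ℝ} (ha : SignType.sign a = SignType.sign c)
    (hb : SignType.sign b = SignType.sign c) (h0 : 0 ≤ s) (h1 : s ≤ 1) :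
    SignType.sign ((1 - s) * a + s * b) = SignType.sign c := by
  rcases lt_trichotomy c 0 with h | h | h
  · rw [sign_neg h, sign_eq_neg_one_iff] at *
    nlinarith [mul_nonneg h0 (neg_nonneg.mpr hb.le),
      mul_nonneg (sub_nonneg.mpr h1) (neg_nonneg.mpr ha.le)]
  · subst h
    rw [sign_zero, sign_eq_zero_iff] at ha hb
    rw [ha, hb, mul_zero, mul_zero, add_zero]
  · rw [sign_pos h, sign_eq_one_iff] at *
    nlinarith [mul_nonneg h0 hb.le, mul_nonneg (sub_nonneg.mpr h1) ha.le]

theorem convexPiece_segment {E : Set (Form d)} {x : Sal E} {z z' : Vec d × Vec d}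
    (hz : z ∈ convexPiece x) (hz' : z' ∈ convexPiece x) {s : ℝ} (h0 : 0 ≤ s) (h1 : s ≤ 1) :
    z + s • (z' - z) ∈ convexPiece x := by
  refine ⟨x.isFace.mem hz.1 fun f hf => ?_, fun f hf hv c hc => ?_⟩
  · have : f (z + s • (z' - z)).1 = (1 - s) * f z.1 + s * f z'.1 := by
      rw [Prod.fst_add, Prod.smul_fst, Prod.fst_sub, form_add, map_smul, form_sub, smul_eq_mul]
      ring
    rw [this]
    exact sign_convex rfl (x.isFace.sign_eq hz'.1 hz.1 hf) h0 h1
  · have : f.linear (z + s • (z' - z)).2 = (1 - s) * f.linear z.2 + s * f.linear z'.2 := by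
      rw [Prod.snd_add, Prod.smul_snd, Prod.snd_sub, map_add, map_smul, map_sub, smul_eq_mul]
      ring
    rw [this]
    exact sign_convex (hz.2 f hf hv c hc) (hz'.2 f hf hv c hc) h0 h1

/-- Choices of points equivariant under all translations preserving the arrangement exist, because
these translations act freely. -/
theorem IsEssential.exists_pointChoice (hA : A.IsEssential) :
    ∃ p : A.PointChoice, ∀ w : A.periods, p.IsEquivariantUnder w.1 := by
  let Γ := A.periods
  let base : Sal A.lift → Vec d × Vec d := fun x => (convexPiece_nonempty x).some
  let pt : Sal A.lift → Vec d × Vec d := fun x =>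
    base (OrbitCat.mk' Γ x).rep + ((-OrbitCat.shift Γ x : Γ).1, 0)
  have hequi : ∀ (w : Γ) x, pt (w +ᵥ x) = pt x + (w.1, 0) := by
    intro w x
    have h1 : OrbitCat.shift Γ (w +ᵥ x) = OrbitCat.shift Γ x - w :=
      OrbitCat.shift_vadd_eq (fun k x h => hA.sal_period h) w x
    change base (OrbitCat.mk' Γ (w +ᵥ x)).rep + ((-OrbitCat.shift Γ (w +ᵥ x) : Γ).1, 0) = _
    rw [h1, OrbitCat.mk'_vadd, neg_sub]
    change _ = base _ + _ + _
    refine Eq.trans ?_ (add_assoc _ _ _).symm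
    refine congrArg (base (OrbitCat.mk' Γ x).rep + ·) (Prod.ext ?_ (add_zero (0 : Vec d)).symm)
    change w.1 - (OrbitCat.shift Γ x : Γ).1 = -(OrbitCat.shift Γ x : Γ).1 + w.1
    abel
  refine ⟨⟨pt, fun x => ?_, fun k x => hequi (intPeriod k) x⟩, fun w x y h1 h2 => ?_⟩
  · have h1 := convexPiece_vadd (-OrbitCat.shift Γ x : Γ)
      (convexPiece_nonempty (OrbitCat.mk' Γ x).rep).some_mem
    rw [← OrbitCat.shift_vadd (Γ := Γ) x, neg_vadd_vadd, OrbitCat.shift_vadd] at h1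
    exact h1
  · rw [sal_eq_of_vadd w h1 h2]
    exact hequi w x

theorem inclusion_simplexIncl (p : A.PointChoice) {n : ℕ} (s : ComposableArrows A.SalQuot n)
    (t : stdSimplex ℝ (Fin (n + 1))) : (inclusion p).hom (simplexIncl s t) = simplexMap p s t := by
  have h := homEquiv_symm_simplexIncl (inclusionSSet p) s
  exact congrArg (fun φ : C(stdSimplex ℝ (Fin (n + 1)), A.complement) => φ t) h

/-- The choice of points between two given ones. -/
def PointChoice.between (p p' : A.PointChoice) (s : unitInterval) : A.PointChoice where
  point x := p.point x + (s : ℝ) • (p'.point x - p.point x)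
  mem x := convexPiece_segment (p.mem x) (p'.mem x) s.2.1 s.2.2
  equivariant k x := by
    rw [p.equivariant, p'.equivariant, add_sub_add_right_eq_sub]
    abel

/-- The maps into the complement obtained from two choices of points are homotopic: the points
allowed for a pair form a convex set, so the segments between the choices are choices as well. -/
theorem inclusion_homotopic (p p' : A.PointChoice) :
    ContinuousMap.Homotopic (inclusion p).hom (inclusion p').hom := by
  let H : SimplexHomotopy A.SalQuot A.complement :=
    { map := fun s t r => simplexMap (p.between p' r) s t
      continuous := fun s => by
        refine Continuous.subtype_mk (toTorus_continuous.comp ?_) _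
        unfold simplexPoint PointChoice.between
        refine continuous_finsetSum _ fun i _ => ?_
        refine ((continuous_apply i).comp (continuous_subtype_val.comp continuous_fst)).smul ?_
        exact continuous_const.add
          ((continuous_subtype_val.comp continuous_snd).smul continuous_const)
      natural := fun θ s t r => simplexMap_natural (p.between p' r) (SimplexCategory.mkHom θ) s t }
  refine H.homotopic (fun s t => ?_) fun s t => ?_
  · rw [inclusion_simplexIncl]
    change simplexMap p s t = simplexMap (p.between p' 0) s t
    have : p.between p' 0 = p := by
      cases p
      simp [PointChoice.between]
    rw [this]
  · rw [inclusion_simplexIncl]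
    change simplexMap p' s t = simplexMap (p.between p' 1) s t
    have : p.between p' 1 = p' := by
      cases p'
      simp [PointChoice.between]
    rw [this]

/-- The choice of points transported by a translation. -/
def PointChoice.translate (p : A.PointChoice) (v : A.periods) : A.PointChoice where
  point x := p.point (-v +ᵥ x) + (v.1, 0)
  mem x := by
    have := convexPiece_vadd v (p.mem (-v +ᵥ x))
    rwa [vadd_neg_vadd] at this
  equivariant k x := by
    rw [period_comm_sal, p.equivariant]
    abel

theorem PointChoice.translate_eq {p : A.PointChoice} {v : A.periods}
    (h : p.IsEquivariantUnder v.1) : p.translate v = p := by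
  have : (p.translate v).point = p.point := funext fun x =>
    (h (-v +ᵥ x) x
      (congrArg Sal.face (vadd_neg_vadd v x).symm) (congrArg Sal.chamber (vadd_neg_vadd v x).symm)).symm
  cases p
  simp only [PointChoice.translate] at this ⊢
  congr 1

/-- Translating a simplex translates its image in the universal covering, up to an element of the
lattice that relates the chosen representatives of the last vertex. -/
theorem simplexPoint_functor (p : A.PointChoice) (v : A.periods) {n : ℕ}
    (s : ComposableArrows A.SalQuot n) (t : stdSimplex ℝ (Fin (n + 1))) :
    ∃ k : Fin d → ℤ, simplexPoint (p.translate v) (s ⋙ salFunctor v) t =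
      (v.1, 0) + simplexPoint p s t + (intVec k, 0) := by
  set k := OrbitCat.shift (Fin d → ℤ) (v +ᵥ (s.obj (Fin.last n)).rep) with hk
  have hchain : ∀ i, liftChain (s ⋙ salFunctor v) i = k +ᵥ (v +ᵥ liftChain s i) := by
    intro i
    unfold liftChain
    change (_ + (s.map _).1 - _ : Fin d → ℤ) +ᵥ (moveSal v (s.obj i)).rep = _
    unfold moveSal
    rw [← OrbitCat.shift_vadd, ← add_vadd, sub_add_cancel, add_vadd, ← period_comm_sal]
  have ht1 : ∑ i, t i = 1 := t.2.2
  refine ⟨k, ?_⟩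
  unfold simplexPoint
  simp only [hchain, PointChoice.equivariant]
  simp only [PointChoice.translate, neg_vadd_vadd, smul_add, Finset.sum_add_distrib,
    ← Finset.sum_smul, ht1, one_smul]
  abel

/-- Multiplication by `g` after the inclusion of a choice of points is the cellular map followed by
the inclusion of the translated choice. -/
theorem inclusion_translate (p : A.PointChoice) (v : A.periods) {g : Torus d} (hg : A.IsInvariant g)
    (hv : toTorus (v.1, 0) = g) : (mulComplement hg).comp (inclusion p).hom =
      (inclusion (p.translate v)).hom.comp (realize (salFunctor v)).hom := by
  refine realization_hom_ext fun s t => ?_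
  change mulComplement hg ((inclusion p).hom (simplexIncl s t)) =
    (inclusion (p.translate v)).hom (realize (salFunctor v) (simplexIncl s t))
  rw [realize_simplexIncl, inclusion_simplexIncl, inclusion_simplexIncl]
  apply Subtype.ext
  obtain ⟨k, hk⟩ := simplexPoint_functor p v s t
  change g * toTorus (simplexPoint p s t) = toTorus (simplexPoint _ _ t)
  rw [hk, toTorus_add_int, toTorus_add, hv]

end ToricArrangement

end

section

variable {d : ℕ}

namespace ToricArrangement

variable {A : ToricArrangement d}

/-! ### Layers as orbits of subtori -/

theorem hypertorus_isClosed (p : (Fin d → ℤ) × Circle) : IsClosed (hypertorus p) := by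
  refine isClosed_eq ?_ continuous_const
  exact Units.continuous_val.comp (continuous_finsetProd _ fun i _ => (continuous_apply i).zpow _)

/-- Near a point of the torus, the covering map has a section through any given lift. -/
theorem eventually_section (z : Vec d × Vec d) {U : Set (Vec d × Vec d)} (hU : U ∈ 𝓝 0) :
    ∀ᶠ t in 𝓝 (toTorus z), ∃ u ∈ U, t = toTorus z * toTorus u := by
  let ζ : Torus d → Fin d → ℂ := fun t j =>
    Complex.log ((t j : ℂ) / (toTorus z j : ℂ)) / (2 * Real.pi * Complex.I)
  let s : Torus d → Vec d × Vec d := fun t => (fun j => (ζ t j).re, fun j => (ζ t j).im)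
  have hζ : ContinuousAt ζ (toTorus z) := by
    refine continuousAt_pi.mpr fun j => ?_
    have h1 : ContinuousAt (fun t : Torus d => (t j : ℂ) / (toTorus z j : ℂ)) (toTorus z) :=
      ((Units.continuous_val.comp (continuous_apply j)).div_const _).continuousAt
    have h2 : (toTorus z j : ℂ) / (toTorus z j : ℂ) ∈ Complex.slitPlane := by
      rw [div_self (toTorus z j).ne_zero]
      exact Complex.one_mem_slitPlane
    exact (h1.clog h2).div_const _
  have hs : ContinuousAt s (toTorus z) := by
    refine ContinuousAt.prodMk ?_ ?_
    · exact continuousAt_pi.mpr fun j =>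
        Complex.continuous_re.continuousAt.comp (continuousAt_pi.mp hζ j)
    · exact continuousAt_pi.mpr fun j =>
        Complex.continuous_im.continuousAt.comp (continuousAt_pi.mp hζ j)
  have hs0 : s (toTorus z) = 0 := by
    have : ∀ j, ζ (toTorus z) j = 0 := fun j => by
      simp only [ζ]
      rw [div_self (toTorus z j).ne_zero, Complex.log_one, zero_div]
    refine Prod.ext (funext fun j => ?_) (funext fun j => ?_)
    · simp [s, this]
    · simp [s, this]
  filter_upwards [hs.preimage_mem_nhds (hs0.symm ▸ hU)] with t ht
  refine ⟨s t, ht, ?_⟩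
  funext j
  apply Units.ext
  change (t j : ℂ) = (toTorus z j : ℂ) *
    Complex.exp (2 * Real.pi * Complex.I * (((ζ t j).re : ℂ) + ((ζ t j).im : ℂ) * Complex.I))
  rw [Complex.re_add_im, mul_div_cancel₀ _ Complex.two_pi_I_ne_zero, Complex.exp_log,
    mul_div_cancel₀ _ (toTorus z j).ne_zero]
  exact div_ne_zero (t j).ne_zero (toTorus z j).ne_zero

/-- A layer is an orbit of the complexification of its direction. -/
theorem mem_layer_iff {L : Set (Torus d)} (hL : L ∈ A.layers) {t t' : Torus d} (ht : t ∈ L) :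
    t' ∈ L ↔ ∃ u ∈ A.flat L, ∃ v ∈ A.flat L, t' = t * toTorus (u, v) := by
  obtain ⟨B, hB, t₀, ht₀, rfl⟩ := hL
  set L := connectedComponentIn (⋂₀ B) t₀ with hLdef
  have hLB : L ⊆ ⋂₀ B := connectedComponentIn_subset _ _
  have hflat : ∀ u, u ∈ A.flat L ↔ ∀ p ∈ A.data, L ⊆ hypertorus p → charForm p.1 u = 0 := by
    intro u
    simp [flat, Submodule.mem_iInf]
  constructor
  · intro ht'
    -- translations by small vectors are the only way to move inside the intersection of `B`
    have hW : ∀ p ∈ A.data, ∀ᶠ u in 𝓝 (0 : Vec d × Vec d), |charForm p.1 u.1| < 1 := by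
      intro p _
      have hc : Continuous fun u : Vec d × Vec d => |charForm p.1 u.1| :=
        ((LinearMap.continuous_of_finiteDimensional _).comp continuous_fst).abs
      have h0 := hc.tendsto 0
      simp only [Prod.fst_zero, map_zero, abs_zero] at h0
      exact h0.eventually (gt_mem_nhds one_pos)
    have hW' := (A.data.eventually_all).mpr hW
    let P : Torus d → Torus d → Prop := fun t t' => ∃ u v : Vec d,
      (∀ p ∈ A.data, hypertorus p ∈ B → charForm p.1 u = 0 ∧ charForm p.1 v = 0) ∧
        t' = t * toTorus (u, v)
    have hP : P t t' := by
      refine isPreconnected_connectedComponentIn.induction₂ P ?_ ?_ ?_ ht ht'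
      · intro x hx
        obtain ⟨z, rfl⟩ := toTorus_surjective x
        filter_upwards [(eventually_section z hW').filter_mono nhdsWithin_le_nhds,
          self_mem_nhdsWithin] with y hy hyL
        obtain ⟨⟨u, v⟩, huv, rfl⟩ := hy
        refine ⟨u, v, fun p hp hpB => ?_, rfl⟩
        have h1 := mem_hypertorus_iff.mp (hLB hx _ hpB)
        rw [← toTorus_add] at hyL
        have h2 := mem_hypertorus_iff.mp (hLB hyL _ hpB)
        simp only [Prod.fst_add, Prod.snd_add, map_add] at h2
        refine ⟨?_, by linarith [h1.2, h2.2]⟩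
        obtain ⟨n, hn⟩ := circle_exp_eq (h2.1.trans h1.1.symm)
        have h3 : charForm p.1 u = n := by linarith
        have h4 := huv p hp
        simp only [h3] at h4 ⊢
        have h5 : |n| < 1 := by exact_mod_cast h4
        exact_mod_cast Int.abs_lt_one_iff.mp h5
      · rintro x _ _ - - - ⟨u, v, h, rfl⟩ ⟨u', v', h', rfl⟩
        refine ⟨u + u', v + v', fun p hp hpB => ?_, ?_⟩
        · rw [map_add, map_add, (h p hp hpB).1, (h p hp hpB).2, (h' p hp hpB).1, (h' p hp hpB).2]
          simp
        · rw [mul_assoc, ← toTorus_add]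
          rfl
      · rintro x _ - - ⟨u, v, h, rfl⟩
        refine ⟨-u, -v, fun p hp hpB => ?_, ?_⟩
        · rw [map_neg, map_neg, (h p hp hpB).1, (h p hp hpB).2]
          simp
        · have : ((-u, -v) : Vec d × Vec d) = -(u, v) := rfl
          rw [this, toTorus_neg, mul_inv_cancel_right]
    obtain ⟨u, v, h, rfl⟩ := hP
    have hsub : ∀ u : Vec d, (∀ p ∈ A.data, hypertorus p ∈ B → charForm p.1 u = 0) →
        u ∈ A.flat L := by
      intro u hu
      refine (hflat u).mpr fun p hp hLp => ?_
      obtain ⟨z, rfl⟩ := toTorus_surjective t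
      let γ : ℝ → Torus d := fun s => toTorus (z + (s • u, 0))
      have hγ : Continuous γ := toTorus_continuous.comp (by fun_prop)
      have hz0 : z + ((0 : ℝ) • u, 0) = z := by
        rw [zero_smul]
        exact add_zero z
      have hmem : ∀ s, γ s ∈ ⋂₀ B := by
        intro s H hH
        obtain ⟨p, hp, rfl⟩ := hB hH
        have := mem_hypertorus_iff.mp (hLB ht _ hH)
        refine mem_hypertorus_iff.mpr ?_
        simpa [hu p hp hH] using this
      have hrange : Set.range γ ⊆ L := by
        rw [hLdef, connectedComponentIn_eq ht]
        exact (isPreconnected_range hγ).subset_connectedComponentIn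
          ⟨0, congrArg toTorus hz0⟩ (by rintro _ ⟨s, rfl⟩; exact hmem s)
      refine eq_zero_of_forall_int fun s => ?_
      have h1 := (mem_hypertorus_iff.mp (hLp (hrange ⟨s, rfl⟩))).1
      have h2 := (mem_hypertorus_iff.mp (hLp ht)).1
      obtain ⟨n, hn⟩ := circle_exp_eq (h1.trans h2.symm)
      simp only [Prod.fst_add, map_add, map_smul, smul_eq_mul] at hn
      exact ⟨n, by linarith⟩
    exact ⟨u, hsub u fun p hp hpB => (h p hp hpB).1, v, hsub v fun p hp hpB => (h p hp hpB).2, rfl⟩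
  · rintro ⟨u, hu, v, hv, rfl⟩
    obtain ⟨z, rfl⟩ := toTorus_surjective t
    let γ : ℝ → Torus d := fun s => toTorus (z + (s • u, s • v))
    have hγ : Continuous γ := toTorus_continuous.comp (by fun_prop)
    have hz0 : z + ((0 : ℝ) • u, (0 : ℝ) • v) = z := by
      rw [zero_smul, zero_smul]
      exact add_zero z
    have hmem : ∀ s, γ s ∈ ⋂₀ B := by
      intro s H hH
      obtain ⟨p, hp, rfl⟩ := hB hH
      have hLp : L ⊆ hypertorus p := fun x hx => hLB hx _ hH
      have := mem_hypertorus_iff.mp (hLp ht)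
      refine mem_hypertorus_iff.mpr ?_
      simpa [(hflat u).mp hu p hp hLp, (hflat v).mp hv p hp hLp] using this
    have hrange : Set.range γ ⊆ L := by
      rw [hLdef, connectedComponentIn_eq ht]
      exact (isPreconnected_range hγ).subset_connectedComponentIn
        ⟨0, congrArg toTorus hz0⟩ (by rintro _ ⟨s, rfl⟩; exact hmem s)
    have h1 : γ 1 = toTorus z * toTorus (u, v) := by
      simp only [γ, one_smul, toTorus_add]
    exact h1 ▸ hrange ⟨1, rfl⟩

theorem layer_isClosed {L : Set (Torus d)} (hL : L ∈ A.layers) : IsClosed L := by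
  obtain ⟨B, hB, t₀, ht₀, rfl⟩ := hL
  have hS : IsClosed (⋂₀ B) := isClosed_sInter fun H hH => by
    obtain ⟨p, -, rfl⟩ := hB hH
    exact hypertorus_isClosed p
  refine closure_subset_iff_isClosed.mp ?_
  exact isPreconnected_connectedComponentIn.closure.subset_connectedComponentIn
    (subset_closure (mem_connectedComponentIn ht₀))
    (closure_minimal (connectedComponentIn_subset _ _) hS)

/-- The real points of a layer, in the universal covering. -/
def realLayer (L : Set (Torus d)) : Set (Vec d) := {x | toTorus (x, 0) ∈ L}

theorem mem_flat_iff {L : Set (Torus d)} {u : Vec d} :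
    u ∈ A.flat L ↔ ∀ p ∈ A.data, L ⊆ hypertorus p → charForm p.1 u = 0 := by
  simp [flat, Submodule.mem_iInf]

theorem realLayer_isClosed {L : Set (Torus d)} (hL : L ∈ A.layers) : IsClosed (realLayer L) :=
  (layer_isClosed hL).preimage (toTorus_continuous.comp (by fun_prop))

theorem realLayer_nonempty {L : Set (Torus d)} (hL : L ∈ A.layers) : (realLayer L).Nonempty := by
  obtain ⟨t, ht⟩ : L.Nonempty := by
    obtain ⟨B, -, t, ht, rfl⟩ := hL
    exact ⟨t, mem_connectedComponentIn ht⟩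
  obtain ⟨⟨x, y⟩, rfl⟩ := toTorus_surjective t
  refine ⟨x, (mem_layer_iff hL ht).mpr ⟨0, zero_mem _, -y, mem_flat_iff.mpr fun p hp hLp => ?_, ?_⟩⟩
  · rw [map_neg, (mem_hypertorus_iff.mp (hLp ht)).2, neg_zero]
  · rw [← toTorus_add]
    simp

theorem realLayer_add {L : Set (Torus d)} (hL : L ∈ A.layers) {x u : Vec d} (hx : x ∈ realLayer L)
    (hu : u ∈ A.flat L) : x + u ∈ realLayer L := by
  refine (mem_layer_iff hL hx).mpr ⟨u, hu, 0, zero_mem _, ?_⟩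
  rw [← toTorus_add]
  simp

theorem realLayer_add_int {L : Set (Torus d)} {x : Vec d} (k : Fin d → ℤ) :
    intVec k + x ∈ realLayer L ↔ x ∈ realLayer L := by
  have := toTorus_add_int (x, 0) k
  rw [Prod.mk_add_mk, add_zero, add_comm] at this
  change toTorus _ ∈ L ↔ toTorus _ ∈ L
  rw [this]

theorem realLayer_sign {L : Set (Torus d)} (hL : L ∈ A.layers) {x y : Vec d} (hx : x ∈ realLayer L)
    (h : ∀ f ∈ A.lift, SignType.sign (f y) = SignType.sign (f x)) : y ∈ realLayer L := by
  have : y - x ∈ A.flat L := mem_flat_iff.mpr fun p hp hLp => by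
    have h1 := (mem_hypertorus_iff.mp (hLp hx)).1
    have h2 := h _ (affForm_mem_lift hp h1)
    rw [affForm_apply, affForm_apply, sub_self, sign_zero, sign_eq_zero_iff] at h2
    rw [map_sub, h2]
  rw [← add_sub_cancel x y]
  exact realLayer_add hL hx this

/-- A symmetry of the torus preserving a layer is covered by a translation along the layer. -/
theorem exists_int_sub_mem_flat {L : Set (Torus d)} (hL : L ∈ A.layers) {v : Vec d}
    (hv : toTorus (v, 0) • L = L) : ∃ k, intVec k + v ∈ A.flat L := by
  obtain ⟨x, hx⟩ := realLayer_nonempty hL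
  have h1 : toTorus (x, 0) * toTorus (v, 0) ∈ L := by
    rw [mul_comm, ← hv]
    exact Set.smul_mem_smul_set hx
  obtain ⟨u, hu, u', -, he⟩ := (mem_layer_iff hL hx).mp h1
  obtain ⟨k, hk⟩ := toTorus_eq_iff.mp (mul_left_cancel he)
  refine ⟨-k, ?_⟩
  have h2 : v = u + intVec k := congrArg Prod.fst hk
  have h3 : intVec (-k) = -intVec k := by ext i; simp [intVec]
  rw [h2, h3]
  simpa using hu

theorem toSet_subset_iff {L : Set (Torus d)} {F : A.FaceCat} :
    F.toSet ⊆ L ↔ F.rep.carrier ⊆ realLayer L := by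
  unfold FaceCat.toSet
  rw [Set.image_subset_iff]
  rfl

/-! ### Local finiteness of the lifted arrangement -/

/-- Only finitely many hyperplanes of the lifted arrangement come close to a bounded set. -/
theorem finite_near (R : ℝ) :
    {f | f ∈ A.lift ∧ ∃ x : Vec d, ‖x‖ ≤ R ∧ |f x| ≤ R}.Finite := by
  have hfin : ∀ p ∈ A.data, {f | ∃ c : ℝ, Circle.exp (2 * Real.pi * c) = p.2 ∧ f = affForm p.1 c ∧
      ∃ x : Vec d, ‖x‖ ≤ R ∧ |f x| ≤ R}.Finite := by
    intro p _
    obtain ⟨c₀, hc₀⟩ := exists_phase p.2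
    obtain ⟨M, hM⟩ : ∃ M : ℝ, ∀ x : Vec d, ‖x‖ ≤ R → |charForm p.1 x| ≤ M := by
      obtain ⟨M, hM⟩ := (isCompact_closedBall (0 : Vec d) R).exists_bound_of_continuousOn
        (LinearMap.continuous_of_finiteDimensional (charForm p.1)).continuousOn
      exact ⟨M, fun x hx => hM x (mem_closedBall_zero_iff.mpr hx)⟩
    refine ((Set.finite_Icc (⌊-(|c₀| + M + R)⌋) ⌈|c₀| + M + R⌉).image
      fun n : ℤ => affForm p.1 (c₀ + n)).subset ?_
    rintro _ ⟨c, hc, rfl, x, hx, hfx⟩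
    obtain ⟨n, rfl⟩ := circle_exp_eq (hc.trans hc₀.symm)
    refine ⟨n, ?_, rfl⟩
    rw [affForm_apply] at hfx
    have h1 := abs_le.mp hfx
    have h2 := abs_le.mp (hM x hx)
    have h3 := neg_abs_le c₀
    have h4 := le_abs_self c₀
    constructor
    · have : (⌊-(|c₀| + M + R)⌋ : ℝ) ≤ n := (Int.floor_le _).trans (by linarith)
      exact_mod_cast this
    · have : (n : ℝ) ≤ ⌈|c₀| + M + R⌉ := le_trans (by linarith) (Int.le_ceil _)
      exact_mod_cast this
  refine (Set.Finite.biUnion A.data.finite_toSet hfin).subset ?_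
  rintro f ⟨⟨p, hp, c, hc, rfl⟩, x, hx, hfx⟩
  exact Set.mem_biUnion hp ⟨c, hc, rfl, x, hx, hfx⟩

/-- Moving a little does not change the nonzero signs. -/
theorem eventually_sign (x : Vec d) : ∀ᶠ y in 𝓝 x, ∀ f ∈ A.lift, f x ≠ 0 →
    SignType.sign (f y) = SignType.sign (f x) := by
  have key : ∀ p ∈ A.data, ∀ᶠ y in 𝓝 x, ∀ c : ℝ, Circle.exp (2 * Real.pi * c) = p.2 →
      affForm p.1 c x ≠ 0 →
      SignType.sign (affForm p.1 c y) = SignType.sign (affForm p.1 c x) := by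
    intro p _
    obtain ⟨c₀, hc₀⟩ := exists_phase p.2
    obtain ⟨δ, hδ, hgap⟩ := exists_gap (charForm p.1 x - c₀)
    have hc : Continuous fun y : Vec d => |charForm p.1 (y - x)| :=
      ((LinearMap.continuous_of_finiteDimensional _).comp (continuous_id.sub continuous_const)).abs
    have hlim := hc.tendsto x
    simp only [sub_self, map_zero, abs_zero] at hlim
    filter_upwards [hlim.eventually (gt_mem_nhds hδ)] with y hy c hc hne
    obtain ⟨n, rfl⟩ := circle_exp_eq (hc.trans hc₀.symm)
    have : affForm p.1 (c₀ + n) y = affForm p.1 (c₀ + n) x + charForm p.1 (y - x) := by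
      rw [affForm_apply, affForm_apply, map_sub]
      ring
    rw [this]
    apply sign_eq_of_abs_lt
    refine hy.trans_le ?_
    rw [affForm_apply] at hne ⊢
    rw [← sub_sub] at hne ⊢
    exact hgap n hne
  filter_upwards [(A.data.eventually_all).mpr key] with y hy
  rintro f ⟨p, hp, c, hc, rfl⟩ hne
  exact hy p hp c hc hne

end ToricArrangement

end

section

variable {d : ℕ}

/-! ### Signs of positive combinations -/

theorem sign_mul_eq {a b : ℝ} (ha : 0 < a) : SignType.sign (a * b) = SignType.sign b := by
  rw [sign_mul, sign_pos ha, one_mul]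

/-- A positive combination of numbers whose nonzero members have the same sign has this sign, unless
all the numbers are zero. -/
theorem sign_sum_eq {ι : Type*} {S : Finset ι} {t b : ι → ℝ} (ht : ∀ i ∈ S, 0 ≤ t i) {s : SignType}
    (hb : ∀ i ∈ S, t i ≠ 0 → b i ≠ 0 → SignType.sign (b i) = s) {j : ι} (hj : j ∈ S) (htj : t j ≠ 0)
    (hbj : b j ≠ 0) : SignType.sign (∑ i ∈ S, t i * b i) = s := by
  have hsj := hb j hj htj hbj
  have htj' : 0 < t j := lt_of_le_of_ne (ht j hj) (Ne.symm htj)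
  rcases lt_or_gt_of_ne hbj with h | h
  · rw [sign_neg h] at hsj
    subst hsj
    rw [sign_eq_neg_one_iff]
    refine Finset.sum_neg' (fun i hi => ?_) ⟨j, hj, mul_neg_of_pos_of_neg htj' h⟩
    by_cases h1 : t i = 0
    · rw [h1, zero_mul]
    by_cases h2 : b i = 0
    · rw [h2, mul_zero]
    exact mul_nonpos_of_nonneg_of_nonpos (ht i hi) (sign_eq_neg_one_iff.mp (hb i hi h1 h2)).le
  · rw [sign_pos h] at hsj
    subst hsj
    rw [sign_eq_one_iff]
    refine Finset.sum_pos' (fun i hi => ?_) ⟨j, hj, mul_pos htj' h⟩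
    by_cases h1 : t i = 0
    · rw [h1, zero_mul]
    by_cases h2 : b i = 0
    · rw [h2, mul_zero]
    exact mul_nonneg (ht i hi) (sign_eq_one_iff.mp (hb i hi h1 h2)).le

theorem eq_zero_of_sum_eq_zero {ι : Type*} {S : Finset ι} {t b : ι → ℝ} (ht : ∀ i ∈ S, 0 ≤ t i)
    {s : SignType} (hb : ∀ i ∈ S, t i ≠ 0 → b i ≠ 0 → SignType.sign (b i) = s)
    (h0 : ∑ i ∈ S, t i * b i = 0) {j : ι} (hj : j ∈ S) (htj : t j ≠ 0) : b j = 0 := by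
  by_contra hbj
  have h1 := sign_sum_eq ht hb hj htj hbj
  rw [h0, sign_zero, ← hb j hj htj hbj, eq_comm, sign_eq_zero_iff] at h1
  exact hbj h1

theorem exists_ne_zero_of_sum_ne_zero {ι : Type*} {S : Finset ι} {t b : ι → ℝ}
    (h0 : ∑ i ∈ S, t i * b i ≠ 0) : ∃ j ∈ S, t j ≠ 0 ∧ b j ≠ 0 := by
  obtain ⟨j, hj, h⟩ := Finset.exists_ne_zero_of_sum_ne_zero h0
  exact ⟨j, hj, left_ne_zero_of_mul h, right_ne_zero_of_mul h⟩

theorem sign_sum_eq' {ι : Type*} {S : Finset ι} {t b : ι → ℝ} (ht : ∀ i ∈ S, 0 ≤ t i) {s : SignType}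
    (hb : ∀ i ∈ S, t i ≠ 0 → SignType.sign (b i) = s) {j : ι} (hj : j ∈ S) (htj : t j ≠ 0) :
    SignType.sign (∑ i ∈ S, t i * b i) = s := by
  by_cases hbj : b j = 0
  · have hs := hb j hj htj
    rw [hbj, sign_zero] at hs
    subst hs
    rw [Finset.sum_eq_zero, sign_zero]
    intro i hi
    by_cases h1 : t i = 0
    · rw [h1, zero_mul]
    · rw [sign_eq_zero_iff.mp (hb i hi h1), mul_zero]
  · exact sign_sum_eq ht (fun i hi h _ => hb i hi h) hj htj hbj

theorem form_sum {ι : Type*} {S : Finset ι} {t : ι → ℝ} (ht : ∑ i ∈ S, t i = 1) (f : Form d)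
    (x : ι → Vec d) : f (∑ i ∈ S, t i • x i) = ∑ i ∈ S, t i * f (x i) := by
  have hl : ∀ v, f v = f.linear v + f 0 := fun v => by
    have := form_add f 0 v
    rw [zero_add] at this
    linarith
  rw [hl, map_sum]
  have : ∑ i ∈ S, t i * f (x i) = ∑ i ∈ S, (t i * f.linear (x i) + t i * f 0) :=
    Finset.sum_congr rfl fun i _ => by rw [hl (x i)]; ring
  rw [this, Finset.sum_add_distrib, ← Finset.sum_mul, ht, one_mul]
  simp

theorem linear_sum {ι : Type*} {S : Finset ι} {t : ι → ℝ} (f : Form d)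
    (x : ι → Vec d) : f.linear (∑ i ∈ S, t i • x i) = ∑ i ∈ S, t i * f.linear (x i) := by
  rw [map_sum]
  simp

namespace ToricArrangement

variable {A : ToricArrangement d}

/-! ### Strata of a layer -/

variable (A) in
/-- The point `x` lies in the closure of the face of the lifted arrangement containing `y`. -/
def Below (x y : Vec d) : Prop := ∀ f ∈ A.lift, f x ≠ 0 → SignType.sign (f y) = SignType.sign (f x)

theorem Below.refl (x : Vec d) : A.Below x x := fun _ _ _ => rfl

theorem Below.ne_zero {x y : Vec d} (h : A.Below x y) {f : Form d} (hf : f ∈ A.lift)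
    (hx : f x ≠ 0) : f y ≠ 0 := fun hy => hx ((sign_zero_iff (h f hf hx)).mp hy)

theorem Below.eq_zero {x y : Vec d} (h : A.Below x y) {f : Form d} (hf : f ∈ A.lift)
    (hy : f y = 0) : f x = 0 := by
  by_contra hx
  exact h.ne_zero hf hx hy

theorem Below.trans {x y z : Vec d} (h : A.Below x y) (h' : A.Below y z) : A.Below x z :=
  fun f hf hx => (h' f hf (h.ne_zero hf hx)).trans (h f hf hx)

theorem Below.of_le {F G : Set (Vec d)} (hF : IsFace A.lift F) (hG : IsFace A.lift G)
    (h : F ⊆ closure G) {x y : Vec d} (hx : x ∈ F) (hy : y ∈ G) : A.Below x y :=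
  fun f hf hne => ((face_le_iff hF hG hx hy).mp h f hf hne).symm

theorem Below.le {F G : Set (Vec d)} (hF : IsFace A.lift F) (hG : IsFace A.lift G) {x y : Vec d}
    (hx : x ∈ F) (hy : y ∈ G) (h : A.Below x y) : F ⊆ closure G :=
  (face_le_iff hF hG hx hy).mpr fun f hf hne => (h f hf hne).symm

theorem Below.vadd {x y : Vec d} (h : A.Below x y) (w : A.periods) :
    A.Below (w.1 + x) (w.1 + y) := by
  intro f hf hne
  obtain ⟨f', hf', c, hc, h1, -⟩ := exists_translate w hf
  rw [h1] at hne ⊢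
  rw [h1, sign_mul, sign_mul, h f' hf' (right_ne_zero_of_mul hne)]

theorem below_isOpen (x : Vec d) : IsOpen {y | A.Below x y} := by
  refine isOpen_iff_mem_nhds.mpr fun y hy => ?_
  filter_upwards [eventually_sign (A := A) y] with y' hy'
  exact Below.trans hy hy'

/-- A point below a point of a layer differs from it by a vector along the layer. -/
theorem Below.sub_mem_flat {L : Set (Torus d)} {x y : Vec d}
    (h : A.Below x y) (hy : y ∈ realLayer L) : x - y ∈ A.flat L := by
  refine mem_flat_iff.mpr fun p hp hLp => ?_
  have h1 := h.eq_zero (affForm_mem_lift hp (mem_hypertorus_iff.mp (hLp hy)).1)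
    (by rw [affForm_apply]; exact sub_self _)
  rw [affForm_apply] at h1
  rw [map_sub]
  exact h1

variable (A) in
/-- A stratum of a layer `L`, relative to a direction `e₀`: a lifted face `F` in the layer, and a
pair `[G, C]` of the Salvetti poset with `F ≤ G` such that `C` lies in the direction `e₀` from each
hyperplane containing `G` but not parallel to `e₀`. -/
@[ext] structure Stratum (L : Set (Torus d)) (e₀ : Vec d) : Type where
  cell : A.Cell
  pair : Sal A.lift
  subset_layer : cell.carrier ⊆ realLayer L
  le : cell.carrier ⊆ closure pair.face
  sign_eq : ∀ f ∈ A.lift, (∀ x ∈ pair.face, f x = 0) → f.linear e₀ ≠ 0 → ∀ c ∈ pair.chamber,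
    SignType.sign (f c) = SignType.sign (f.linear e₀)

variable {L : Set (Torus d)} {e₀ : Vec d}

/-- The order corresponds to the direction of the morphisms of `∫ D`: it reverses the order of the
faces in the layer. -/
instance : PartialOrder (A.Stratum L e₀) where
  le i j := j.cell ≤ i.cell ∧ i.pair ≤ j.pair
  le_refl i := ⟨le_rfl, le_rfl⟩
  le_trans i j k h h' := ⟨h'.1.trans h.1, h.2.trans h'.2⟩
  le_antisymm i j h h' := Stratum.ext (h'.1.antisymm h.1) (h.2.antisymm h'.2)

variable (A) in
/-- The translations that preserve the arrangement and a layer. -/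
def layerPeriods (L : Set (Torus d)) : AddSubgroup A.periods where
  carrier := {w | ∀ x, w.1 + x ∈ realLayer L ↔ x ∈ realLayer L}
  zero_mem' x := by
    change 0 + x ∈ realLayer L ↔ _
    rw [zero_add]
  add_mem' {v w} hv hw x := by
    change v.1 + w.1 + x ∈ realLayer L ↔ _
    rw [add_assoc, hv, hw]
  neg_mem' {w} hw x := by
    rw [← hw]
    change w.1 + (-w.1 + x) ∈ _ ↔ _
    rw [add_neg_cancel_left]

/-- A translation in `ℤ^d` preserves every layer. -/
def intLayerPeriod (k : Fin d → ℤ) : A.layerPeriods L :=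
  ⟨intPeriod k, fun _ => realLayer_add_int k⟩

/-- A translation along a layer preserves the layer. -/
def flatPeriod (hL : L ∈ A.layers) (w : A.periods) (hw : w.1 ∈ A.flat L) : A.layerPeriods L :=
  ⟨w, fun x => by
    refine ⟨fun h => ?_, fun h => ?_⟩
    · have := realLayer_add hL h (neg_mem hw)
      rwa [add_comm w.1, add_neg_cancel_right] at this
    · rw [add_comm]
      exact realLayer_add hL h hw⟩

instance : AddAction (A.layerPeriods L) (A.Stratum L e₀) where
  vadd w i :=
    { cell := w.1 +ᵥ i.cell
      pair := w.1 +ᵥ i.pair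
      subset_layer := by
        rintro _ ⟨x, hx, rfl⟩
        exact (w.2 x).mpr (i.subset_layer hx)
      le := le_vadd i.le _
      sign_eq := by
        rintro f hf h0 hne _ ⟨c, hc, rfl⟩
        obtain ⟨f', hf', a, ha, h1, h2⟩ := exists_translate w.1 hf
        rw [h2] at hne ⊢
        change SignType.sign (f (w.1.1 + c)) = _
        rw [h1, sign_mul, sign_mul, i.sign_eq f' hf' (fun x hx => ?_) (right_ne_zero_of_mul hne) c hc]
        have h3 : f (w.1.1 + x) = 0 := h0 _ ⟨x, hx, rfl⟩
        rw [h1] at h3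
        exact (mul_eq_zero.mp h3).resolve_left ha }
  zero_vadd i := Stratum.ext (zero_vadd A.periods i.cell) (zero_vadd A.periods i.pair)
  add_vadd v w i := Stratum.ext (add_vadd v.1 w.1 i.cell) (add_vadd v.1 w.1 i.pair)

namespace Stratum

theorem vadd_mono (w : A.layerPeriods L) {i j : A.Stratum L e₀} (h : i ≤ j) : w +ᵥ i ≤ w +ᵥ j :=
  ⟨OrbitCat.vadd_le_vadd' w.1 h.1, OrbitCat.vadd_le_vadd' w.1 h.2⟩

theorem vadd_free (hA : A.IsEssential) (w : A.layerPeriods L) (i : A.Stratum L e₀)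
    (h : w +ᵥ i = i) : w = 0 :=
  Subtype.ext (hA.cell_period (congrArg Stratum.cell h))

/-- The order automorphism of the poset of strata given by a translation. -/
def translate (w : A.layerPeriods L) : A.Stratum L e₀ ≃o A.Stratum L e₀ where
  toFun i := w +ᵥ i
  invFun i := -w +ᵥ i
  left_inv i := neg_vadd_vadd w i
  right_inv i := vadd_neg_vadd w i
  map_rel_iff' {i j} := ⟨fun h => by
    have := vadd_mono (-w) h
    simpa using this, fun h => vadd_mono w h⟩

end Stratum

/-- The triples that determine a stratum: a point in the layer, a second point whose face contains
the first one in its closure, and a generic direction at the second point. -/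
structure Admissible (A : ToricArrangement d) (L : Set (Torus d)) (e₀ : Vec d)
    (z : Vec d × Vec d × Vec d) : Prop where
  mem : z.1 ∈ realLayer L
  below : A.Below z.1 z.2.1
  generic : ∀ f ∈ A.lift, f z.2.1 = 0 → f.linear z.2.2 ≠ 0
  sign_eq : ∀ f ∈ A.lift, f.linear e₀ ≠ 0 →
    SignType.sign (f.linear z.2.2) = SignType.sign (f.linear e₀)

/-- A point slightly moved in the direction `y` keeps its nonzero signs, and on the hyperplanes
containing it receives the signs of `y`. -/
theorem exists_push (x y : Vec d) : ∃ u : Vec d, ∀ f ∈ A.lift, SignType.sign (f u) =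
    if f x = 0 then SignType.sign (f.linear y) else SignType.sign (f x) := by
  obtain ⟨ε, hε, h0⟩ := ((locFin_lift (A := A) x y).and self_mem_nhdsWithin).exists
  refine ⟨x + ε • y, fun f hf => ?_⟩
  split_ifs with h1
  · rw [form_add, h1, zero_add, map_smul, smul_eq_mul]
    exact sign_mul_eq h0
  · exact hε f hf h1

/-- The stratum of an admissible triple `(a, x, y)`: the faces containing `a` and `x`, and the
chamber seen from `x` in the direction `y`. -/
def Admissible.stratum (hL : L ∈ A.layers) {z : Vec d × Vec d × Vec d} (hz : Admissible A L e₀ z) :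
    A.Stratum L e₀ where
  cell := ⟨signCell A.lift z.1, z.1, rfl⟩
  pair :=
    { face := signCell A.lift z.2.1
      chamber := signCell A.lift (exists_push (A := A) z.2.1 z.2.2).choose
      isFace := ⟨_, rfl⟩
      isChamber := by
        have h := (exists_push (A := A) z.2.1 z.2.2).choose_spec
        refine ⟨⟨_, rfl⟩, fun f hf x hx h0 => ?_⟩
        have h1 := hx f hf
        rw [h f hf, h0, sign_zero] at h1
        split_ifs at h1 with h2
        · exact hz.generic f hf h2 (sign_eq_zero_iff.mp h1.symm)
        · exact h2 (sign_eq_zero_iff.mp h1.symm)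
      le := Below.le ⟨_, rfl⟩ ⟨_, rfl⟩ (mem_signCell_self _) (mem_signCell_self _) fun f hf hne => by
        rw [(exists_push (A := A) z.2.1 z.2.2).choose_spec f hf, if_neg hne] }
  subset_layer x hx := realLayer_sign hL hz.mem hx
  le := Below.le ⟨_, rfl⟩ ⟨_, rfl⟩ (mem_signCell_self _) (mem_signCell_self _) hz.below
  sign_eq f hf h0 hne c hc := by
    rw [hc f hf, (exists_push (A := A) z.2.1 z.2.2).choose_spec f hf,
      if_pos (h0 _ (mem_signCell_self _)), hz.sign_eq f hf hne]

/-- The sign vectors of the points of the chamber of the stratum of an admissible triple. -/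
theorem Admissible.sign_chamber (hL : L ∈ A.layers) {z : Vec d × Vec d × Vec d}
    (hz : Admissible A L e₀ z) {c : Vec d} (hc : c ∈ (hz.stratum hL).pair.chamber) {f : Form d}
    (hf : f ∈ A.lift) : SignType.sign (f c) =
      if f z.2.1 = 0 then SignType.sign (f.linear z.2.2) else SignType.sign (f z.2.1) := by
  rw [hc f hf, (exists_push (A := A) z.2.1 z.2.2).choose_spec f hf]

theorem Admissible.mem_cell (hL : L ∈ A.layers) {z : Vec d × Vec d × Vec d}
    (hz : Admissible A L e₀ z) : z.1 ∈ (hz.stratum hL).cell.carrier := mem_signCell_self _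

theorem Admissible.mem_face (hL : L ∈ A.layers) {z : Vec d × Vec d × Vec d}
    (hz : Admissible A L e₀ z) : z.2.1 ∈ (hz.stratum hL).pair.face := mem_signCell_self _

/-- A criterion for a stratum to lie below the one of an admissible triple. -/
theorem Admissible.le_stratum (hL : L ∈ A.layers) {z : Vec d × Vec d × Vec d}
    (hz : Admissible A L e₀ z) {i : A.Stratum L e₀} {a x : Vec d} (ha : a ∈ i.cell.carrier)
    (hx : x ∈ i.pair.face) (h1 : A.Below z.1 a) (h2 : A.Below z.2.1 x)
    (h3 : ∀ f ∈ A.lift, f x = 0 → ∀ c ∈ i.pair.chamber,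
      SignType.sign (f c) = SignType.sign (f.linear z.2.2)) : i ≤ hz.stratum hL := by
  refine ⟨Below.le (hz.stratum hL).cell.isFace i.cell.isFace (hz.mem_cell hL) ha h1,
    Below.le (hz.stratum hL).pair.isFace i.pair.isFace (hz.mem_face hL) hx h2, ?_⟩
  intro f hf h0 c hc c' hc'
  rw [h3 f hf (h0 x hx) c hc, hz.sign_chamber hL hc' hf, if_pos (h2.eq_zero hf (h0 x hx))]

theorem Admissible.stratum_le_stratum (hL : L ∈ A.layers) {z w : Vec d × Vec d × Vec d}
    (hz : Admissible A L e₀ z) (hw : Admissible A L e₀ w) (h1 : A.Below z.1 w.1)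
    (h2 : A.Below z.2.1 w.2.1) (h3 : ∀ f ∈ A.lift, f w.2.1 = 0 →
      SignType.sign (f.linear w.2.2) = SignType.sign (f.linear z.2.2)) :
    hw.stratum hL ≤ hz.stratum hL :=
  hz.le_stratum hL (hw.mem_cell hL) (hw.mem_face hL) h1 h2 fun f hf h0 c hc => by
    rw [hw.sign_chamber hL hc hf, if_pos h0, h3 f hf h0]

theorem Admissible.vadd {z : Vec d × Vec d × Vec d} (hz : Admissible A L e₀ z)
    (w : A.layerPeriods L) : Admissible A L e₀ (z + (w.1.1, w.1.1, 0)) where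
  mem := by
    have := (w.2 z.1).mpr hz.mem
    rwa [add_comm] at this
  below := by
    have := hz.below.vadd w.1
    rwa [add_comm, add_comm w.1.1] at this
  generic f hf h0 := by
    obtain ⟨f', hf', a, ha, h1, h2⟩ := exists_translate w.1 hf
    change f (z.2.1 + w.1.1) = 0 at h0
    change f.linear (z.2.2 + 0) ≠ 0
    rw [add_comm, h1] at h0
    rw [add_zero, h2]
    exact mul_ne_zero ha (hz.generic f' hf' ((mul_eq_zero.mp h0).resolve_left ha))
  sign_eq f hf hne := by
    change SignType.sign (f.linear (z.2.2 + 0)) = _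
    rw [add_zero]
    exact hz.sign_eq f hf hne

theorem Admissible.stratum_vadd (hL : L ∈ A.layers) {z : Vec d × Vec d × Vec d}
    (hz : Admissible A L e₀ z) (w : A.layerPeriods L) :
    (hz.vadd w).stratum hL = w +ᵥ hz.stratum hL := by
  refine le_antisymm ?_ ?_
  swap
  · refine (hz.vadd w).le_stratum hL (i := w +ᵥ hz.stratum hL) (a := w.1.1 + z.1)
      (x := w.1.1 + z.2.1) ⟨_, hz.mem_cell hL, rfl⟩ ⟨_, hz.mem_face hL, rfl⟩ ?_ ?_ ?_
    · rw [add_comm]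
      exact Below.refl _
    · rw [add_comm]
      exact Below.refl _
    · rintro f hf h0 _ ⟨c, hc, rfl⟩
      obtain ⟨f', hf', a, ha, h1, h2⟩ := exists_translate w.1 hf
      rw [h1] at h0
      change SignType.sign (f (w.1.1 + c)) = SignType.sign (f.linear (z.2.2 + 0))
      rw [add_zero, h1, h2, sign_mul, sign_mul, hz.sign_chamber hL hc hf',
        if_pos ((mul_eq_zero.mp h0).resolve_left ha)]
  · have key : -w +ᵥ (hz.vadd w).stratum hL ≤ hz.stratum hL := by
      refine hz.le_stratum hL (i := -w +ᵥ (hz.vadd w).stratum hL)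
        (a := -w.1.1 + (z.1 + w.1.1)) (x := -w.1.1 + (z.2.1 + w.1.1))
        ⟨_, (hz.vadd w).mem_cell hL, rfl⟩ ⟨_, (hz.vadd w).mem_face hL, rfl⟩ ?_ ?_ ?_
      · rw [add_comm z.1, neg_add_cancel_left]
        exact Below.refl _
      · rw [add_comm z.2.1, neg_add_cancel_left]
        exact Below.refl _
      · rintro f hf h0 _ ⟨c, hc, rfl⟩
        obtain ⟨f', hf', a, ha, h1, h2⟩ := exists_translate (-w.1) hf
        have h1' : ∀ x, f (-w.1.1 + x) = a * f' x := h1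
        rw [h1'] at h0
        change SignType.sign (f (-w.1.1 + c)) = SignType.sign (f.linear z.2.2)
        have h4 : f' (z + (w.1.1, w.1.1, 0)).2.1 = 0 := (mul_eq_zero.mp h0).resolve_left ha
        rw [h1', h2, sign_mul, sign_mul, (hz.vadd w).sign_chamber hL hc hf', if_pos h4]
        change _ * SignType.sign (f'.linear (z.2.2 + 0)) = _
        rw [add_zero]
    have := Stratum.vadd_mono w key
    rwa [vadd_neg_vadd] at this

end ToricArrangement

end

section

variable {d : ℕ}

/-! ### Bump functions of open sets -/

/-- A continuous function with values in `[0, 1]` that is positive exactly on a given open set. -/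
def openBump {E : Type*} [PseudoEMetricSpace E] (U : Set E) (z : E) : ℝ :=
  (min 1 (Metric.infEDist z Uᶜ)).toReal

section OpenBump

variable {E : Type*} [PseudoEMetricSpace E] {U : Set E}

theorem openBump_continuous : Continuous (openBump U) := by
  refine ENNReal.continuousOn_toReal.comp_continuous
    (continuous_const.min Metric.continuous_infEDist) fun z => ?_
  exact ne_top_of_le_ne_top ENNReal.one_ne_top (min_le_left _ _)

theorem openBump_nonneg (z : E) : 0 ≤ openBump U z := ENNReal.toReal_nonneg

theorem openBump_le_one (z : E) : openBump U z ≤ 1 :=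
  (ENNReal.toReal_mono ENNReal.one_ne_top (min_le_left _ _)).trans_eq ENNReal.toReal_one

theorem openBump_pos (hU : IsOpen U) {z : E} : 0 < openBump U z ↔ z ∈ U := by
  unfold openBump
  rw [ENNReal.toReal_pos_iff, lt_min_iff, pos_iff_ne_zero (a := Metric.infEDist z Uᶜ), Ne,
    ← Metric.mem_closure_iff_infEDist_zero, hU.isClosed_compl.closure_eq, Set.notMem_compl_iff]
  refine ⟨fun h => h.1.2, fun h => ⟨⟨zero_lt_one, h⟩, ?_⟩⟩
  exact (min_le_left _ _).trans_lt ENNReal.one_lt_top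

theorem openBump_vadd {E : Type*} [SeminormedAddCommGroup E] (v z : E) {U U' : Set E}
    (h : ∀ z, z + v ∈ U' ↔ z ∈ U) : openBump U' (z + v) = openBump U z := by
  have hc : U'ᶜ = v +ᵥ Uᶜ := by
    ext y
    rw [Set.mem_vadd_set_iff_neg_vadd_mem, vadd_eq_add, Set.mem_compl_iff, Set.mem_compl_iff, ← h,
      neg_add_cancel_comm]
  unfold openBump
  rw [hc, add_comm z v, ← vadd_eq_add, Metric.infEDist_vadd]

end OpenBump

namespace ToricArrangement

variable {A : ToricArrangement d} {L : Set (Torus d)} {e₀ : Vec d}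

/-! ### Combinations of points in closures of a common face -/

section Combination

variable {ι : Type*} {S : Finset ι} {t : ι → ℝ} {x : ι → Vec d} {y : Vec d}

/-- A convex combination of points below `y` is below `y`. -/
theorem below_combination (ht : ∀ i ∈ S, 0 ≤ t i) (h1 : ∑ i ∈ S, t i = 1)
    (h : ∀ i ∈ S, t i ≠ 0 → A.Below (x i) y) : A.Below (∑ i ∈ S, t i • x i) y := by
  intro f hf hne
  rw [form_sum h1] at hne ⊢
  obtain ⟨j, hj, htj, hbj⟩ := exists_ne_zero_of_sum_ne_zero hne
  exact (sign_sum_eq ht (fun i hi hti hb => (h i hi hti f hf hb).symm) hj htj hbj).symm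

/-- A hyperplane containing a convex combination of points below a common point contains all of them. -/
theorem combination_eq_zero (ht : ∀ i ∈ S, 0 ≤ t i) (h1 : ∑ i ∈ S, t i = 1)
    (h : ∀ i ∈ S, t i ≠ 0 → A.Below (x i) y) {f : Form d} (hf : f ∈ A.lift)
    (h0 : f (∑ i ∈ S, t i • x i) = 0) {j : ι} (hj : j ∈ S) (htj : t j ≠ 0) : f (x j) = 0 := by
  rw [form_sum h1] at h0
  exact eq_zero_of_sum_eq_zero ht (fun i hi hti hb => (h i hi hti f hf hb).symm) h0 hj htj

/-- Points that are all below a common point `y` are below their convex combinations. -/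
theorem below_combination' (ht : ∀ i ∈ S, 0 ≤ t i) (h1 : ∑ i ∈ S, t i = 1)
    (h : ∀ i ∈ S, t i ≠ 0 → A.Below (x i) y) {j : ι} (hj : j ∈ S) (htj : t j ≠ 0) :
    A.Below (x j) (∑ i ∈ S, t i • x i) := by
  intro f hf hne
  rw [form_sum h1, sign_sum_eq ht (fun i hi hti hb => (h i hi hti f hf hb).symm) hj htj hne]
  exact h j hj htj f hf hne

end Combination

/-! ### The thickening of the poset of strata -/

/-- Nearby points, one of which is in the layer, are in the star of a common face in the layer.  The
radius is a Lebesgue number of the covering by stars of a compact part of the layer whose integral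
translates exhaust it. -/
theorem exists_radius (hL : L ∈ A.layers) : ∃ η > 0, ∀ a ∈ realLayer L, ∀ x : Vec d, ‖x - a‖ < η →
    ∃ b ∈ realLayer L, A.Below b a ∧ A.Below b x := by
  have hK : IsCompact (realLayer L ∩ Metric.closedBall 0 1) :=
    (isCompact_closedBall (0 : Vec d) 1).inter_left (realLayer_isClosed hL)
  obtain ⟨η, hη, h⟩ := lebesgue_number_lemma_of_metric hK
    (c := fun b : realLayer L => {y | A.Below b.1 y}) (fun b => below_isOpen b.1)
    fun a ha => Set.mem_iUnion.mpr ⟨⟨a, ha.1⟩, Below.refl a⟩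
  refine ⟨η, hη, fun a ha x hx => ?_⟩
  let k : Fin d → ℤ := fun i => -⌊a i⌋
  have hk : intVec k + a ∈ realLayer L ∩ Metric.closedBall 0 1 := by
    refine ⟨(realLayer_add_int k).mpr ha, ?_⟩
    rw [mem_closedBall_zero_iff, pi_norm_le_iff_of_nonneg zero_le_one]
    intro i
    have : (intVec k + a) i = Int.fract (a i) := by
      simp only [Pi.add_apply, intVec, k, Int.fract]
      push_cast
      ring
    rw [this, Real.norm_eq_abs, abs_of_nonneg (Int.fract_nonneg _)]
    exact (Int.fract_lt_one _).le
  obtain ⟨⟨b, hb⟩, hball⟩ := h _ hk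
  have h1 : A.Below b (intVec k + a) := hball (Metric.mem_ball_self hη)
  have h2 : A.Below b (intVec k + x) := hball (by
    rw [Metric.mem_ball, dist_eq_norm, add_sub_add_left_eq_sub]
    exact hx)
  have h3 : ∀ y : Vec d, (-intPeriod k : A.periods).1 + (intVec k + y) = y := fun y =>
    neg_add_cancel_left (intVec k) y
  refine ⟨(-intPeriod k : A.periods).1 + b, ?_, ?_, ?_⟩
  · exact ((-intLayerPeriod (A := A) (L := L) k).2 b).mpr hb
  · have := h1.vadd (-intPeriod k)
    rwa [h3] at this
  · have := h2.vadd (-intPeriod k)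
    rwa [h3] at this

/-- The distance up to which points near the layer are considered. -/
def radius (hL : L ∈ A.layers) : ℝ := (exists_radius hL).choose

theorem radius_pos (hL : L ∈ A.layers) : 0 < radius hL := (exists_radius hL).choose_spec.1

theorem exists_common_face (hL : L ∈ A.layers) {a x : Vec d} (ha : a ∈ realLayer L)
    (hx : ‖x - a‖ < radius hL) : ∃ b ∈ realLayer L, A.Below b a ∧ A.Below b x :=
  (exists_radius hL).choose_spec.2 a ha x hx

/-- The points `(a, x, y)` that may serve as a vertex of a stratum `(F, [G, C])`: `a` is in `F`, `x` is a
nearby point of `G`, and `y` points from `x` into `C` and close to the direction `e₀`. -/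
structure IsVertex (hL : L ∈ A.layers) (i : A.Stratum L e₀) (z : Vec d × Vec d × Vec d) : Prop where
  mem_cell : z.1 ∈ i.cell.carrier
  mem_face : z.2.1 ∈ i.pair.face
  sign_chamber : ∀ f ∈ A.lift, f z.2.1 = 0 → ∀ c ∈ i.pair.chamber,
    SignType.sign (f.linear z.2.2) = SignType.sign (f c)
  sign_eq : ∀ f ∈ A.lift, f.linear e₀ ≠ 0 →
    SignType.sign (f.linear z.2.2) = SignType.sign (f.linear e₀)
  near : ‖z.2.1 - z.1‖ < radius hL

/-- Because the chamber of the stratum lies in the direction `e₀` from the hyperplanes containing its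
face, the direction of the vertex can be taken close to `e₀`. -/
theorem exists_isVertex (hL : L ∈ A.layers) (i : A.Stratum L e₀) : ∃ z, IsVertex hL i z := by
  obtain ⟨a, ha⟩ := i.cell.isFace.nonempty
  obtain ⟨b, hb⟩ := i.pair.isFace.nonempty
  have hab : A.Below a b := Below.of_le i.cell.isFace i.pair.isFace i.le ha hb
  -- a point of the face `G` close to `a`
  obtain ⟨x, hx, hxa⟩ : ∃ x ∈ i.pair.face, ‖x - a‖ < radius hL := by
    obtain ⟨x, hx, h⟩ := Metric.mem_closure_iff.mp (i.le ha) _ (radius_pos hL)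
    exact ⟨x, hx, by rwa [← dist_eq_norm, dist_comm]⟩
  obtain ⟨c, hc⟩ := i.pair.isChamber.1.nonempty
  -- a direction towards `C` close to `e₀`
  have hev : ∀ᶠ ε in 𝓝[>] (0 : ℝ), ∀ f ∈ A.lift, f.linear e₀ ≠ 0 →
      SignType.sign (f.linear (e₀ + ε • (c - x))) = SignType.sign (f.linear e₀) := by
    have key : ∀ p ∈ A.data, ∀ᶠ ε in 𝓝[>] (0 : ℝ), charForm p.1 e₀ ≠ 0 →
        SignType.sign (charForm p.1 (e₀ + ε • (c - x))) = SignType.sign (charForm p.1 e₀) := by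
      intro p _
      by_cases h0 : charForm p.1 e₀ = 0
      · exact Eventually.of_forall fun ε h => absurd h0 h
      · have hlim : Tendsto (fun ε : ℝ => |ε * charForm p.1 (c - x)|) (𝓝[>] 0) (𝓝 0) := by
          have : Continuous fun ε : ℝ => |ε * charForm p.1 (c - x)| := by fun_prop
          have h := this.tendsto 0
          simp only [zero_mul, abs_zero] at h
          exact h.mono_left nhdsWithin_le_nhds
        filter_upwards [hlim.eventually (gt_mem_nhds (abs_pos.mpr h0))] with ε hε _
        rw [map_add, map_smul, smul_eq_mul]
        exact sign_eq_of_abs_lt hε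
    filter_upwards [(A.data.eventually_all).mpr key] with ε hε
    rintro f ⟨p, hp, c, -, rfl⟩ hne
    rw [affForm_linear] at hne ⊢
    exact hε p hp hne
  obtain ⟨ε, hε, hε0⟩ := (hev.and self_mem_nhdsWithin).exists
  refine ⟨(a, x, e₀ + ε • (c - x)), ha, hx, fun f hf h0 c' hc' => ?_, fun f hf hne => hε f hf hne,
    hxa⟩
  rw [i.pair.isChamber.1.sign_eq hc' hc hf]
  by_cases he : f.linear e₀ = 0
  · change SignType.sign (f.linear (e₀ + ε • (c - x))) = _
    have h0' : f x = 0 := h0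
    rw [map_add, he, zero_add, map_smul, smul_eq_mul, form_sub, h0', sub_zero]
    exact sign_mul_eq hε0
  · rw [i.sign_eq f hf (i.pair.isFace.vanish hx hf h0) he c hc]
    exact hε f hf he

/-- The translation of triples by a translation of the real vector space. -/
def diag (w : A.layerPeriods L) : Vec d × Vec d × Vec d := (w.1.1, w.1.1, 0)

theorem IsVertex.vadd {hL : L ∈ A.layers} {i : A.Stratum L e₀} {z : Vec d × Vec d × Vec d}
    (h : IsVertex hL i z) (w : A.layerPeriods L) : IsVertex hL (w +ᵥ i) (z + diag w) where
  mem_cell := ⟨_, h.mem_cell, add_comm _ _⟩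
  mem_face := ⟨_, h.mem_face, add_comm _ _⟩
  sign_chamber := by
    rintro f hf h0 _ ⟨c, hc, rfl⟩
    obtain ⟨f', hf', a, ha, h1, h2⟩ := exists_translate w.1 hf
    change f (z.2.1 + w.1.1) = 0 at h0
    rw [add_comm, h1] at h0
    change SignType.sign (f.linear (z.2.2 + 0)) = SignType.sign (f (w.1.1 + c))
    rw [add_zero, h1, h2, sign_mul, sign_mul,
      h.sign_chamber f' hf' ((mul_eq_zero.mp h0).resolve_left ha) c hc]
  sign_eq f hf hne := by
    change SignType.sign (f.linear (z.2.2 + 0)) = _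
    rw [add_zero]
    exact h.sign_eq f hf hne
  near := by
    change ‖z.2.1 + w.1.1 - (z.1 + w.1.1)‖ < _
    rw [add_sub_add_right_eq_sub]
    exact h.near

/-- Translations act freely on the strata, so vertices can be chosen on representatives of the orbits. -/
theorem exists_equivariant_vertex (hA : A.IsEssential) (hL : L ∈ A.layers) :
    ∃ V : A.Stratum L e₀ → Vec d × Vec d × Vec d, (∀ i, IsVertex hL i (V i)) ∧
      ∀ (w : A.layerPeriods L) i, V (w +ᵥ i) = V i + diag w := by
  let Γ := A.layerPeriods L
  let base : A.Stratum L e₀ → Vec d × Vec d × Vec d := fun i => (exists_isVertex hL i).choose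
  refine ⟨fun i => base (OrbitCat.mk' Γ i).rep + diag (-OrbitCat.shift Γ i : Γ), fun i => ?_,
    fun w i => ?_⟩
  · have h1 := (exists_isVertex hL (OrbitCat.mk' Γ i).rep).choose_spec.vadd (-OrbitCat.shift Γ i : Γ)
    have h2 : (-OrbitCat.shift Γ i : Γ) +ᵥ (OrbitCat.mk' Γ i).rep = i := by
      rw [← OrbitCat.shift_vadd (Γ := Γ) i, neg_vadd_vadd]
    rwa [h2] at h1
  · have h1 : OrbitCat.shift Γ (w +ᵥ i) = OrbitCat.shift Γ i - w :=
      OrbitCat.shift_vadd_eq (fun k x h => Stratum.vadd_free hA k x h) w i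
    have h2 : diag (w - OrbitCat.shift Γ i : Γ) = diag (-OrbitCat.shift Γ i : Γ) + diag w := by
      refine Prod.ext ?_ (Prod.ext ?_ (add_zero (0 : Vec d)).symm)
      · change w.1.1 - (OrbitCat.shift Γ i : Γ).1.1 = -(OrbitCat.shift Γ i : Γ).1.1 + w.1.1
        abel
      · change w.1.1 - (OrbitCat.shift Γ i : Γ).1.1 = -(OrbitCat.shift Γ i : Γ).1.1 + w.1.1
        abel
    change base (OrbitCat.mk' Γ (w +ᵥ i)).rep + diag (-OrbitCat.shift Γ (w +ᵥ i) : Γ) = _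
    rw [h1, OrbitCat.mk'_vadd, neg_sub, h2]
    exact (add_assoc _ _ _).symm

/-- The chosen vertices of the strata, equivariant under the translations preserving the layer. -/
def vertex (hA : A.IsEssential) (hL : L ∈ A.layers) (i : A.Stratum L e₀) : Vec d × Vec d × Vec d :=
  (exists_equivariant_vertex hA hL).choose i

theorem vertex_isVertex (hA : A.IsEssential) (hL : L ∈ A.layers) (i : A.Stratum L e₀) :
    IsVertex hL i (vertex hA hL i) := (exists_equivariant_vertex hA hL).choose_spec.1 i

theorem vertex_vadd (hA : A.IsEssential) (hL : L ∈ A.layers) (w : A.layerPeriods L)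
    (i : A.Stratum L e₀) : vertex hA hL (w +ᵥ i) = vertex hA hL i + diag w :=
  (exists_equivariant_vertex hA hL).choose_spec.2 w i

/-- The triple `(a, x, y)` lies in the open star of the stratum `(F, [G, C])`: the faces of `a` and of `x`
have `F` and `G` in their closures, and `y` is on the side of `C` of the hyperplanes containing
`G`. -/
structure Sees (i : A.Stratum L e₀) (z : Vec d × Vec d × Vec d) : Prop where
  below_cell : ∀ a ∈ i.cell.carrier, A.Below a z.1
  below_face : ∀ x ∈ i.pair.face, A.Below x z.2.1
  sign_chamber : ∀ f ∈ A.lift, (∀ x ∈ i.pair.face, f x = 0) → ∀ c ∈ i.pair.chamber,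
    SignType.sign (f.linear z.2.2) = SignType.sign (f c)

theorem below_congr {F : Set (Vec d)} (hF : IsFace A.lift F) {a b y : Vec d} (ha : a ∈ F) (hb : b ∈ F)
    (h : A.Below a y) : A.Below b y := fun f hf hne => by
  rw [hF.sign_eq hb ha hf]
  exact h f hf ((sign_zero_iff (hF.sign_eq hb ha hf)).not.mp hne)

/-- A small change of a direction does not change its nonzero signs. -/
theorem eventually_sign_linear (y : Vec d) : ∀ᶠ y' in 𝓝 y, ∀ f ∈ A.lift, f.linear y ≠ 0 →
    SignType.sign (f.linear y') = SignType.sign (f.linear y) := by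
  have key : ∀ p ∈ A.data, ∀ᶠ y' in 𝓝 y, charForm p.1 y ≠ 0 →
      SignType.sign (charForm p.1 y') = SignType.sign (charForm p.1 y) := by
    intro p _
    by_cases h0 : charForm p.1 y = 0
    · exact Eventually.of_forall fun _ h => absurd h0 h
    have hc : Continuous fun y' : Vec d => |charForm p.1 (y' - y)| :=
      ((LinearMap.continuous_of_finiteDimensional _).comp (continuous_id.sub continuous_const)).abs
    have hlim := hc.tendsto y
    simp only [sub_self, map_zero, abs_zero] at hlim
    filter_upwards [hlim.eventually (gt_mem_nhds (abs_pos.mpr h0))] with y' hy' _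
    have : charForm p.1 y' = charForm p.1 y + charForm p.1 (y' - y) := by
      rw [map_sub]
      ring
    rw [this]
    exact sign_eq_of_abs_lt hy'
  filter_upwards [(A.data.eventually_all).mpr key] with y' hy'
  rintro f ⟨p, hp, c, -, rfl⟩ hne
  rw [affForm_linear] at hne ⊢
  exact hy' p hp hne

theorem sees_isOpen (i : A.Stratum L e₀) : IsOpen {z | Sees i z} := by
  refine isOpen_iff_mem_nhds.mpr fun z hz => ?_
  have e1 : ∀ᶠ z' in 𝓝 z, A.Below z.1 z'.1 :=
    continuous_fst.tendsto z (eventually_sign (A := A) z.1)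
  have e2 : ∀ᶠ z' in 𝓝 z, A.Below z.2.1 z'.2.1 :=
    (continuous_fst.comp continuous_snd).tendsto z (eventually_sign (A := A) z.2.1)
  have e3 : ∀ᶠ z' : Vec d × Vec d × Vec d in 𝓝 z, ∀ f ∈ A.lift, f.linear z.2.2 ≠ 0 →
      SignType.sign (f.linear z'.2.2) = SignType.sign (f.linear z.2.2) :=
    (continuous_snd.comp continuous_snd).tendsto z (eventually_sign_linear (A := A) z.2.2)
  filter_upwards [e1, e2, e3] with z' h1 h2 h3
  refine ⟨fun a ha => (hz.below_cell a ha).trans h1, fun x hx => (hz.below_face x hx).trans h2,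
    fun f hf h0 c hc => ?_⟩
  have h4 := hz.sign_chamber f hf h0 c hc
  rw [h3 f hf fun h => i.pair.isChamber.2 f hf c hc ((sign_zero_iff h4).mp h), h4]

theorem Sees.vadd {i : A.Stratum L e₀} {z : Vec d × Vec d × Vec d} (h : Sees i z)
    (w : A.layerPeriods L) : Sees (w +ᵥ i) (z + diag w) where
  below_cell := by
    rintro _ ⟨a, ha, rfl⟩
    have := (h.below_cell a ha).vadd w.1
    rwa [add_comm w.1.1 z.1] at this
  below_face := by
    rintro _ ⟨a, ha, rfl⟩
    have := (h.below_face a ha).vadd w.1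
    rwa [add_comm w.1.1 z.2.1] at this
  sign_chamber := by
    rintro f hf h0 _ ⟨c, hc, rfl⟩
    obtain ⟨f', hf', a, ha, h1, h2⟩ := exists_translate w.1 hf
    change SignType.sign (f.linear (z.2.2 + 0)) = SignType.sign (f (w.1.1 + c))
    rw [add_zero, h1, h2, sign_mul, sign_mul, h.sign_chamber f' hf' (fun x hx => ?_) c hc]
    have h3 : f (w.1.1 + x) = 0 := h0 _ ⟨x, hx, rfl⟩
    rw [h1] at h3
    exact (mul_eq_zero.mp h3).resolve_left ha

theorem sees_vadd_iff {i : A.Stratum L e₀} {z : Vec d × Vec d × Vec d} (w : A.layerPeriods L) :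
    Sees (w +ᵥ i) (z + diag w) ↔ Sees i z := by
  refine ⟨fun h => ?_, fun h => h.vadd w⟩
  have h1 := h.vadd (-w)
  rw [neg_vadd_vadd] at h1
  have h2 : z + diag w + diag (-w) = z := by
    rw [add_assoc]
    refine (congrArg (z + ·) ?_).trans (add_zero z)
    refine Prod.ext (add_neg_cancel w.1.1) (Prod.ext (add_neg_cancel w.1.1) (add_zero (0 : Vec d)))
  rwa [h2] at h1

/-- A form of the lifted arrangement far from zero on a ball has constant sign there. -/
theorem sign_far {R : ℝ} {f : Form d} (hf : ∀ x : Vec d, ‖x‖ ≤ R → R < |f x|) (hR : 1 ≤ R) {x : Vec d}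
    (hx : ‖x‖ ≤ R) : SignType.sign (f x) = SignType.sign (f 0) := by
  have hpre : _root_.IsPreconnected (Metric.closedBall (0 : Vec d) R) :=
    (convex_closedBall 0 R).isPreconnected
  have hne : ∀ y : Vec d, ‖y‖ ≤ R → f y ≠ 0 := fun y hy h0 => by
    have := hf y hy
    rw [h0, abs_zero] at this
    linarith
  have h0 : ‖(0 : Vec d)‖ ≤ R := by
    rw [norm_zero]
    linarith
  have hx' := mem_closedBall_zero_iff.mpr hx
  have h0' := mem_closedBall_zero_iff.mpr h0
  rcases lt_or_gt_of_ne (hne x hx) with h1 | h1 <;> rcases lt_or_gt_of_ne (hne 0 h0) with h2 | h2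
  · rw [sign_neg h1, sign_neg h2]
  · obtain ⟨y, hy, hy0⟩ := hpre.intermediate_value hx' h0' (form_continuous f).continuousOn
      ⟨h1.le, h2.le⟩
    exact absurd hy0 (hne y (mem_closedBall_zero_iff.mp hy))
  · obtain ⟨y, hy, hy0⟩ := hpre.intermediate_value h0' hx' (form_continuous f).continuousOn
      ⟨h2.le, h1.le⟩
    exact absurd hy0 (hne y (mem_closedBall_zero_iff.mp hy))
  · rw [sign_pos h1, sign_pos h2]

/-- Forms with large absolute value do not vanish at points below the given one, since the
arrangement contains parallel hyperplanes at distance one. -/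
theorem Below.ne_zero_of_one_lt {x y : Vec d} (h : A.Below x y) {f : Form d} (hf : f ∈ A.lift)
    (h1 : 1 < |f y|) : f x ≠ 0 := by
  obtain ⟨p, hp, c, hc, rfl⟩ := hf
  intro h0
  rw [affForm_apply] at h0 h1
  rcases lt_abs.mp h1 with h2 | h2
  · have hmem : affForm p.1 (c - (-1 : ℤ)) ∈ A.lift :=
      affForm_mem_lift hp (by rw [circle_exp_sub_int, hc])
    have h3 := h _ hmem
    rw [affForm_apply, affForm_apply] at h3
    push_cast at h3
    rw [sign_pos (by linarith), sign_neg (by linarith)] at h3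
    exact absurd (h3 (by linarith)) (by decide)
  · have hmem : affForm p.1 (c - (1 : ℤ)) ∈ A.lift :=
      affForm_mem_lift hp (by rw [circle_exp_sub_int, hc])
    have h3 := h _ hmem
    rw [affForm_apply, affForm_apply] at h3
    push_cast at h3
    rw [sign_neg (by linarith), sign_pos (by linarith)] at h3
    exact absurd (h3 (by linarith)) (by decide)

/-- A bounded set meets only finitely many stars: off finitely many hyperplanes, all strata visible
from it have the same signs. -/
theorem finite_sees (R : ℝ) : {i : A.Stratum L e₀ | ∃ z, ‖z‖ ≤ R ∧ Sees i z}.Finite := by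
  classical
  wlog hR : 1 ≤ R generalizing R
  · refine (this (max R 1) (le_max_right _ _)).subset ?_
    rintro i ⟨z, hz, h⟩
    exact ⟨z, hz.trans (le_max_left _ _), h⟩
  let Q : Set (Form d) := {f | f ∈ A.lift ∧ ∃ x : Vec d, ‖x‖ ≤ R ∧ |f x| ≤ R}
  have hQ : Q.Finite := finite_near R
  have : Finite Q := hQ
  have hfar : ∀ f ∈ A.lift, f ∉ Q → ∀ x : Vec d, ‖x‖ ≤ R → R < |f x| := by
    intro f hf hfQ x hx
    by_contra! hcon
    exact hfQ ⟨hf, x, hx, hcon⟩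
  -- off a finite set of hyperplanes, the sign vectors of all visible strata agree
  have hbelow : ∀ {x y : Vec d}, ‖y‖ ≤ R → A.Below x y → ∀ f ∈ A.lift, f ∉ Q →
      f x ≠ 0 ∧ SignType.sign (f x) = SignType.sign (f 0) := by
    intro x y hy h f hf hfQ
    have h1 := hfar f hf hfQ
    have h2 := h.ne_zero_of_one_lt hf (hR.trans_lt (h1 y hy))
    exact ⟨h2, by rw [← h f hf h2, sign_far h1 hR hy]⟩
  let pt : A.Stratum L e₀ → Vec d × Vec d × Vec d := fun i =>
    (i.cell.isFace.nonempty.some, i.pair.isFace.nonempty.some, i.pair.isChamber.1.nonempty.some)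
  have hpt1 : ∀ i, (pt i).1 ∈ i.cell.carrier := fun i => i.cell.isFace.nonempty.some_mem
  have hpt2 : ∀ i, (pt i).2.1 ∈ i.pair.face := fun i => i.pair.isFace.nonempty.some_mem
  have hpt3 : ∀ i, (pt i).2.2 ∈ i.pair.chamber := fun i => i.pair.isChamber.1.nonempty.some_mem
  let code : A.Stratum L e₀ → (Q → SignType) × (Q → SignType) × (Q → SignType) := fun i =>
    (fun f => SignType.sign (f.1 (pt i).1), fun f => SignType.sign (f.1 (pt i).2.1),
      fun f => SignType.sign (f.1 (pt i).2.2))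
  refine Set.Finite.of_injOn (f := code) (t := Set.univ) (fun _ _ => Set.mem_univ _) ?_
    Set.finite_univ
  rintro i ⟨z, hz, hi⟩ j ⟨z', hz', hj⟩ hij
  have hz1 : ‖z.1‖ ≤ R := (norm_fst_le z).trans hz
  have hz2 : ‖z.2.1‖ ≤ R := (norm_fst_le z.2).trans ((norm_snd_le z).trans hz)
  have hz1' : ‖z'.1‖ ≤ R := (norm_fst_le z').trans hz'
  have hz2' : ‖z'.2.1‖ ≤ R := (norm_fst_le z'.2).trans ((norm_snd_le z').trans hz')
  have h1 : i.cell = j.cell := by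
    refine Face.ext (i.cell.isFace.eq_of_mem j.cell.isFace (hpt1 i)
      (j.cell.isFace.mem (hpt1 j) fun f hf => ?_))
    by_cases hfQ : f ∈ Q
    · exact congrFun (congrArg Prod.fst hij) ⟨f, hfQ⟩
    · rw [(hbelow hz1 (hi.below_cell _ (hpt1 i)) f hf hfQ).2,
        (hbelow hz1' (hj.below_cell _ (hpt1 j)) f hf hfQ).2]
  have h2 : i.pair.face = j.pair.face := by
    refine i.pair.isFace.eq_of_mem j.pair.isFace (hpt2 i) (j.pair.isFace.mem (hpt2 j) fun f hf => ?_)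
    by_cases hfQ : f ∈ Q
    · exact congrFun (congrArg (fun c => c.2.1) hij) ⟨f, hfQ⟩
    · rw [(hbelow hz2 (hi.below_face _ (hpt2 i)) f hf hfQ).2,
        (hbelow hz2' (hj.below_face _ (hpt2 j)) f hf hfQ).2]
  have hch : ∀ (i : A.Stratum L e₀) (z : Vec d × Vec d × Vec d), ‖z.2.1‖ ≤ R → Sees i z →
      ∀ f ∈ A.lift, f ∉ Q → SignType.sign (f (pt i).2.2) = SignType.sign (f 0) := by
    intro i z hz hi f hf hfQ
    have h3 := hbelow hz (hi.below_face _ (hpt2 i)) f hf hfQ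
    rw [← h3.2]
    exact Below.of_le i.pair.isFace i.pair.isChamber.1 i.pair.le (hpt2 i) (hpt3 i) f hf h3.1
  have h3 : i.pair.chamber = j.pair.chamber := by
    refine i.pair.isChamber.1.eq_of_mem j.pair.isChamber.1 (hpt3 i)
      (j.pair.isChamber.1.mem (hpt3 j) fun f hf => ?_)
    by_cases hfQ : f ∈ Q
    · exact congrFun (congrArg (fun c => c.2.2) hij) ⟨f, hfQ⟩
    · rw [hch i z hz2 hi f hf hfQ, hch j z' hz2' hj f hf hfQ]
  exact Stratum.ext h1 (Sal.ext h2 h3)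

theorem locallyFinite_sees : LocallyFinite fun i : A.Stratum L e₀ => {z | Sees i z} := by
  intro z
  refine ⟨Metric.ball z 1, Metric.ball_mem_nhds z one_pos, (finite_sees (‖z‖ + 1)).subset ?_⟩
  rintro i ⟨z', hi, hz'⟩
  refine ⟨z', ?_, hi⟩
  have h1 : ‖z' - z‖ < 1 := mem_ball_iff_norm.mp hz'
  have h2 := norm_le_norm_add_norm_sub' z' z
  rw [norm_sub_rev] at h1
  linarith [norm_sub_rev z z', norm_sub_norm_le z' z, norm_sub_rev z' z]

/-- The region near a layer that is covered by the stars of the strata. -/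
structure InRegion (e₀ : Vec d) (hL : L ∈ A.layers) (z : Vec d × Vec d × Vec d) : Prop where
  mem : z.1 ∈ realLayer L
  near : ‖z.2.1 - z.1‖ < radius hL
  generic : ∀ f ∈ A.lift, f z.2.1 = 0 → f.linear z.2.2 ≠ 0
  sign_eq : ∀ f ∈ A.lift, f.linear e₀ ≠ 0 →
    SignType.sign (f.linear z.2.2) = SignType.sign (f.linear e₀)

/-- A point `(a, x, y)` of the region is visible from the stratum of `(b, x, y)`, where `b` is a point of
the layer below both `a` and `x`. -/
theorem InRegion.exists_sees {hL : L ∈ A.layers} {z : Vec d × Vec d × Vec d}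
    (hz : InRegion e₀ hL z) : ∃ i : A.Stratum L e₀, Sees i z := by
  obtain ⟨b, hb, h1, h2⟩ := exists_common_face hL hz.mem hz.near
  have hadm : Admissible A L e₀ (b, z.2) := ⟨hb, h2, hz.generic, hz.sign_eq⟩
  refine ⟨hadm.stratum hL, fun a ha => ?_, fun x hx => ?_, fun f hf h0 c hc => ?_⟩
  · exact below_congr (hadm.stratum hL).cell.isFace (hadm.mem_cell hL) ha h1
  · exact below_congr (hadm.stratum hL).pair.isFace (hadm.mem_face hL) hx (Below.refl _)
  · rw [hadm.sign_chamber hL hc hf, if_pos (h0 _ (hadm.mem_face hL))]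

end ToricArrangement

end

section

variable {d : ℕ}

namespace ToricArrangement

variable {A : ToricArrangement d} {L : Set (Torus d)} {e₀ : Vec d}

/-! ### The stratum common to visible strata -/

section Average

variable (hA : A.IsEssential) (hL : L ∈ A.layers)

/-- The barycenter of the vertices of finitely many strata. -/
def average (S : Finset (A.Stratum L e₀)) : Vec d × Vec d × Vec d :=
  ∑ i ∈ S, (S.card : ℝ)⁻¹ • vertex hA hL i

variable {S : Finset (A.Stratum L e₀)} {z : Vec d × Vec d × Vec d}

theorem average_weights (hS : S.Nonempty) :
    (∀ i ∈ S, (0 : ℝ) ≤ (fun _ => (S.card : ℝ)⁻¹) i) ∧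
      ∑ i ∈ S, (fun _ : A.Stratum L e₀ => (S.card : ℝ)⁻¹) i = 1 ∧ (S.card : ℝ)⁻¹ ≠ 0 := by
  have h : (S.card : ℝ) ≠ 0 := by exact_mod_cast hS.card_ne_zero
  refine ⟨fun _ _ => by positivity, ?_, inv_ne_zero h⟩
  rw [Finset.sum_const, nsmul_eq_mul, mul_inv_cancel₀ h]

theorem average_fst : (average hA hL S).1 = ∑ i ∈ S, (S.card : ℝ)⁻¹ • (vertex hA hL i).1 := by
  unfold average
  rw [Prod.fst_sum]
  rfl

theorem average_snd : (average hA hL S).2.1 = ∑ i ∈ S, (S.card : ℝ)⁻¹ • (vertex hA hL i).2.1 := by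
  unfold average
  rw [Prod.snd_sum, Prod.fst_sum]
  rfl

theorem average_thd : (average hA hL S).2.2 = ∑ i ∈ S, (S.card : ℝ)⁻¹ • (vertex hA hL i).2.2 := by
  unfold average
  rw [Prod.snd_sum, Prod.snd_sum]
  rfl

variable {hA hL}

theorem average_below_fst (hS : S.Nonempty) (hz : ∀ i ∈ S, Sees i z) :
    A.Below (average hA hL S).1 z.1 := by
  rw [average_fst]
  have hw := average_weights hS
  exact below_combination hw.1 hw.2.1 fun i hi _ =>
    (hz i hi).below_cell _ (vertex_isVertex hA hL i).mem_cell

theorem average_below_snd (hS : S.Nonempty) (hz : ∀ i ∈ S, Sees i z) :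
    A.Below (average hA hL S).2.1 z.2.1 := by
  rw [average_snd]
  have hw := average_weights hS
  exact below_combination hw.1 hw.2.1 fun i hi _ =>
    (hz i hi).below_face _ (vertex_isVertex hA hL i).mem_face

theorem below_average_fst (hz : ∀ i ∈ S, Sees i z) {i : A.Stratum L e₀} (hi : i ∈ S) :
    A.Below (vertex hA hL i).1 (average hA hL S).1 := by
  rw [average_fst]
  have hw := average_weights ⟨i, hi⟩
  exact below_combination' hw.1 hw.2.1 (fun i hi _ =>
    (hz i hi).below_cell _ (vertex_isVertex hA hL i).mem_cell) hi hw.2.2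

theorem below_average_snd (hz : ∀ i ∈ S, Sees i z) {i : A.Stratum L e₀} (hi : i ∈ S) :
    A.Below (vertex hA hL i).2.1 (average hA hL S).2.1 := by
  rw [average_snd]
  have hw := average_weights ⟨i, hi⟩
  exact below_combination' hw.1 hw.2.1 (fun i hi _ =>
    (hz i hi).below_face _ (vertex_isVertex hA hL i).mem_face) hi hw.2.2

/-- On the hyperplanes containing the second component of the barycenter, the direction of the
barycenter is on the same side as any direction seen from all the strata. -/
theorem average_sign_thd (hS : S.Nonempty) (hz : ∀ i ∈ S, Sees i z) {f : Form d} (hf : f ∈ A.lift)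
    (h0 : f (average hA hL S).2.1 = 0) :
    SignType.sign (f.linear (average hA hL S).2.2) = SignType.sign (f.linear z.2.2) := by
  have hw := average_weights hS
  obtain ⟨j, hj⟩ := hS
  rw [average_thd, linear_sum]
  refine sign_sum_eq' hw.1 (fun i hi _ => ?_) hj hw.2.2
  have h1 := (below_average_snd (hA := hA) (hL := hL) hz hi).eq_zero hf h0
  obtain ⟨c, hc⟩ := i.pair.isChamber.1.nonempty
  rw [(vertex_isVertex hA hL i).sign_chamber f hf h1 c hc, (hz i hi).sign_chamber f hf
    (i.pair.isFace.vanish (vertex_isVertex hA hL i).mem_face hf h1) c hc]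

/-- If all strata of a finite set are visible from a point whose first component is in the layer, then
their barycenter determines a stratum. -/
theorem average_admissible (hS : S.Nonempty) (hz : ∀ i ∈ S, Sees i z) (hzL : z.1 ∈ realLayer L) :
    Admissible A L e₀ (average hA hL S) where
  mem := by
    have h1 := (average_below_fst (hA := hA) (hL := hL) hS hz).sub_mem_flat hzL
    have := realLayer_add hL hzL h1
    rwa [add_sub_cancel] at this
  below f hf hne := by
    have hw := average_weights hS
    have h1 := hne
    rw [average_fst, form_sum hw.2.1] at h1
    obtain ⟨j, hj, -, hbj⟩ := exists_ne_zero_of_sum_ne_zero h1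
    have hv := vertex_isVertex hA hL j
    have h2 := Below.of_le j.cell.isFace j.pair.isFace j.le hv.mem_cell hv.mem_face
    rw [below_average_fst hz hj f hf hbj, ← h2 f hf hbj,
      below_average_snd hz hj f hf (h2.ne_zero hf hbj)]
  generic f hf h0 := by
    obtain ⟨j, hj⟩ := id hS
    have h1 := (below_average_snd (hA := hA) (hL := hL) hz hj).eq_zero hf h0
    obtain ⟨c, hc⟩ := j.pair.isChamber.1.nonempty
    intro h2
    rw [sign_zero_iff (average_sign_thd hS hz hf h0), sign_zero_iff ((hz j hj).sign_chamber f hf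
      (j.pair.isFace.vanish (vertex_isVertex hA hL j).mem_face hf h1) c hc)] at h2
    exact j.pair.isChamber.2 f hf c hc h2
  sign_eq f hf hne := by
    have hw := average_weights hS
    obtain ⟨j, hj⟩ := hS
    rw [average_thd, linear_sum]
    exact sign_sum_eq' hw.1 (fun i _ _ => (vertex_isVertex hA hL i).sign_eq f hf hne) hj hw.2.2

theorem average_vadd [DecidableEq (A.Stratum L e₀)] (hS : S.Nonempty) (w : A.layerPeriods L) :
    average hA hL (S.image fun i => w +ᵥ i) = average hA hL S + diag w := by
  have hw := (average_weights hS).2.1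
  have hinj : Function.Injective fun i : A.Stratum L e₀ => w +ᵥ i := AddAction.injective w
  unfold average
  rw [Finset.sum_image fun i _ j _ h => hinj h, Finset.card_image_of_injective _ hinj]
  simp only [vertex_vadd, smul_add]
  rw [Finset.sum_add_distrib, ← Finset.sum_smul, hw, one_smul]

variable (hA hL)

/-- The stratum of the barycenter of finitely many strata, provided it is defined; for any other set
of strata this is the irrelevant value `i₀`. -/
def meetStratum (i₀ : A.Stratum L e₀) (B : Set (A.Stratum L e₀)) : A.Stratum L e₀ := by
  classical
  exact if h : ∃ S : Finset (A.Stratum L e₀), (S : Set (A.Stratum L e₀)) = B ∧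
    Admissible A L e₀ (average hA hL S) then h.choose_spec.2.stratum hL else i₀

variable {hA hL}

theorem meetStratum_coe (i₀ : A.Stratum L e₀) (h : Admissible A L e₀ (average hA hL S)) :
    meetStratum hA hL i₀ (S : Set (A.Stratum L e₀)) = h.stratum hL := by
  have hex : ∃ S' : Finset (A.Stratum L e₀), (S' : Set (A.Stratum L e₀)) = S ∧
    Admissible A L e₀ (average hA hL S') := ⟨S, rfl, h⟩
  unfold meetStratum
  rw [dif_pos hex]
  have h1 : hex.choose = S := Finset.coe_injective hex.choose_spec.1
  congr 2

theorem finite_of_sees {B : Set (A.Stratum L e₀)} (h : ∀ i ∈ B, Sees i z) : B.Finite :=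
  (locallyFinite_sees.point_finite z).subset h

variable (hA hL)

/-- The strata of a layer, thickened to open sets covering a region near the layer.  When a set
of strata visible from a point grows, fewer hyperplanes contain its barycenter, so the faces of the
stratum of the barycenter grow and this stratum decreases. -/
def thickening (i₀ : A.Stratum L e₀) : Thickening (A.Stratum L e₀) (Vec d × Vec d × Vec d) where
  vertex := vertex hA hL
  bump i := openBump {z | Sees i z}
  bump_continuous _ := openBump_continuous
  bump_nonneg _ := openBump_nonneg
  bump_le_one _ := openBump_le_one
  locallyFinite := by
    simp only [openBump_pos (sees_isOpen _)]
    exact locallyFinite_sees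
  meet := meetStratum hA hL i₀
  region := {z | InRegion e₀ hL z}
  cover z hz := by
    simp only [openBump_pos (sees_isOpen _)]
    exact hz.exists_sees
  meet_anti z hz B B' hB hBB' h := by
    simp only [openBump_pos (sees_isOpen _)] at h
    have h' : ∀ i ∈ B, Sees i z := fun i hi => h i (hBB' hi)
    obtain ⟨S, rfl⟩ := (finite_of_sees h').exists_finset_coe
    obtain ⟨S', rfl⟩ := (finite_of_sees h).exists_finset_coe
    have hS : S.Nonempty := hB
    have hSS' : S ⊆ S' := fun i hi => hBB' hi
    have hS' : S'.Nonempty := hS.mono hSS'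
    have hadm : Admissible A L e₀ (average hA hL S) := average_admissible hS h' hz.mem
    have hadm' : Admissible A L e₀ (average hA hL S') := average_admissible hS' h hz.mem
    rw [meetStratum_coe i₀ hadm, meetStratum_coe i₀ hadm']
    refine hadm.stratum_le_stratum hL hadm' (fun f hf hne => ?_) (fun f hf hne => ?_) fun f hf h0 => ?_
    · have h1 := hne
      rw [average_fst, form_sum (average_weights hS).2.1] at h1
      obtain ⟨j, hj, -, hbj⟩ := exists_ne_zero_of_sum_ne_zero h1
      rw [below_average_fst h (hSS' hj) f hf hbj, below_average_fst h' hj f hf hbj]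
    · have h1 := hne
      rw [average_snd, form_sum (average_weights hS).2.1] at h1
      obtain ⟨j, hj, -, hbj⟩ := exists_ne_zero_of_sum_ne_zero h1
      rw [below_average_snd h (hSS' hj) f hf hbj, below_average_snd h' hj f hf hbj]
    · rw [average_sign_thd hS' h hf h0, average_sign_thd hS h' hf]
      rw [average_snd, form_sum (average_weights hS).2.1]
      refine Finset.sum_eq_zero fun i hi => ?_
      rw [(below_average_snd (hA := hA) (hL := hL) h (hSS' hi)).eq_zero hf h0, mul_zero]

variable {hA hL}

theorem thickening_bump_pos {i₀ i : A.Stratum L e₀} :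
    0 < (thickening hA hL i₀).bump i z ↔ Sees i z := openBump_pos (sees_isOpen i)

variable (hA hL) in
/-- The translations preserving the layer act on the thickening. -/
def layerSymmetry (i₀ : A.Stratum L e₀) (w : A.layerPeriods L) : (thickening hA hL i₀).Symmetry where
  shift := diag w
  toIso := Stratum.translate w
  vertex_eq i := vertex_vadd hA hL w i
  bump_eq _ z := openBump_vadd (diag w) z fun _ => sees_vadd_iff w
  meet_eq z hz B hB h := by
    classical
    simp only [thickening_bump_pos] at h
    obtain ⟨S, rfl⟩ := (finite_of_sees h).exists_finset_coe
    have hadm : Admissible A L e₀ (average hA hL S) := average_admissible hB h hz.mem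
    have h1 : Stratum.translate w '' (S : Set (A.Stratum L e₀)) =
        (S.image fun i => w +ᵥ i : Finset (A.Stratum L e₀)) := by
      rw [Finset.coe_image]
      rfl
    have hadm' : Admissible A L e₀ (average hA hL (S.image fun i => w +ᵥ i)) := by
      rw [average_vadd hB]
      exact hadm.vadd w
    change meetStratum hA hL i₀ _ = w +ᵥ meetStratum hA hL i₀ _
    rw [h1, meetStratum_coe i₀ hadm', meetStratum_coe i₀ hadm, ← hadm.stratum_vadd hL]
    have h2 := average_vadd (hA := hA) (hL := hL) hB w
    congr 1

end Average

/-! ### Moving the strata along the layer -/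

section Motion

variable {hA : A.IsEssential} {hL : L ∈ A.layers} {n : ℕ} (σ : Fin (n + 1) →o A.Stratum L e₀)
  (t : stdSimplex ℝ (Fin (n + 1)))

theorem weights_nonneg : ∀ i ∈ Finset.univ, (0 : ℝ) ≤ t i := fun i _ => t.2.1 i

theorem weights_sum : ∑ i ∈ Finset.univ, t i = 1 := t.2.2

variable (hA hL)

/-- The barycenter of a simplex of strata in the thickening. -/
def center : Vec d × Vec d × Vec d := ∑ j, t j • vertex hA hL (σ j)

theorem center_fst : (center hA hL σ t).1 = ∑ j, t j • (vertex hA hL (σ j)).1 := by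
  unfold center
  rw [Prod.fst_sum]
  rfl

theorem center_snd : (center hA hL σ t).2.1 = ∑ j, t j • (vertex hA hL (σ j)).2.1 := by
  unfold center
  rw [Prod.snd_sum, Prod.fst_sum]
  rfl

theorem center_thd : (center hA hL σ t).2.2 = ∑ j, t j • (vertex hA hL (σ j)).2.2 := by
  unfold center
  rw [Prod.snd_sum, Prod.snd_sum]
  rfl

variable {σ t}

theorem vertex_below_fst {i j : A.Stratum L e₀} (h : i ≤ j) :
    A.Below (vertex hA hL j).1 (vertex hA hL i).1 :=
  Below.of_le j.cell.isFace i.cell.isFace h.1 (vertex_isVertex hA hL j).mem_cell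
    (vertex_isVertex hA hL i).mem_cell

theorem vertex_below_snd {i j : A.Stratum L e₀} (h : i ≤ j) :
    A.Below (vertex hA hL j).2.1 (vertex hA hL i).2.1 :=
  Below.of_le j.pair.isFace i.pair.isFace h.2.1 (vertex_isVertex hA hL j).mem_face
    (vertex_isVertex hA hL i).mem_face

theorem le_of_min {m : Fin (n + 1)} (hm : ∀ j, 0 < t j → m ≤ j) {j : Fin (n + 1)} (hj : t j ≠ 0) :
    σ m ≤ σ j := σ.monotone (hm j (lt_of_le_of_ne (t.2.1 j) (Ne.symm hj)))

/-- On the hyperplanes containing the face `G` of the smallest stratum `(F, [G, C])` of a simplex, the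
direction of the barycenter lies on the same side as `C`. -/
theorem center_sign_thd {m : Fin (n + 1)} (hm0 : 0 < t m) (hm : ∀ j, 0 < t j → m ≤ j) {f : Form d}
    (hf : f ∈ A.lift) (h0 : f (vertex hA hL (σ m)).2.1 = 0) {c : Vec d}
    (hc : c ∈ (σ m).pair.chamber) :
    SignType.sign (f.linear (center hA hL σ t).2.2) = SignType.sign (f c) := by
  rw [center_thd, linear_sum]
  refine sign_sum_eq' (weights_nonneg t) (fun j _ hj => ?_) (Finset.mem_univ m) hm0.ne'
  have hle : σ m ≤ σ j := le_of_min hm hj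
  obtain ⟨c', hc'⟩ := (σ j).pair.isChamber.1.nonempty
  rw [(vertex_isVertex hA hL (σ j)).sign_chamber f hf
    ((vertex_below_snd hA hL hle).eq_zero hf h0) c' hc']
  exact (hle.2.2 f hf ((σ m).pair.isFace.vanish (vertex_isVertex hA hL (σ m)).mem_face hf h0)
    c hc c' hc').symm

variable (σ t)

/-- The barycenter of a simplex of strata stays in the region when it is moved along the layer. -/
theorem center_add_inRegion (he : ∀ f ∈ A.lift, f.linear e₀ = 0 → ∀ u ∈ A.flat L, f.linear u = 0)
    {u : Vec d} (hu : u ∈ A.flat L) : InRegion e₀ hL (center hA hL σ t + (u, u, 0)) := by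
  obtain ⟨m, hm0, hm⟩ := Thickening.exists_min_pos t
  have hsign : ∀ f ∈ A.lift, f.linear e₀ ≠ 0 →
      SignType.sign (f.linear (center hA hL σ t).2.2) = SignType.sign (f.linear e₀) := by
    intro f hf hne
    rw [center_thd, linear_sum]
    exact sign_sum_eq' (weights_nonneg t)
      (fun j _ _ => (vertex_isVertex hA hL (σ j)).sign_eq f hf hne) (Finset.mem_univ m) hm0.ne'
  refine ⟨?_, ?_, fun f hf h0 => ?_, fun f hf hne => ?_⟩
  · refine realLayer_add hL ?_ hu
    have hmL := (σ m).subset_layer (vertex_isVertex hA hL (σ m)).mem_cell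
    have h1 : A.Below (center hA hL σ t).1 (vertex hA hL (σ m)).1 := by
      rw [center_fst]
      exact below_combination (weights_nonneg t) (weights_sum t) fun j _ hj =>
        vertex_below_fst hA hL (le_of_min hm hj)
    have := realLayer_add hL hmL (h1.sub_mem_flat hmL)
    rwa [add_sub_cancel] at this
  · change ‖(center hA hL σ t).2.1 + u - ((center hA hL σ t).1 + u)‖ < _
    rw [add_sub_add_right_eq_sub, center_fst, center_snd, ← Finset.sum_sub_distrib]
    simp only [← smul_sub]
    have := (convex_ball (0 : Vec d) (radius hL)).sum_mem (weights_nonneg t) (weights_sum t)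
      (z := fun j => (vertex hA hL (σ j)).2.1 - (vertex hA hL (σ j)).1)
      fun j _ => mem_ball_zero_iff.mpr (vertex_isVertex hA hL (σ j)).near
    exact mem_ball_zero_iff.mp this
  · change f ((center hA hL σ t).2.1 + u) = 0 at h0
    change f.linear ((center hA hL σ t).2.2 + 0) ≠ 0
    rw [add_zero]
    by_cases hne : f.linear e₀ = 0
    · rw [form_add, he f hf hne u hu, add_zero, center_snd] at h0
      have h1 := combination_eq_zero (weights_nonneg t) (weights_sum t)
        (fun j _ hj => vertex_below_snd hA hL (le_of_min (σ := σ) hm hj)) hf h0 (Finset.mem_univ m)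
        hm0.ne'
      obtain ⟨c, hc⟩ := (σ m).pair.isChamber.1.nonempty
      intro h2
      exact (σ m).pair.isChamber.2 f hf c hc
        ((sign_zero_iff (center_sign_thd hA hL hm0 hm hf h1 hc)).mp h2)
    · intro h2
      exact hne ((sign_zero_iff (hsign f hf hne)).mp h2)
  · change SignType.sign (f.linear ((center hA hL σ t).2.2 + 0)) = _
    rw [add_zero]
    exact hsign f hf hne

variable {σ t}

/-- All strata visible from a translate of the barycenter of a simplex have a common stratum above
the translate of the smallest stratum of the simplex. -/
theorem translate_le_meetStratum (i₀ : A.Stratum L e₀) (w : A.layerPeriods L) {m : Fin (n + 1)}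
    (hm0 : 0 < t m) (hm : ∀ j, 0 < t j → m ≤ j)
    (hmem : (center hA hL σ t + diag w).1 ∈ realLayer L) {B : Set (A.Stratum L e₀)}
    (hB : B.Nonempty) (h : ∀ i ∈ B, Sees i (center hA hL σ t + diag w)) :
    w +ᵥ σ m ≤ meetStratum hA hL i₀ B := by
  obtain ⟨S, rfl⟩ := (finite_of_sees h).exists_finset_coe
  have hadm : Admissible A L e₀ (average hA hL S) := average_admissible hB h hmem
  rw [meetStratum_coe i₀ hadm]
  have hv := vertex_isVertex hA hL (σ m)
  have b1 : A.Below (average hA hL S).1 (w.1.1 + (vertex hA hL (σ m)).1) := by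
    refine (average_below_fst hB h).trans ?_
    have h1 : A.Below (center hA hL σ t).1 (vertex hA hL (σ m)).1 := by
      rw [center_fst]
      exact below_combination (weights_nonneg t) (weights_sum t) fun j _ hj =>
        vertex_below_fst hA hL (le_of_min hm hj)
    have h2 := h1.vadd w.1
    rwa [add_comm w.1.1 (center hA hL σ t).1] at h2
  have b2 : A.Below (average hA hL S).2.1 (w.1.1 + (vertex hA hL (σ m)).2.1) := by
    refine (average_below_snd hB h).trans ?_
    have h1 : A.Below (center hA hL σ t).2.1 (vertex hA hL (σ m)).2.1 := by
      rw [center_snd]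
      exact below_combination (weights_nonneg t) (weights_sum t) fun j _ hj =>
        vertex_below_snd hA hL (le_of_min hm hj)
    have h2 := h1.vadd w.1
    rwa [add_comm w.1.1 (center hA hL σ t).2.1] at h2
  refine hadm.le_stratum hL (i := w +ᵥ σ m) ⟨_, hv.mem_cell, rfl⟩ ⟨_, hv.mem_face, rfl⟩ b1 b2 ?_
  rintro f hf h0 _ ⟨c, hc, rfl⟩
  rw [average_sign_thd hB h hf (b2.eq_zero hf h0)]
  obtain ⟨f', hf', a, ha, h1, h2⟩ := exists_translate w.1 hf
  have h0' : f (w.1.1 + (vertex hA hL (σ m)).2.1) = 0 := h0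
  rw [h1] at h0'
  change SignType.sign (f (w.1.1 + c)) = SignType.sign (f.linear ((center hA hL σ t).2.2 + 0))
  rw [add_zero, h1, h2, sign_mul, sign_mul,
    center_sign_thd hA hL hm0 hm hf' ((mul_eq_zero.mp h0').resolve_left ha) hc]

/-- The motion of the strata along the layer by a translation preserving the arrangement. -/
def flatMotion (he : ∀ f ∈ A.lift, f.linear e₀ = 0 → ∀ u ∈ A.flat L, f.linear u = 0)
    (i₀ : A.Stratum L e₀) (w : A.periods) (hw : w.1 ∈ A.flat L) : (thickening hA hL i₀).Motion where
  shift := diag (flatPeriod hL w hw)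
  toHom := ⟨fun i => flatPeriod hL w hw +ᵥ i, fun _ _ h => Stratum.vadd_mono _ h⟩
  mem_region σ t := center_add_inRegion hA hL σ t he hw
  le_meet σ t m hm0 hm B hB h := by
    simp only [thickening_bump_pos] at h
    exact translate_le_meetStratum hA hL i₀ (flatPeriod hL w hw) hm0 hm
      (center_add_inRegion hA hL σ t he hw).mem hB h

end Motion

end ToricArrangement

end

section

variable {d : ℕ}

namespace ToricArrangement

variable {A : ToricArrangement d}

/-! ### Faces seen from a smaller face -/

/-- The directions from the face `F` to a larger face `K`, as a face of the local arrangement. -/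
def dirCell (A : ToricArrangement d) (F K : Set (Vec d)) : Set (Vec d) :=
  {u | ∀ f ∈ A.lift, (∀ a ∈ F, f a = 0) → ∀ g ∈ K, SignType.sign (f.linear u) = SignType.sign (f g)}

theorem dirCell_period (w : A.periods) (F K : Set (Vec d)) :
    dirCell A (w.1 +ᵥ F) (w.1 +ᵥ K) = dirCell A F K := by
  have key : ∀ (w : A.periods) (F K : Set (Vec d)),
      dirCell A F K ⊆ dirCell A (w.1 +ᵥ F) (w.1 +ᵥ K) := by
    rintro w F K u hu f hf h0 _ ⟨g, hg, rfl⟩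
    obtain ⟨f', hf', c, hc, h1, h2⟩ := exists_translate w hf
    change _ = SignType.sign (f (w.1 + g))
    rw [h1, h2, sign_mul, sign_mul, hu f' hf' (fun a ha => ?_) g hg]
    have h3 : f (w.1 + a) = 0 := h0 _ ⟨a, ha, rfl⟩
    rw [h1] at h3
    exact (mul_eq_zero.mp h3).resolve_left hc
  refine subset_antisymm ?_ (key w F K)
  have h := key (-w) (w.1 +ᵥ F) (w.1 +ᵥ K)
  have hneg : (-w : A.periods).1 = -w.1 := rfl
  rwa [hneg, neg_vadd_vadd, neg_vadd_vadd] at h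

section Unstar

variable {F : A.Cell} {K K' : Set (Vec d)}

theorem dirCell_eq_signCell (hK : IsFace A.lift K) {a g : Vec d} (ha : a ∈ F.carrier) (hg : g ∈ K) :
    dirCell A F.carrier K = signCell (localForms A.lift F.carrier) (g - a) := by
  ext u
  constructor
  · rintro hu _ ⟨f, hf, h0, rfl⟩
    change SignType.sign (f.linear u) = SignType.sign (f.linear (g - a))
    rw [form_sub, h0 a ha, sub_zero]
    exact hu f hf h0 g hg
  · intro hu f hf h0 g' hg'
    have h1 : SignType.sign (f.linear u) = SignType.sign (f.linear (g - a)) := hu _ ⟨f, hf, h0, rfl⟩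
    rw [h1, form_sub, h0 a ha, sub_zero]
    exact hK.sign_eq hg hg' hf

theorem dirCell_isFace (hK : IsFace A.lift K) :
    IsFace (localForms A.lift F.carrier) (dirCell A F.carrier K) := by
  obtain ⟨a, ha⟩ := F.isFace.nonempty
  obtain ⟨g, hg⟩ := hK.nonempty
  exact ⟨_, dirCell_eq_signCell hK ha hg⟩

theorem sub_mem_dirCell (hK : IsFace A.lift K) {a g : Vec d} (ha : a ∈ F.carrier) (hg : g ∈ K) :
    g - a ∈ dirCell A F.carrier K := by
  rw [dirCell_eq_signCell hK ha hg]
  exact mem_signCell_self _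

theorem dirCell_isChamber (hK : IsChamber A.lift K) :
    IsChamber (localForms A.lift F.carrier) (dirCell A F.carrier K) := by
  refine ⟨dirCell_isFace hK.1, ?_⟩
  rintro _ ⟨f, hf, h0, rfl⟩ u hu h1
  obtain ⟨g, hg⟩ := hK.1.nonempty
  exact hK.2 f hf g hg ((sign_zero_iff (hu f hf h0 g hg)).mp h1)

theorem dirCell_le (hK : IsFace A.lift K) (hK' : IsFace A.lift K') (h : K ⊆ closure K') :
    dirCell A F.carrier K ⊆ closure (dirCell A F.carrier K') := by
  obtain ⟨a, ha⟩ := F.isFace.nonempty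
  obtain ⟨g, hg⟩ := hK.nonempty
  obtain ⟨g', hg'⟩ := hK'.nonempty
  refine (face_le_iff (dirCell_isFace hK) (dirCell_isFace hK') (sub_mem_dirCell hK ha hg)
    (sub_mem_dirCell hK' ha hg')).mpr ?_
  rintro _ ⟨f, hf, h0, rfl⟩ hne
  change f.linear (g - a) ≠ 0 at hne
  change SignType.sign (f.linear (g - a)) = SignType.sign (f.linear (g' - a))
  rw [form_sub, h0 a ha, sub_zero] at hne ⊢
  rw [form_sub, h0 a ha, sub_zero]
  exact (face_le_iff hK hK' hg hg').mp h f hf hne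

theorem glue_dirCell (hK : IsFace A.lift K) (h : F.carrier ⊆ closure K) :
    glue A.lift F.carrier (dirCell A F.carrier K) = K := by
  obtain ⟨a, ha⟩ := F.isFace.nonempty
  obtain ⟨g, hg⟩ := hK.nonempty
  refine ((isLocal_star F).isFace (dirCell_isFace hK)).eq_of_mem hK (x := g) ?_ hg
  refine ⟨a, ha, g - a, sub_mem_dirCell hK ha hg, fun f hf => ?_⟩
  split_ifs with h0
  · rw [form_sub, h0, sub_zero]
  · exact ((face_le_iff F.isFace hK ha hg).mp h f hf h0).symm

theorem dirCell_glue {E : Set (Form d)} (hE : E = localForms A.lift F.carrier) (hK : IsFace E K) :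
    dirCell A F.carrier (glue A.lift F.carrier K) = K := by
  subst hE
  obtain ⟨a, ha⟩ := F.isFace.nonempty
  obtain ⟨v, hv⟩ := hK.nonempty
  have hloc := isLocal_star F
  obtain ⟨u, hu⟩ := hloc.exists_mem hK
  rw [dirCell_eq_signCell (hloc.isFace hK) ha hu, hK.eq_signCell hv]
  have hs := (hloc.mem_glue_iff hK ha hv).mp hu
  have h1 : ∀ f ∈ localForms A.lift F.carrier,
      SignType.sign (f (u - a)) = SignType.sign (f v) := by
    rintro _ ⟨f, hf, h0, rfl⟩
    change SignType.sign (f.linear (u - a)) = SignType.sign (f.linear v)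
    rw [form_sub, h0 a ha, sub_zero, hs f hf, if_pos (h0 a ha)]
  ext y
  exact forall₂_congr fun f hf => by rw [h1 f hf]

variable (F) in
/-- The pair of the local arrangement at `F` that is the direction of a pair of the whole
arrangement. -/
def unstar {E : Set (Form d)} (hE : E = localForms A.lift F.carrier) (x : Sal A.lift) : Sal E where
  face := dirCell A F.carrier x.face
  chamber := dirCell A F.carrier x.chamber
  isFace := hE ▸ dirCell_isFace x.isFace
  isChamber := hE ▸ dirCell_isChamber x.isChamber
  le := dirCell_le x.isFace x.isChamber.1 x.le

theorem star_unstar {E : Set (Form d)} (hE : E = localForms A.lift F.carrier) {x : Sal A.lift}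
    (h : F.carrier ⊆ closure x.face) : star F hE (unstar F hE x) = x :=
  Sal.ext (glue_dirCell x.isFace h)
    (glue_dirCell x.isChamber.1 (face_le_trans h x.le))

theorem unstar_star {E : Set (Form d)} (hE : E = localForms A.lift F.carrier) (y : Sal E) :
    unstar F hE (star F hE y) = y :=
  Sal.ext (dirCell_glue hE y.isFace) (dirCell_glue hE y.isChamber.1)

theorem unstar_mono {E : Set (Form d)} (hE : E = localForms A.lift F.carrier) {x x' : Sal A.lift}
    (h : x ≤ x') : unstar F hE x ≤ unstar F hE x' := by
  refine ⟨dirCell_le x'.isFace x.isFace h.1, ?_⟩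
  subst hE
  rintro _ ⟨f, hf, h0, rfl⟩ hv c hc c' hc'
  obtain ⟨b, hb⟩ := x.isChamber.1.nonempty
  obtain ⟨b', hb'⟩ := x'.isChamber.1.nonempty
  obtain ⟨a, ha⟩ := F.isFace.nonempty
  change SignType.sign (f.linear c) = SignType.sign (f.linear c')
  rw [hc f hf h0 b hb, hc' f hf h0 b' hb']
  refine h.2 f hf (fun g hg => ?_) b hb b' hb'
  have h1 : f.linear (g - a) = 0 := hv _ (sub_mem_dirCell x.isFace ha hg)
  rwa [form_sub, h0 a ha, sub_zero] at h1

theorem le_of_star_le {E : Set (Form d)} (hE : E = localForms A.lift F.carrier) {y y' : Sal E}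
    (h : star F hE y ≤ star F hE y') : y ≤ y' := by
  rw [← unstar_star hE y, ← unstar_star hE y']
  exact unstar_mono hE h

theorem le_star {E : Set (Form d)} (hE : E = localForms A.lift F.carrier) (y : Sal E) :
    F.carrier ⊆ closure (star F hE y).face := by
  subst hE
  obtain ⟨a, ha⟩ := F.isFace.nonempty
  obtain ⟨v, hv⟩ := y.isFace.nonempty
  have hloc := isLocal_star F
  obtain ⟨u, hu⟩ := hloc.exists_mem y.isFace
  refine (face_le_iff F.isFace (hloc.isFace y.isFace) ha hu).mpr fun f hf hne => ?_
  rw [(hloc.mem_glue_iff y.isFace ha hv).mp hu f hf, if_neg hne]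

end Unstar

/-! ### The objects of the subcomplexes -/

/-- The chamber `C` lies in the direction `e₀` from each hyperplane of the linear arrangement `E`
that contains `G` but not `e₀`. -/
def DirectedAlong {E : Set (Form d)} (e₀ : Vec d) (y : Sal E) : Prop :=
  ∀ f ∈ E, (∀ x ∈ y.face, f x = 0) → f e₀ ≠ 0 → ∀ c ∈ y.chamber,
    SignType.sign (f c) = SignType.sign (f e₀)

theorem localForms_subset_linear (W : Set (Vec d)) : localForms A.lift W ⊆ A.linear := by
  rintro _ ⟨_, ⟨p, hp, c, -, rfl⟩, -, rfl⟩
  exact ⟨p, hp, by rw [affForm_linear]⟩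

theorem lift_linear_mem {f : Form d} (hf : f ∈ A.lift) : f.linear.toAffineMap ∈ A.linear := by
  obtain ⟨p, hp, c, -, rfl⟩ := hf
  exact ⟨p, hp, by rw [affForm_linear]⟩

theorem sign_eq_of_mem_closure {E : Set (Form d)} {C : Set (Vec d)} (hC : IsFace E C) {x y : Vec d}
    (hx : x ∈ closure C) (hy : y ∈ C) {f : Form d} (hf : f ∈ E) (hne : f x ≠ 0) :
    SignType.sign (f x) = SignType.sign (f y) := by
  rcases lt_or_gt_of_ne hne with hlt | hgt
  · obtain ⟨z, hz, hzC⟩ := mem_closure_iff.mp hx {z | f z < 0}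
      (isOpen_lt (form_continuous f) continuous_const) hlt
    rw [← hC.sign_eq hzC hy hf, sign_neg hlt, sign_neg hz]
  · obtain ⟨z, hz, hzC⟩ := mem_closure_iff.mp hx {z | 0 < f z}
      (isOpen_lt continuous_const (form_continuous f)) hgt
    rw [← hC.sign_eq hzC hy hf, sign_pos hgt, sign_pos hz]

/-- A pair `[G, C]` is of the form `[G, B_G]` with `B ≥ F₀` if and only if `C` lies in the direction
of `F₀` from the hyperplanes containing `G`. -/
theorem exists_chamber_iff {F₀ W : Set (Vec d)} (hF₀ : IsFace A.linear F₀) {e₀ : Vec d}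
    (he₀ : e₀ ∈ F₀) (y : Sal (localForms A.lift W)) :
    (∃ B, IsChamber (localForms A.lift W) B ∧ F₀ ⊆ closure B ∧
      AgreeAt (localForms A.lift W) y.face B y.chamber) ↔ DirectedAlong e₀ y := by
  constructor
  · rintro ⟨B, hB, hle, hag⟩ f hf h0 hne c hc
    obtain ⟨b, hb⟩ := hB.1.nonempty
    rw [← hag f hf h0 b hb c hc]
    exact (sign_eq_of_mem_closure hB.1 (hle he₀) hb hf hne).symm
  · intro h
    obtain ⟨c, hc⟩ := y.isChamber.1.nonempty
    obtain ⟨ε, hε, hε0⟩ := ((locFin_localForms W e₀ c).and self_mem_nhdsWithin).exists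
    have hval : ∀ f ∈ localForms A.lift W, f e₀ = 0 →
        SignType.sign (f (e₀ + ε • c)) = SignType.sign (f c) := by
      rintro _ ⟨f, hf, -, rfl⟩ h0
      change f.linear e₀ = 0 at h0
      change SignType.sign (f.linear (e₀ + ε • c)) = SignType.sign (f.linear c)
      rw [map_add, h0, zero_add, map_smul, smul_eq_mul]
      exact sign_mul_eq hε0
    have hface : IsFace (localForms A.lift W) (signCell (localForms A.lift W) (e₀ + ε • c)) :=
      ⟨_, rfl⟩
    refine ⟨_, ⟨hface, fun f hf x hx h0 => ?_⟩, ?_, fun f hf h0 b hb c' hc' => ?_⟩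
    · have h1 := (sign_zero_iff (hx f hf)).mp h0
      by_cases he : f e₀ = 0
      · exact y.isChamber.2 f hf c hc ((sign_zero_iff (hval f hf he)).mp h1)
      · exact he ((sign_zero_iff (hε f hf he)).mp h1)
    · have h1 : F₀ ⊆ signCell (localForms A.lift W) e₀ := fun x hx f hf =>
        hF₀.sign_eq hx he₀ (localForms_subset_linear W hf)
      refine h1.trans ((face_le_iff ⟨e₀, rfl⟩ hface (mem_signCell_self _)
        (mem_signCell_self _)).mpr fun f hf hne => (hε f hf hne).symm)
    · rw [hb f hf, y.isChamber.1.sign_eq hc' hc hf]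
      by_cases he : f e₀ = 0
      · exact hval f hf he
      · rw [hε f hf he, h f hf h0 he c hc]

theorem subcomplexObj_iff {L : Set (Torus d)} {F₀ : Set (Vec d)} (hF₀ : IsFace A.linear F₀)
    {e₀ : Vec d} (he₀ : e₀ ∈ F₀) (X : A.ToricSal) : A.subcomplexObj L F₀ X ↔
      X.base.rep.carrier ⊆ realLayer L ∧ DirectedAlong e₀ X.pair :=
  and_congr toSet_subset_iff (exists_chamber_iff hF₀ he₀ X.pair)

/-- Translations map the subcomplex of a layer and a direction to the one of the translated layer and
the same direction. -/
theorem toricFunctor_subcomplexObj (v : A.periods) {L : Set (Torus d)} {F₀ : Set (Vec d)}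
    {X : A.ToricSal} (h : A.subcomplexObj L F₀ X) :
    A.subcomplexObj (toTorus (v.1, 0) • L) F₀ ((toricFunctor v).obj X) := by
  obtain ⟨h1, B, hB, hF, hag⟩ := h
  refine ⟨?_, B, (localArr_moveFace v X.base).isChamber hB, hF,
    (localArr_moveFace v X.base).agreeAt hag⟩
  change (moveFace v X.base).toSet ⊆ _
  rw [toSet_moveFace]
  exact Set.smul_set_mono h1

/-! ### The poset of strata as a covering of the subcomplex -/

section Covering

variable {L : Set (Torus d)} {F₀ : Set (Vec d)} {e₀ : Vec d}

/-- The shift of a face to the representative of its orbit. -/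
abbrev cellShift (F : A.Cell) : Fin d → ℤ := OrbitCat.shift (Fin d → ℤ) F

namespace Stratum

theorem rep_le (i : A.Stratum L e₀) :
    (OrbitCat.mk' (Fin d → ℤ) i.cell).rep.carrier ⊆ closure (cellShift i.cell +ᵥ i.pair).face := by
  rw [← OrbitCat.shift_vadd]
  exact le_vadd i.le _

/-- The object of `∫ D` of a stratum. -/
def toSal (i : A.Stratum L e₀) : A.ToricSal :=
  ToricSal.mk (OrbitCat.mk' (Fin d → ℤ) i.cell)
    (unstar (OrbitCat.mk' (Fin d → ℤ) i.cell).rep rfl (cellShift i.cell +ᵥ i.pair))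

theorem toSal_face (i : A.Stratum L e₀) :
    i.toSal.pair.face = dirCell A i.cell.carrier i.pair.face := by
  change dirCell A (OrbitCat.mk' (Fin d → ℤ) i.cell).rep.carrier _ = _
  rw [← OrbitCat.shift_vadd]
  exact dirCell_period (intPeriod (cellShift i.cell)) _ _

theorem toSal_chamber (i : A.Stratum L e₀) :
    i.toSal.pair.chamber = dirCell A i.cell.carrier i.pair.chamber := by
  change dirCell A (OrbitCat.mk' (Fin d → ℤ) i.cell).rep.carrier _ = _
  rw [← OrbitCat.shift_vadd]
  exact dirCell_period (intPeriod (cellShift i.cell)) _ _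

theorem toSal_property (hF₀ : IsFace A.linear F₀) (he₀ : e₀ ∈ F₀) (i : A.Stratum L e₀) :
    A.subcomplexObj L F₀ i.toSal := by
  have hrep : (OrbitCat.mk' (Fin d → ℤ) i.cell).rep.carrier =
      intVec (cellShift i.cell) +ᵥ i.cell.carrier := by
    rw [← OrbitCat.shift_vadd]
    rfl
  refine (subcomplexObj_iff hF₀ he₀ _).mpr ⟨?_, ?_⟩
  · change (OrbitCat.mk' (Fin d → ℤ) i.cell).rep.carrier ⊆ _
    rw [hrep]
    rintro _ ⟨x, hx, rfl⟩
    exact (realLayer_add_int _).mpr (i.subset_layer hx)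
  · rintro f hf h0 hne c hc
    have hf' : f ∈ localForms A.lift i.cell.carrier := by
      have hf1 : f ∈ localForms A.lift (OrbitCat.mk' (Fin d → ℤ) i.cell).rep.carrier := hf
      rwa [hrep, localForms_vadd] at hf1
    rw [toSal_face] at h0
    rw [toSal_chamber] at hc
    obtain ⟨f, hfl, hv, rfl⟩ := hf'
    obtain ⟨b, hb⟩ := i.pair.isChamber.1.nonempty
    obtain ⟨a, ha⟩ := i.cell.isFace.nonempty
    change SignType.sign (f.linear c) = SignType.sign (f.linear e₀)
    rw [hc f hfl hv b hb]
    refine i.sign_eq f hfl (fun x hx => ?_) hne b hb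
    have h1 : f.linear (x - a) = 0 := h0 _ (sub_mem_dirCell i.pair.isFace ha hx)
    rwa [form_sub, hv a ha, sub_zero] at h1

/-- The morphism of `∫ D` of a relation between strata. -/
def toSalHom {i j : A.Stratum L e₀} (h : i ≤ j) : i.toSal ⟶ j.toSal :=
  ToricSal.homMk (X := i.toSal) (Y := j.toSal)
    ⟨cellShift i.cell - cellShift j.cell, by
      change _ +ᵥ (OrbitCat.mk' (Fin d → ℤ) j.cell).rep ≤ (OrbitCat.mk' (Fin d → ℤ) i.cell).rep
      rw [← OrbitCat.shift_vadd, ← OrbitCat.shift_vadd, ← add_vadd, sub_add_cancel]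
      exact OrbitCat.vadd_le_vadd' _ h.1⟩ (by
    refine le_of_star_le (F := (OrbitCat.mk' (Fin d → ℤ) j.cell).rep) rfl ?_
    let m : j.toSal.base ⟶ i.toSal.base := ⟨cellShift i.cell - cellShift j.cell, by
      change _ +ᵥ (OrbitCat.mk' (Fin d → ℤ) j.cell).rep ≤ (OrbitCat.mk' (Fin d → ℤ) i.cell).rep
      rw [← OrbitCat.shift_vadd, ← OrbitCat.shift_vadd, ← add_vadd, sub_add_cancel]
      exact OrbitCat.vadd_le_vadd' _ h.1⟩
    have h1 : star i.toSal.base.rep rfl i.toSal.pair = cellShift i.cell +ᵥ i.pair :=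
      star_unstar rfl i.rep_le
    have h2 : star j.toSal.base.rep rfl j.toSal.pair = cellShift j.cell +ᵥ j.pair :=
      star_unstar rfl j.rep_le
    have h3 := star_transition m i.toSal.pair
    have h4 : star j.toSal.base.rep rfl (transition m i.toSal.pair) =
        cellShift j.cell +ᵥ i.pair := by
      have h5 : -m.1 +ᵥ star i.toSal.base.rep rfl i.toSal.pair =
          star j.toSal.base.rep rfl (transition m i.toSal.pair) := by
        rw [h3, neg_vadd_vadd]
      rw [← h5, h1, ← add_vadd]
      congr 1
      change -(cellShift i.cell - cellShift j.cell) + cellShift i.cell = _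
      abel
    change star j.toSal.base.rep rfl (transition m i.toSal.pair) ≤
      star j.toSal.base.rep rfl j.toSal.pair
    rw [h4, h2]
    exact OrbitCat.vadd_le_vadd' _ h.2)

end Stratum

variable (L) in
/-- The projection from the poset of strata to the subcomplex. -/
def strataProj (hF₀ : IsFace A.linear F₀) (he₀ : e₀ ∈ F₀) :
    A.Stratum L e₀ ⥤ A.Subcomplex L F₀ where
  obj i := ⟨i.toSal, i.toSal_property hF₀ he₀⟩
  map h := ObjectProperty.homMk (Stratum.toSalHom (leOfHom h))
  map_id i := by
    apply ObjectProperty.hom_ext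
    apply ToricSal.hom_ext
    change cellShift i.cell - cellShift i.cell = (0 : Fin d → ℤ)
    rw [sub_self]
  map_comp {i j k} h h' := by
    apply ObjectProperty.hom_ext
    apply ToricSal.hom_ext
    change cellShift i.cell - cellShift k.cell =
      cellShift i.cell - cellShift j.cell + (cellShift j.cell - cellShift k.cell)
    abel

theorem subcomplex_obj_ext {X Y : A.Subcomplex L F₀} (h : X.obj.base = Y.obj.base)
    (h1 : X.obj.pair.face = Y.obj.pair.face) (h2 : X.obj.pair.chamber = Y.obj.pair.chamber) :
    X = Y := ObjectProperty.FullSubcategory.ext (ToricSal.obj_ext h h1 h2)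

theorem subcomplex_hom_heq {X Y X' Y' : A.Subcomplex L F₀} (hX : X = X') (hY : Y = Y') {f : X ⟶ Y}
    {f' : X' ⟶ Y'} (h : f.hom.base.unop.1 = f'.hom.base.unop.1) : HEq f f' := by
  subst hX hY
  exact heq_of_eq (ObjectProperty.hom_ext _ (ToricSal.hom_ext h))

theorem strataProj_vadd_obj (hF₀ : IsFace A.linear F₀) (he₀ : e₀ ∈ F₀) (k : Fin d → ℤ)
    (i : A.Stratum L e₀) : (strataProj L hF₀ he₀).obj ((intLayerPeriod k : A.layerPeriods L) +ᵥ i) =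
      (strataProj L hF₀ he₀).obj i := by
  refine subcomplex_obj_ext (OrbitCat.mk'_vadd k i.cell) ?_ ?_
  · change (Stratum.toSal _).pair.face = (Stratum.toSal _).pair.face
    rw [Stratum.toSal_face, Stratum.toSal_face]
    exact dirCell_period (intPeriod k) _ _
  · change (Stratum.toSal _).pair.chamber = (Stratum.toSal _).pair.chamber
    rw [Stratum.toSal_chamber, Stratum.toSal_chamber]
    exact dirCell_period (intPeriod k) _ _

/-- The chosen stratum over an object of the subcomplex. -/
def stratumOf (hF₀ : IsFace A.linear F₀) (he₀ : e₀ ∈ F₀) (X : A.Subcomplex L F₀) :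
    A.Stratum L e₀ where
  cell := X.obj.base.rep
  pair := star X.obj.base.rep rfl X.obj.pair
  subset_layer := ((subcomplexObj_iff hF₀ he₀ _).mp X.property).1
  le := le_star rfl _
  sign_eq := by
    intro f hf h0 hne c hc
    have hloc := isLocal_star X.obj.base.rep
    obtain ⟨a, ha⟩ := X.obj.base.rep.isFace.nonempty
    obtain ⟨v, hv⟩ := X.obj.pair.isFace.nonempty
    obtain ⟨b, hb⟩ := X.obj.pair.isChamber.1.nonempty
    obtain ⟨u, hu⟩ := hloc.exists_mem X.obj.pair.isFace
    have hfa : ∀ x ∈ X.obj.base.rep.carrier, f x = 0 :=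
      vanish_of_le X.obj.base.rep.isFace (hloc.isFace X.obj.pair.isFace)
        (le_star (F := X.obj.base.rep) rfl X.obj.pair) hf h0
    have h1 := (hloc.mem_glue_iff X.obj.pair.isFace ha hv).mp hu f hf
    have h2 := (hloc.mem_glue_iff X.obj.pair.isChamber.1 ha hb).mp hc f hf
    rw [if_pos (hfa a ha)] at h1 h2
    have hmem : f.linear.toAffineMap ∈ A.localArr X.obj.base := ⟨f, hf, hfa, rfl⟩
    rw [h2]
    refine ((subcomplexObj_iff hF₀ he₀ _).mp X.property).2 _ hmem ?_ hne b hb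
    exact X.obj.pair.isFace.vanish hv hmem ((sign_zero_iff h1).mp (h0 u hu))

/-- The translation from the representative of the face of a later vertex of a simplex towards the
representative of the face of an earlier one. -/
def edgeShift {n : ℕ} (s : ComposableArrows (A.Subcomplex L F₀) n) {i j : Fin (n + 1)} (h : i ≤ j) :
    Fin d → ℤ := (s.map (homOfLE h)).hom.base.unop.1

theorem edgeShift_trans {n : ℕ} (s : ComposableArrows (A.Subcomplex L F₀) n) {i j k : Fin (n + 1)}
    (h : i ≤ j) (h' : j ≤ k) : edgeShift s (h.trans h') = edgeShift s h + edgeShift s h' := by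
  have h1 : s.map (homOfLE (h.trans h')) = s.map (homOfLE h) ≫ s.map (homOfLE h') := by
    rw [← s.map_comp]
    rfl
  unfold edgeShift
  rw [h1]
  rfl

theorem stratumOf_le (hF₀ : IsFace A.linear F₀) (he₀ : e₀ ∈ F₀) {X Y : A.Subcomplex L F₀}
    (f : X ⟶ Y) : stratumOf hF₀ he₀ X ≤
      (intLayerPeriod f.hom.base.unop.1 : A.layerPeriods L) +ᵥ stratumOf hF₀ he₀ Y := by
  refine ⟨f.hom.base.unop.2, ?_⟩
  change star X.obj.base.rep rfl X.obj.pair ≤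
    f.hom.base.unop.1 +ᵥ star Y.obj.base.rep rfl Y.obj.pair
  refine (le_of_eq (star_transition f.hom.base.unop X.obj.pair)).trans ?_
  exact OrbitCat.vadd_le_vadd' _ ((star Y.obj.base.rep rfl).monotone (ToricSal.hom_le f.hom))

theorem intLayerPeriod_add (k l : Fin d → ℤ) :
    (intLayerPeriod (k + l) : A.layerPeriods L) = intLayerPeriod k + intLayerPeriod l :=
  Subtype.ext (Subtype.ext (intVec_add k l))

/-- The lift of a simplex of the subcomplex to a chain of strata, starting at the chosen one over the
first vertex. -/
def strataLift (hF₀ : IsFace A.linear F₀) (he₀ : e₀ ∈ F₀) {n : ℕ}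
    (s : ComposableArrows (A.Subcomplex L F₀) n) : Fin (n + 1) →o A.Stratum L e₀ where
  toFun i := (intLayerPeriod (edgeShift s (Fin.zero_le i)) : A.layerPeriods L) +ᵥ
    stratumOf hF₀ he₀ (s.obj i)
  monotone' i j h := by
    change (intLayerPeriod (edgeShift s (Fin.zero_le i)) : A.layerPeriods L) +ᵥ
        stratumOf hF₀ he₀ (s.obj i) ≤
      (intLayerPeriod (edgeShift s (Fin.zero_le j)) : A.layerPeriods L) +ᵥ
        stratumOf hF₀ he₀ (s.obj j)
    rw [edgeShift_trans s (Fin.zero_le i) h, intLayerPeriod_add, add_vadd]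
    exact Stratum.vadd_mono _ (stratumOf_le hF₀ he₀ (s.map (homOfLE h)))

theorem shift_rep (hA : A.IsEssential) (F : A.FaceCat) : cellShift F.rep = 0 := by
  refine hA.cell_free _ F.rep ?_
  have := OrbitCat.shift_vadd (Γ := Fin d → ℤ) F.rep
  rwa [OrbitCat.mk'_rep] at this

theorem strataProj_stratumOf (hF₀ : IsFace A.linear F₀) (he₀ : e₀ ∈ F₀) (X : A.Subcomplex L F₀) :
    (strataProj L hF₀ he₀).obj (stratumOf hF₀ he₀ X) = X := by
  refine subcomplex_obj_ext (OrbitCat.mk'_rep X.obj.base) ?_ ?_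
  · change (Stratum.toSal _).pair.face = _
    rw [Stratum.toSal_face]
    exact dirCell_glue (F := X.obj.base.rep) rfl X.obj.pair.isFace
  · change (Stratum.toSal _).pair.chamber = _
    rw [Stratum.toSal_chamber]
    exact dirCell_glue (F := X.obj.base.rep) rfl X.obj.pair.isChamber.1

theorem strataProj_strataLift (hA : A.IsEssential) (hF₀ : IsFace A.linear F₀) (he₀ : e₀ ∈ F₀) {n : ℕ}
    (s : ComposableArrows (A.Subcomplex L F₀) n) :
    (strataLift hF₀ he₀ s).monotone.functor ⋙ strataProj L hF₀ he₀ = s := by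
  have hobj : ∀ i, (strataProj L hF₀ he₀).obj (strataLift hF₀ he₀ s i) = s.obj i := fun i =>
    (strataProj_vadd_obj hF₀ he₀ _ _).trans (strataProj_stratumOf hF₀ he₀ _)
  refine CategoryTheory.Functor.hext hobj fun i j h => subcomplex_hom_heq (hobj i) (hobj j) ?_
  have hsh : ∀ i, cellShift (strataLift hF₀ he₀ s i).cell = -edgeShift s (Fin.zero_le i) := by
    intro i
    change OrbitCat.shift (Fin d → ℤ) (edgeShift s (Fin.zero_le i) +ᵥ (s.obj i).obj.base.rep) = _
    rw [OrbitCat.shift_vadd_eq hA.cell_free]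
    change cellShift (s.obj i).obj.base.rep - _ = _
    rw [shift_rep hA, zero_sub]
  change cellShift (strataLift hF₀ he₀ s i).cell - cellShift (strataLift hF₀ he₀ s j).cell =
    edgeShift s (leOfHom h)
  rw [hsh, hsh, edgeShift_trans s (Fin.zero_le i) (leOfHom h)]
  abel

/-- The poset of strata covers the subcomplex, with group `ℤ^d`. -/
def strataCovering (hA : A.IsEssential) (hL : L ∈ A.layers) (hF₀ : IsFace A.linear F₀)
    (he₀ : e₀ ∈ F₀) (i₀ : A.Stratum L e₀) :
    Thickening.Covering (A.Subcomplex L F₀) (thickening hA hL i₀) where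
  proj := strataProj L hF₀ he₀
  lift s := strataLift hF₀ he₀ s
  lift_proj s := strataProj_strataLift hA hF₀ he₀ s
  deck κ := ∃ k, κ = layerSymmetry hA hL i₀ (intLayerPeriod k)
  deck_proj := by
    rintro _ ⟨k, rfl⟩
    refine CategoryTheory.Functor.hext (strataProj_vadd_obj hF₀ he₀ k) fun i j h =>
      subcomplex_hom_heq (strataProj_vadd_obj hF₀ he₀ k i) (strataProj_vadd_obj hF₀ he₀ k j) ?_
    change OrbitCat.shift (Fin d → ℤ) (k +ᵥ i.cell) - OrbitCat.shift (Fin d → ℤ) (k +ᵥ j.cell) =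
      cellShift i.cell - cellShift j.cell
    rw [OrbitCat.shift_vadd_eq hA.cell_free, OrbitCat.shift_vadd_eq hA.cell_free]
    abel
  lift_reindex θ s := by
    refine ⟨_, ⟨edgeShift s (Fin.zero_le (θ 0)), rfl⟩, ?_⟩
    ext1
    funext i
    change (intLayerPeriod (edgeShift s (Fin.zero_le (θ i))) : A.layerPeriods L) +ᵥ
        stratumOf hF₀ he₀ (s.obj (θ i)) =
      (intLayerPeriod (edgeShift s (Fin.zero_le (θ 0))) : A.layerPeriods L) +ᵥ
        ((intLayerPeriod (edgeShift (reindex θ s) (Fin.zero_le i)) : A.layerPeriods L) +ᵥ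
          stratumOf hF₀ he₀ (s.obj (θ i)))
    rw [← add_vadd, ← intLayerPeriod_add, edgeShift_trans s (Fin.zero_le (θ 0))
      (θ.monotone (Fin.zero_le i))]
    rfl

/-- The self-map of the subcomplex given by a translation preserving the layer. -/
def restrictedFunctor (v : A.periods) (hv : toTorus (v.1, 0) • L = L) (F₀ : Set (Vec d)) :
    A.Subcomplex L F₀ ⥤ A.Subcomplex L F₀ :=
  (A.subcomplexObj L F₀).lift ((A.subcomplexObj L F₀).ι ⋙ toricFunctor v) fun X => by
    have h := toricFunctor_subcomplexObj v X.property
    rwa [hv] at h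

/-- Moving the strata along the layer covers the self-map of the subcomplex. -/
theorem strataProj_move (hA : A.IsEssential) (hL : L ∈ A.layers) (hF₀ : IsFace A.linear F₀)
    (he₀ : e₀ ∈ F₀) (v : A.periods) (hv : toTorus (v.1, 0) • L = L) (k : Fin d → ℤ)
    (hw : (intPeriod k + v : A.periods).1 ∈ A.flat L) (T : A.Stratum L e₀ →o A.Stratum L e₀)
    (hT : ∀ i, T i = flatPeriod hL (intPeriod k + v) hw +ᵥ i) :
    T.monotone.functor ⋙ strataProj L hF₀ he₀ =
      strataProj L hF₀ he₀ ⋙ restrictedFunctor v hv F₀ := by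
  have hcell : ∀ i, (T i).cell = k +ᵥ (v +ᵥ i.cell) := fun i => by
    rw [hT]
    exact add_vadd (intPeriod k : A.periods) v i.cell
  have hobj : ∀ i, (strataProj L hF₀ he₀).obj (T i) =
      (restrictedFunctor v hv F₀).obj ((strataProj L hF₀ he₀).obj i) := by
    intro i
    refine subcomplex_obj_ext ?_ ?_ ?_
    · change OrbitCat.mk' (Fin d → ℤ) (T i).cell = moveFace v (OrbitCat.mk' (Fin d → ℤ) i.cell)
      rw [hcell, OrbitCat.mk'_vadd, moveFace_mk]
    · change (Stratum.toSal _).pair.face = (Stratum.toSal i).pair.face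
      rw [Stratum.toSal_face, Stratum.toSal_face, hT]
      exact dirCell_period _ _ _
    · change (Stratum.toSal _).pair.chamber = (Stratum.toSal i).pair.chamber
      rw [Stratum.toSal_chamber, Stratum.toSal_chamber, hT]
      exact dirCell_period _ _ _
  refine CategoryTheory.Functor.hext hobj fun i j h => subcomplex_hom_heq (hobj i) (hobj j) ?_
  have hsh : ∀ F : A.Cell, OrbitCat.shift (Fin d → ℤ) (v +ᵥ (OrbitCat.mk' (Fin d → ℤ) F).rep) =
      OrbitCat.shift (Fin d → ℤ) (v +ᵥ F) - cellShift F := fun F => by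
    rw [← OrbitCat.shift_vadd, period_comm_cell, OrbitCat.shift_vadd_eq hA.cell_free]
  change cellShift (T i).cell - cellShift (T j).cell =
    OrbitCat.shift (Fin d → ℤ) (v +ᵥ (OrbitCat.mk' (Fin d → ℤ) i.cell).rep) +
      (cellShift i.cell - cellShift j.cell) -
      OrbitCat.shift (Fin d → ℤ) (v +ᵥ (OrbitCat.mk' (Fin d → ℤ) j.cell).rep)
  rw [hsh, hsh, hcell, hcell, cellShift, cellShift, OrbitCat.shift_vadd_eq hA.cell_free,
    OrbitCat.shift_vadd_eq hA.cell_free]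
  abel

/-- The self-map of the subcomplex of a layer given by a symmetry of the layer is homotopic to the
identity. -/
theorem restrictedFunctor_homotopic (hA : A.IsEssential) (hL : L ∈ A.layers)
    (hF₀ : IsFace A.linear F₀) (hspan : Submodule.span ℝ F₀ = A.flat L) (v : A.periods)
    (hv : toTorus (v.1, 0) • L = L) : ContinuousMap.Homotopic
      (realize (restrictedFunctor v hv F₀)).hom
      (ContinuousMap.id (Realization (A.Subcomplex L F₀))) := by
  obtain ⟨e₀, he₀⟩ := hF₀.nonempty
  rcases isEmpty_or_nonempty (A.Stratum L e₀) with hempty | ⟨⟨i₀⟩⟩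
  · have : (realize (restrictedFunctor v hv F₀)).hom =
        ContinuousMap.id (Realization (A.Subcomplex L F₀)) :=
      realization_hom_ext fun s _ => (hempty.false (stratumOf hF₀ he₀ (s.obj 0))).elim
    rw [this]
  have he : ∀ f ∈ A.lift, f.linear e₀ = 0 → ∀ u ∈ A.flat L, f.linear u = 0 := by
    intro f hf h0 u hu
    have h1 : F₀ ⊆ LinearMap.ker f.linear := fun x hx =>
      hF₀.vanish he₀ (lift_linear_mem hf) h0 x hx
    rw [← hspan] at hu
    exact Submodule.span_le.mpr h1 hu
  obtain ⟨k, hk⟩ := exists_int_sub_mem_flat (A := A) hL hv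
  have hw : (intPeriod k + v : A.periods).1 ∈ A.flat L := hk
  refine (strataCovering hA hL hF₀ he₀ i₀).homotopic_id
    (flatMotion hA hL he i₀ 0 (zero_mem _)) (flatMotion hA hL he i₀ (intPeriod k + v) hw) rfl ?_ ?_ ?_
    _ (strataProj_move hA hL hF₀ he₀ v hv k hw _ fun _ => rfl)
  · ext1
    funext i
    exact zero_vadd (A.layerPeriods L) i
  · rintro _ ⟨l, rfl⟩ i
    exact vadd_comm (flatPeriod hL (intPeriod k + v) hw) (intLayerPeriod l : A.layerPeriods L) i
  · intro n σ t s
    have h1 : (s : ℝ) • diag (flatPeriod hL (intPeriod k + v) hw) =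
        ((s : ℝ) • (intPeriod k + v : A.periods).1, (s : ℝ) • (intPeriod k + v : A.periods).1, 0) :=
      Prod.ext rfl (Prod.ext rfl (smul_zero _))
    change InRegion e₀ hL (center hA hL σ t + (s : ℝ) • diag (flatPeriod hL (intPeriod k + v) hw))
    rw [h1]
    exact center_add_inRegion hA hL σ t he ((A.flat L).smul_mem _ hw)

end Covering

end ToricArrangement

end

end ToricSalvetti
end

theorem mainTheorem9 {d : ℕ} (A : ToricSalvetti.ToricArrangement d) (hA : A.IsEssential)
    (g : ToricSalvetti.Torus d) (hg : A.IsInvariant g) :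
    -- there are choices of points equivariant under all translations preserving the arrangement
    (∃ p : A.PointChoice, ∀ w : ToricSalvetti.Vec d,
      A.IsInvariant (ToricSalvetti.toTorus (w, 0)) → p.IsEquivariantUnder w) ∧
    ∃ (v : ToricSalvetti.Vec d) (μ₁ : A.SalQuot ⥤ A.SalQuot) (μ : A.ToricSal ⥤ A.ToricSal),
      ToricSalvetti.toTorus (v, 0) = g ∧
      -- the map on `S(A^↾) / ℤ^d` is induced by the translation by `v`
      (∀ x : ToricSalvetti.Sal A.lift, ∃ y : ToricSalvetti.Sal A.lift,
        y.face = v +ᵥ x.face ∧ y.chamber = v +ᵥ x.chamber ∧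
        μ₁.obj (ToricSalvetti.OrbitCat.mk' (Fin d → ℤ) x) =
          ToricSalvetti.OrbitCat.mk' (Fin d → ℤ) y) ∧
      -- the map on `∫ D` is `(F, [G, C]) ↦ (g F, [G, C])`
      (∀ X : A.ToricSal, (μ.obj X).base.toSet = g • X.base.toSet ∧
        (μ.obj X).pair.face = X.pair.face ∧ (μ.obj X).pair.chamber = X.pair.chamber) ∧
      -- compatibility with multiplication by `g` on the complement
      (∀ p : A.PointChoice, p.IsEquivariantUnder v →
        (ToricSalvetti.ToricArrangement.mulComplement hg).comp
            (ToricSalvetti.ToricArrangement.inclusion p).hom =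
          (ToricSalvetti.ToricArrangement.inclusion p).hom.comp (ToricSalvetti.realize μ₁).hom) ∧
      (∀ p : A.PointChoice, ContinuousMap.Homotopic
        ((ToricSalvetti.ToricArrangement.mulComplement hg).comp
          (ToricSalvetti.ToricArrangement.inclusion p).hom)
        ((ToricSalvetti.ToricArrangement.inclusion p).hom.comp
          (ToricSalvetti.realize μ₁).hom)) ∧
      ToricSalvetti.realize μ ≫ ToricSalvetti.realize A.comparison =
        ToricSalvetti.realize A.comparison ≫ ToricSalvetti.realize μ₁ ∧
      -- the subcomplexes
      ∀ L ∈ A.layers, ∀ F₀ : Set (ToricSalvetti.Vec d), ToricSalvetti.IsFace A.linear F₀ →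
        Submodule.span ℝ F₀ = A.flat L →
        (∀ X, A.subcomplexObj L F₀ X → A.subcomplexObj (g • L) F₀ (μ.obj X)) ∧
        (g • L = L → ∃ ν : A.Subcomplex L F₀ ⥤ A.Subcomplex L F₀,
          ν ⋙ (A.subcomplexObj L F₀).ι = (A.subcomplexObj L F₀).ι ⋙ μ ∧
          ContinuousMap.Homotopic (ToricSalvetti.realize ν).hom
            (ContinuousMap.id (ToricSalvetti.Realization (A.Subcomplex L F₀)))) := by
  obtain ⟨v, hv⟩ := hA.exists_period hg
  refine ⟨?_, v.1, ToricSalvetti.ToricArrangement.salFunctor v,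
    ToricSalvetti.ToricArrangement.toricFunctor v, hv,
    fun x => ⟨v +ᵥ x, rfl, rfl, ToricSalvetti.ToricArrangement.moveSal_mk v x⟩,
    fun X => ⟨?_, rfl, rfl⟩, fun p hp => ?_, fun p => ?_, ?_, fun L hL F₀ hF₀ hspan => ⟨?_, ?_⟩⟩
  · obtain ⟨p, hp⟩ := hA.exists_pointChoice
    exact ⟨p, fun w hw => hp ⟨w, hw⟩⟩
  · have h := ToricSalvetti.ToricArrangement.toSet_moveFace v X.base
    rw [hv] at h
    exact h
  · have h := ToricSalvetti.ToricArrangement.inclusion_translate p v hg hv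
    rwa [ToricSalvetti.ToricArrangement.PointChoice.translate_eq hp] at h
  · rw [ToricSalvetti.ToricArrangement.inclusion_translate p v hg hv]
    exact (ToricSalvetti.ToricArrangement.inclusion_homotopic (p.translate v) p).comp
      (ContinuousMap.Homotopic.refl _)
  · have h := congrArg ToricSalvetti.realize
      (ToricSalvetti.ToricArrangement.toricFunctor_comparison hA v)
    unfold ToricSalvetti.realize at h ⊢
    rw [← Functor.map_comp, ← Functor.map_comp]
    exact h
  · intro X hX
    have h := ToricSalvetti.ToricArrangement.toricFunctor_subcomplexObj v hX
    rwa [hv] at h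
  · intro hgL
    rw [← hv] at hgL
    exact ⟨ToricSalvetti.ToricArrangement.restrictedFunctor v hgL F₀, rfl,
      ToricSalvetti.ToricArrangement.restrictedFunctor_homotopic hA hL hF₀ hspan v hgL⟩
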